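/- **Setting.** Let $n\ge 2$ and $N\ge 1$ be integers, and let $\mathbb D^*=\mathbb D^*_{2n}\subset SU(2)$ be the binary dihedral group of order $4n$ generated by $$A=\begin{pmatrix}e^{i\pi/n}&0\\0&e^{-i\pi/n}\end{pmatrix},\qquad B=\begin{pmatrix}0&-1\\1&0\end{pmatrix}.$$ Let $\mathbb D=P(\mathbb D^*)\subset SO(3)$ be its image under the double cover $P:SU(2)\to SO(3)$ for which the Hopf fibration $$\mathfrak P:S^3\to S^2,\qquad \mathfrak P(\alpha,\beta)=(|\alpha|^2-|\beta|^2,\,-2\,\mathrm{Im}(\bar\alpha\beta),\,-2\,\mathrm{Re}(\bar\alpha\beta)),$$ is equivariant, and let $\mathfrak p:S^3/\mathbb D^*\to S^2/\mathbb D$ be the induced map. Let $\lambda=\frac i2\sum_k(z_k\,d\bar z_k-\bar z_k\,dz_k)$ restricted to $S^3$; this is the contact form whose Reeb flow is $z\mapsto e^{it}z$. Let $f:S^2\to\mathbb R$ be a smooth $\mathbb D$-invariant function whose set of critical points is the set of points fixed by some nontrivial element of $\mathbb D$. Assume that near each critical point, in suitable stereographic coordinates $(x,y)$ centred there (the map $(x,y)\mapsto\frac{(2x,\,2y,\,1-x^2-y^2)}{1+x^2+y^2}$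 followed by a rotation in $SO(3)$), $f$ equals * $\frac{x^2+y^2}2-1$ at the points $p_{-,k}=(0,\cos\frac{(2k+1)\pi}n,\sin\frac{(2k+1)\pi}n)$, $1\le k\le n$; * $\frac{x^2-y^2}2$ at the points $p_{h,k}=(0,\cos\frac{2k\pi}n,\sin\frac{2k\pi}n)$, $1\le k\le n$; * $1-\frac{x^2+y^2}2$ at the points $p_{+}=(\pm1,0,0)$. (Such $f$ is automatically Morse–Smale.) Each of the three families is one $\mathbb D$-orbit; let $p_-,p_h,p_+\in S^2/\mathbb D$ denote their images. For $\varepsilon>0$ small let $\lambda_{\mathbb D^*,\varepsilon}$ be the contact form on $S^3/\mathbb D^*$ whose pullback to $S^3$ is $(1+\varepsilon\,\mathfrak P^*f)\lambda$. Reeb orbits are closed Reeb trajectories $\gamma:\mathbb R/T\mathbb Z\to S^3/\mathbb D^*$, $T>0$, not necessarily injective, up to reparametrization; their action is $\mathcal A(\gamma)=T$, and $\gamma^k$ is the $k$-fold iterate. An orbit is bad if it is an even iterate of a negative hyperbolic orbit, and good otherwise. The Conley–Zehnder index $\mu_{CZ}$ is taken with respect to the global trivialization of the contact structure induced by the $SU(2)$-invariant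 frame $V_1(\alpha,\beta)=(-\bar\beta,\bar\alpha)$, $V_2=iV_1$ on $S^3$, and $|\gamma|=\mu_{CZ}(\gamma)-1$. Put $L_N=2\pi N-\frac{\pi}{2n}$. **Lemma 3.1.** There is $\varepsilon_N>0$ such that for all $\varepsilon\in(0,\varepsilon_N]$ we have $1+\varepsilon f>0$ (so that $\lambda_{\mathbb D^*,\varepsilon}$ is a contact form) and the following hold. 1. Every Reeb orbit $\gamma$ of $\lambda_{\mathbb D^*,\varepsilon}$ with $\mathcal A(\gamma)<L_N$ is nondegenerate and projects under $\mathfrak p$ to the image in $S^2/\mathbb D$ of a critical point of $f$. 2. There are embedded Reeb orbits $e_-,h,e_+$ projecting to $p_-,p_h,p_+$, respectively, with $$\mathcal A(e_-^k)=\tfrac{k\pi(1-\varepsilon)}2,\qquad \mathcal A(h^k)=\tfrac{k\pi}2,\qquad \mathcal A(e_+^k)=\tfrac{k\pi(1+\varepsilon)}n\qquad(k\ge1).$$ The Reeb orbits of action less than $L_N$ are exactly $e_-^k$ and $h^k$ for $1\le k\le 4N-1$ and $e_+^k$ for $1\le k\le 2nN-1$. For these $k$, $$\mu_{CZ}(e_-^k)=2\lceil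 k/2\rceil-1,\qquad \mu_{CZ}(h^k)=k,\qquad \mu_{CZ}(e_+^k)=2\lfloor k/n\rfloor+1.$$ 3. Let $c_i$ be the number of Reeb orbits $\gamma$ with $\mathcal A(\gamma)<L_N$ and $|\gamma|=i$. Then * $c_i=0$ if $i<0$ or $i>4N-2$; * $c_i=n+2$ if $i=0$ or $i=4N-2$, and all these orbits are good; * $c_i=n+3$ if $i$ is even and $0<i<4N-2$, and all these orbits are good; * $c_i=1$ if $i$ is odd and $0<i<4N-2$, and this orbit is bad. 4. Consequently, every linear endomorphism of degree $-1$ of the graded $\mathbb Q$-vector space generated by the good Reeb orbits of action less than $L_N$ is zero; in particular, the filtered differential $\partial^{L_N}$ vanishes. -/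

import Mathlib

open scoped Manifold ContDiff Topology

noncomputable section

namespace BinaryDihedral

/-! ### Spheres, the groups SU(2) and SO(3), and the Hopf fibration -/

/-- The unit sphere `S³ ⊂ ℂ²`. -/
abbrev S3 : Type := Metric.sphere (0 : EuclideanSpace ℂ (Fin 2)) 1

/-- The unit sphere `S² ⊂ ℝ³`, with the smooth structure provided by Mathlib. -/
abbrev S2 : Type := Metric.sphere (0 : EuclideanSpace ℝ (Fin 3)) 1

abbrev SU2 : Type := Matrix.specialUnitaryGroup (Fin 2) ℂ

abbrev SO3 : Type := Matrix.specialOrthogonalGroup (Fin 3) ℝ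

theorem norm_mulVec_of_unitary {𝕜 : Type} [RCLike 𝕜] {d : ℕ}
    (g : Matrix.specialUnitaryGroup (Fin d) 𝕜) (z : EuclideanSpace 𝕜 (Fin d)) :
    ‖(WithLp.toLp 2 (g.1.mulVec z.ofLp) : EuclideanSpace 𝕜 (Fin d))‖ = ‖z‖ := by
  have h : star g.1 * g.1 = 1 :=
    Matrix.mem_unitaryGroup_iff'.mp (Matrix.mem_specialUnitaryGroup_iff.mp g.2).1
  have key : inner 𝕜 (WithLp.toLp 2 (g.1.mulVec z.ofLp) : EuclideanSpace 𝕜 (Fin d))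
      (WithLp.toLp 2 (g.1.mulVec z.ofLp)) = inner 𝕜 z z := by
    rw [EuclideanSpace.inner_eq_star_dotProduct, EuclideanSpace.inner_eq_star_dotProduct,
      dotProduct_comm, dotProduct_comm z.ofLp, Matrix.star_mulVec, Matrix.dotProduct_mulVec,
      Matrix.vecMul_vecMul, ← Matrix.star_eq_conjTranspose, h, Matrix.vecMul_one]
  rw [inner_self_eq_norm_sq_to_K, inner_self_eq_norm_sq_to_K] at key
  have h2 : ‖(WithLp.toLp 2 (g.1.mulVec z.ofLp) : EuclideanSpace 𝕜 (Fin d))‖ ^ 2 = ‖z‖ ^ 2 := by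
    exact_mod_cast key
  exact (sq_eq_sq₀ (norm_nonneg _) (norm_nonneg _)).mp h2

/-- Matrix action of the special unitary group (of the special orthogonal group when `𝕜 = ℝ`)
on the unit sphere. -/
instance sphereAction {𝕜 : Type} [RCLike 𝕜] {d : ℕ} :
    MulAction (Matrix.specialUnitaryGroup (Fin d) 𝕜)
      (Metric.sphere (0 : EuclideanSpace 𝕜 (Fin d)) 1) where
  smul g z := ⟨WithLp.toLp 2 (g.1.mulVec z.1.ofLp), by
    rw [mem_sphere_zero_iff_norm, norm_mulVec_of_unitary]
    exact mem_sphere_zero_iff_norm.mp z.2⟩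
  one_smul z := by
    apply Subtype.ext
    change WithLp.toLp 2 ((1 : Matrix (Fin d) (Fin d) 𝕜).mulVec z.1.ofLp) = z.1
    rw [Matrix.one_mulVec]
  mul_smul g h z := by
    apply Subtype.ext
    change WithLp.toLp 2 ((g.1 * h.1).mulVec z.1.ofLp)
      = WithLp.toLp 2 (g.1.mulVec (h.1.mulVec z.1.ofLp))
    rw [Matrix.mulVec_mulVec]

theorem sphereAction_ofLp {𝕜 : Type} [RCLike 𝕜] {d : ℕ}
    (g : Matrix.specialUnitaryGroup (Fin d) 𝕜)
    (z : Metric.sphere (0 : EuclideanSpace 𝕜 (Fin d)) 1) :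
    (g • z).1.ofLp = g.1.mulVec z.1.ofLp := rfl

theorem su2_apply_one_one (g : SU2) : g.1 1 1 = star (g.1 0 0) := by
  have h := Matrix.mem_specialUnitaryGroup_iff.mp g.2
  have h1 : star g.1 * g.1 = 1 := Matrix.mem_unitaryGroup_iff'.mp h.1
  have h2 : g.1.adjugate = star g.1 := by
    calc g.1.adjugate = (star g.1 * g.1) * g.1.adjugate := by rw [h1, one_mul]
      _ = star g.1 := by rw [mul_assoc, Matrix.mul_adjugate, h.2, one_smul, mul_one]
  have h3 := congrFun (congrFun h2 0) 0
  simpa [Matrix.adjugate_fin_two, Matrix.star_apply] using h3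

theorem su2_apply_zero_one (g : SU2) : g.1 0 1 = -star (g.1 1 0) := by
  have h := Matrix.mem_specialUnitaryGroup_iff.mp g.2
  have h1 : star g.1 * g.1 = 1 := Matrix.mem_unitaryGroup_iff'.mp h.1
  have h2 : g.1.adjugate = star g.1 := by
    calc g.1.adjugate = (star g.1 * g.1) * g.1.adjugate := by rw [h1, one_mul]
      _ = star g.1 := by rw [mul_assoc, Matrix.mul_adjugate, h.2, one_smul, mul_one]
  have h3 := congrFun (congrFun h2 0) 1
  rw [Matrix.adjugate_fin_two] at h3
  simp [Matrix.star_apply] at h3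
  rw [← neg_eq_iff_eq_neg, h3]
  rfl

theorem su2_normSq (g : SU2) : Complex.normSq (g.1 0 0) + Complex.normSq (g.1 1 0) = 1 := by
  have h := (Matrix.mem_specialUnitaryGroup_iff.mp g.2).2
  rw [Matrix.det_fin_two, su2_apply_one_one, su2_apply_zero_one] at h
  have := congrArg Complex.re h
  simp [Complex.normSq_apply] at this ⊢
  linarith

/-- The matrix of `P(g) ∈ SO(3)` for `g ∈ SU(2)` with first column `(α, β)`. -/
def coverMatrix (α β : ℂ) : Matrix (Fin 3) (Fin 3) ℝ :=
  !![Complex.normSq α - Complex.normSq β, 2 * (α * β).im, 2 * (α * β).re;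
     -2 * (star α * β).im, (α ^ 2 + β ^ 2).re, -(α ^ 2 + β ^ 2).im;
     -2 * (star α * β).re, (α ^ 2 - β ^ 2).im, (α ^ 2 - β ^ 2).re]

theorem coverMatrix_mem (g : SU2) :
    coverMatrix (g.1 0 0) (g.1 1 0) ∈ Matrix.specialOrthogonalGroup (Fin 3) ℝ := by
  have h := su2_normSq g
  generalize g.1 0 0 = α at h
  generalize g.1 1 0 = β at h
  obtain ⟨a, b⟩ := α
  obtain ⟨c, d⟩ := β
  simp only [Complex.normSq_mk] at h
  have h2 : (a * a + b * b + (c * c + d * d)) ^ 2 = 1 := by rw [h]; norm_num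
  have h3 : (a * a + b * b + (c * c + d * d)) ^ 3 = 1 := by rw [h]; norm_num
  rw [Matrix.mem_specialOrthogonalGroup_iff, Matrix.mem_orthogonalGroup_iff]
  constructor
  · ext i j
    fin_cases i <;> fin_cases j <;>
      simp [coverMatrix, Matrix.mul_apply, Fin.sum_univ_three, Complex.normSq_mk,
        pow_two] <;>
      first
        | linear_combination h2
        | ring
  · simp [coverMatrix, Matrix.det_fin_three, Complex.normSq_mk, pow_two]
    linear_combination h3

/-- The double cover `P : SU(2) → SO(3)`. -/
def cover : SU2 →* SO3 where
  toFun g := ⟨coverMatrix (g.1 0 0) (g.1 1 0), coverMatrix_mem g⟩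
  map_one' := by
    apply Subtype.ext
    ext i j
    fin_cases i <;> fin_cases j <;> simp [coverMatrix]
  map_mul' g h := by
    apply Subtype.ext
    have e0 : (g * h).1 0 0 = g.1 0 0 * h.1 0 0 + g.1 0 1 * h.1 1 0 := by
      change (g.1 * h.1) 0 0 = _
      simp [Matrix.mul_apply]
    have e1 : (g * h).1 1 0 = g.1 1 0 * h.1 0 0 + g.1 1 1 * h.1 1 0 := by
      change (g.1 * h.1) 1 0 = _
      simp [Matrix.mul_apply]
    change coverMatrix ((g * h).1 0 0) ((g * h).1 1 0)
      = coverMatrix (g.1 0 0) (g.1 1 0) * coverMatrix (h.1 0 0) (h.1 1 0)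
    rw [e0, e1, su2_apply_one_one, su2_apply_zero_one]
    generalize g.1 0 0 = α
    generalize g.1 1 0 = β
    generalize h.1 0 0 = μ
    generalize h.1 1 0 = ν
    obtain ⟨a, b⟩ := α
    obtain ⟨c, d⟩ := β
    obtain ⟨p, q⟩ := μ
    obtain ⟨r, s⟩ := ν
    ext i j
    fin_cases i <;> fin_cases j <;>
      simp [coverMatrix, Matrix.mul_apply, Fin.sum_univ_three, Complex.normSq_apply, pow_two] <;>
      ring

theorem s3_normSq (z : S3) : Complex.normSq (z.1 0) + Complex.normSq (z.1 1) = 1 := by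
  have h : ‖z.1‖ = 1 := mem_sphere_zero_iff_norm.mp z.2
  have h2 := EuclideanSpace.norm_sq_eq z.1
  rw [h] at h2
  simp [Fin.sum_univ_two, ← Complex.normSq_eq_norm_sq] at h2
  linarith

/-- The Hopf fibration `𝔓 : S³ → S²`. -/
def hopf (z : S3) : S2 :=
  ⟨!₂[Complex.normSq (z.1 0) - Complex.normSq (z.1 1), -2 * (star (z.1 0) * z.1 1).im,
      -2 * (star (z.1 0) * z.1 1).re], by
    have h := s3_normSq z
    rw [mem_sphere_zero_iff_norm, ← sq_eq_sq₀ (norm_nonneg _) zero_le_one,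
      EuclideanSpace.norm_sq_eq]
    generalize z.1 0 = α at h
    generalize z.1 1 = β at h
    obtain ⟨a, b⟩ := α
    obtain ⟨c, d⟩ := β
    simp only [Complex.normSq_mk] at h
    have h2 : (a * a + b * b + (c * c + d * d)) ^ 2 = 1 := by rw [h]; norm_num
    simp [Fin.sum_univ_three, Complex.normSq_mk]
    linear_combination h2⟩

theorem hopf_smul (g : SU2) (z : S3) : hopf (g • z) = cover g • hopf z := by
  apply Subtype.ext
  ext i
  have e0 : (g • z).1 0 = g.1 0 0 * z.1 0 + g.1 0 1 * z.1 1 := by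
    change (g.1.mulVec z.1.ofLp) 0 = _
    simp [Matrix.mulVec, dotProduct]
  have e1 : (g • z).1 1 = g.1 1 0 * z.1 0 + g.1 1 1 * z.1 1 := by
    change (g.1.mulVec z.1.ofLp) 1 = _
    simp [Matrix.mulVec, dotProduct]
  change (hopf (g • z)).1 i = ((coverMatrix (g.1 0 0) (g.1 1 0)).mulVec (hopf z).1.ofLp) i
  simp only [hopf, Matrix.mulVec, dotProduct, Fin.sum_univ_three]
  rw [e0, e1, su2_apply_one_one, su2_apply_zero_one]
  generalize g.1 0 0 = α
  generalize g.1 1 0 = β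
  generalize z.1 0 = μ
  generalize z.1 1 = ν
  obtain ⟨a, b⟩ := α
  obtain ⟨c, d⟩ := β
  obtain ⟨p, q⟩ := μ
  obtain ⟨r, s⟩ := ν
  fin_cases i <;>
    simp [coverMatrix, Complex.normSq_apply, pow_two] <;>
    ring

/-! ### The quotients `S³/G` and `S²/H` -/

/-- The quotient `S³/G` for a subgroup `G` of `SU(2)`. -/
abbrev Link (G : Subgroup SU2) : Type := MulAction.orbitRel.Quotient G S3

/-- The quotient map `π_G : S³ → S³/G`. -/
def Link.mk (G : Subgroup SU2) (z : S3) : Link G := Quotient.mk _ z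

/-- The orbifold surface `S²/H`, as a set, where `H = P(G)`. -/
abbrev Base (G : Subgroup SU2) : Type := MulAction.orbitRel.Quotient (G.map cover) S2

/-- The quotient map `π_H : S² → S²/H`. -/
def Base.mk (G : Subgroup SU2) (p : S2) : Base G := Quotient.mk _ p

/-- The Seifert projection `𝔭 : S³/G → S²/H`, induced by the Hopf fibration. -/
def seifert (G : Subgroup SU2) : Link G → Base G :=
  Quotient.map hopf (by
    rintro z w ⟨g, hg⟩
    refine ⟨⟨cover g.1, Subgroup.mem_map_of_mem cover g.2⟩, ?_⟩
    change cover g.1 • hopf w = hopf z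
    rw [← hopf_smul]
    exact congrArg hopf hg)

/-- The points of `S²` fixed by a nontrivial element of `H`. -/
def fixedPoints (H : Subgroup SO3) : Set S2 := {p | ∃ h ∈ H, h ≠ 1 ∧ h • p = p}

/-- The critical points of a function on `S²`. -/
def critPoints (f : S2 → ℝ) : Set S2 :=
  {p | mfderiv (𝓡 2) 𝓘(ℝ, ℝ) f p = 0}

/-! ### The perturbed contact forms and their Reeb vector fields -/

/-- The standard one-form `∑ (x_k dy_k - y_k dx_k) = (i/2) ∑ (z_k d z̄_k - z̄_k d z_k)` on `ℂ²`.
Its restriction to `S³` is the round contact form `λ`, whose Reeb flow is `z ↦ e^{it} z`. -/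
def stdForm (z : EuclideanSpace ℂ (Fin 2)) : EuclideanSpace ℂ (Fin 2) →L[ℝ] ℝ :=
  Complex.imCLM.comp ((innerSL ℂ z).restrictScalars ℝ)

/-- The extension of a function on `S³` to `ℂ²` that is constant on open rays from the origin
(the value at the origin is irrelevant). -/
def radialExt (F : S3 → ℝ) (z : EuclideanSpace ℂ (Fin 2)) : ℝ :=
  open Classical in
  if h : z ≠ 0 then F ⟨(‖z‖⁻¹ : ℝ) • z, by
    rw [mem_sphere_zero_iff_norm, norm_smul, norm_inv, norm_norm,
      inv_mul_cancel₀ (norm_ne_zero_iff.mpr h)]⟩ else 0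

/-- A one-form on `ℂ² ∖ {0}` whose restriction to `S³` is
`λ_ε = (1 + ε 𝔓^* f) λ`; when `f` is invariant, this is the pullback of the contact form
`λ_{G,ε}` on `S³/G`. -/
def perturbedForm (f : S2 → ℝ) (ε : ℝ) (z : EuclideanSpace ℂ (Fin 2)) :
    EuclideanSpace ℂ (Fin 2) →L[ℝ] ℝ :=
  (1 + ε * radialExt (fun w => f (hopf w)) z) • stdForm z

/-- The exterior derivative of a one-form on `ℂ²`, evaluated on two vectors. -/
def dForm (α : EuclideanSpace ℂ (Fin 2) → EuclideanSpace ℂ (Fin 2) →L[ℝ] ℝ)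
    (z u v : EuclideanSpace ℂ (Fin 2)) : ℝ :=
  extDeriv (fun x => ContinuousAlternatingMap.ofSubsingleton ℝ (EuclideanSpace ℂ (Fin 2)) ℝ
    (0 : Fin 1) (α x)) z ![u, v]

/-- The tangent space `T_z S³` as a subset of `ℂ²`. -/
def tangentS3 (z : S3) : Set (EuclideanSpace ℂ (Fin 2)) := {v | (inner ℂ z.1 v).re = 0}

/-- `w ∈ T_z S³` is the value at `z` of the Reeb vector field of the restriction of `α` to `S³`:
`α(w) = 1` and `dα(w, ·) = 0` on `T_z S³`. -/
def IsReebVector (α : EuclideanSpace ℂ (Fin 2) → EuclideanSpace ℂ (Fin 2) →L[ℝ] ℝ)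
    (z : S3) (w : EuclideanSpace ℂ (Fin 2)) : Prop :=
  w ∈ tangentS3 z ∧ α z.1 w = 1 ∧ ∀ v ∈ tangentS3 z, dForm α z.1 w v = 0

/-- The curve `c` in `S³` is differentiable at time `t`, with velocity the Reeb vector of `λ_ε`. -/
def HasReebVelocity (f : S2 → ℝ) (ε : ℝ) (c : ℝ → S3) (t : ℝ) : Prop :=
  ∃ w, IsReebVector (perturbedForm f ε) (c t) w ∧
    HasDerivAt (fun s => (c s : EuclideanSpace ℂ (Fin 2))) w t

/-- Integral curves of the Reeb vector field of `λ_ε` on `S³`. -/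
def IsReebTrajectory (f : S2 → ℝ) (ε : ℝ) (c : ℝ → S3) : Prop :=
  ∀ t, HasReebVelocity f ε c t

/-- Integral curves of the Reeb vector field of `λ_{G,ε}` on `S³/G`. The smooth structure of `S³/G`
and the form `λ_{G,ε}` are those for which `π_G` is a local diffeomorphism with
`π_G^* λ_{G,ε} = λ_ε`. So the curve `c` has the Reeb vector as its velocity at time `t` exactly if
some lift of `c` near `t` does. -/
def IsQuotientReebTrajectory (G : Subgroup SU2) (f : S2 → ℝ) (ε : ℝ) (c : ℝ → Link G) : Prop :=
  ∀ t, ∃ l : ℝ → S3, (∀ᶠ s in 𝓝 t, Link.mk G (l s) = c s) ∧ HasReebVelocity f ε l t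

/-! ### The linearized Reeb flow in the global trivialization -/

/-- The time `t` Reeb flow `φ^t` of `λ_ε` on `S³`: follow the integral curve through `z`. -/
def reebFlow (f : S2 → ℝ) (ε : ℝ) (t : ℝ) (z : S3) : S3 :=
  open Classical in
  if h : ∃ c : ℝ → S3, IsReebTrajectory f ε c ∧ c 0 = z then h.choose t else z

/-- The `SU(2)`-invariant frame `V₁(α, β) = (-β̄, ᾱ)`, `V₂ = i V₁` of the contact planes
`ξ = ker λ`. -/
def frame (i : Fin 2) (z : S3) : EuclideanSpace ℂ (Fin 2) :=
  ![(1 : ℂ), Complex.I] i • !₂[-star (z.1 1), star (z.1 0)]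

theorem norm_greatCircle (i : Fin 2) (z : S3) (s : ℝ) :
    ‖Real.cos s • z.1 + Real.sin s • frame i z‖ = 1 := by
  have h := s3_normSq z
  have hs := Real.sin_sq_add_cos_sq s
  rw [← sq_eq_sq₀ (norm_nonneg _) zero_le_one, EuclideanSpace.norm_sq_eq]
  simp only [Fin.sum_univ_two, ← Complex.normSq_eq_norm_sq]
  simp only [PiLp.add_apply, PiLp.smul_apply, frame]
  generalize z.1 0 = α at h
  generalize z.1 1 = β at h
  obtain ⟨a, b⟩ := α
  obtain ⟨c, d⟩ := β
  simp only [Complex.normSq_mk] at h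
  fin_cases i <;> simp [Complex.normSq_apply, Complex.cos_ofReal_re, Complex.sin_ofReal_re] <;>
    linear_combination (Real.sin s ^ 2 + Real.cos s ^ 2) * h + hs

/-- The great circle through `z` with velocity `V_i(z)` at time `0`. -/
def greatCircle (i : Fin 2) (z : S3) (s : ℝ) : S3 :=
  ⟨Real.cos s • z.1 + Real.sin s • frame i z, by
    rw [mem_sphere_zero_iff_norm, norm_greatCircle]⟩

/-- The matrix of `dφ^t : ξ_z → ξ_{φ^t(z)}` with respect to the frames `(V₁, V₂)`, which are
orthonormal for the Euclidean metric. The entry `(i, j)` is the `V_i`-coordinate of `dφ^t(V_j)`.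
In passing to a `dλ_ε`-symplectic frame, `V₁` and `V₂` are divided by the same positive function;
this changes neither the rotation of vectors nor the return map of a closed orbit. -/
def linearizedFlow (f : S2 → ℝ) (ε : ℝ) (t : ℝ) (z : S3) : Matrix (Fin 2) (Fin 2) ℝ :=
  Matrix.of fun i j =>
    (inner ℂ (frame i (reebFlow f ε t z))
      (deriv (fun s => (reebFlow f ε t (greatCircle j z s) : EuclideanSpace ℂ (Fin 2))) 0)).re

/-! ### The Conley–Zehnder index of a path of `2 × 2` matrices -/

/-- Along `t ∈ [0, T]` the nonzero vector `M t v` turns counterclockwise by the total angle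
`2πδ`. -/
def HasRotation (M : ℝ → Matrix (Fin 2) (Fin 2) ℝ) (T : ℝ) (v : Fin 2 → ℝ) (δ : ℝ) : Prop :=
  ∃ θ : ℝ → ℝ, ContinuousOn θ (Set.Icc 0 T) ∧
    (∀ t ∈ Set.Icc 0 T, ∃ r : ℝ, 0 < r ∧
      (M t).mulVec v = ![r * Real.cos (θ t), r * Real.sin (θ t)]) ∧
    θ T - θ 0 = 2 * Real.pi * δ

/-- `μ` is the Conley–Zehnder index of the path `M` on `[0, T]`, which starts at the identity and
ends at a matrix without eigenvalue `1`. In dimension two, the index is determined by the interval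
of rotations of the vectors `v ≠ 0`: it is `2k` if this interval contains the integer `k`, and
`2k + 1` if the interval lies strictly between `k` and `k + 1`. -/
def HasConleyZehnderIndex (M : ℝ → Matrix (Fin 2) (Fin 2) ℝ) (T : ℝ) (μ : ℤ) : Prop :=
  (∃ k : ℤ, μ = 2 * k ∧ ∃ v, v ≠ 0 ∧ HasRotation M T v k) ∨
  (∃ k : ℤ, μ = 2 * k + 1 ∧
    ∀ v, v ≠ 0 → ∃ δ : ℝ, (k : ℝ) < δ ∧ δ < k + 1 ∧ HasRotation M T v δ)

/-! ### Reeb orbits -/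

/-- Parametrized closed Reeb trajectories `ℝ/Tℤ → S³/G` of `λ_{G,ε}`. -/
structure ReebLoop (G : Subgroup SU2) (f : S2 → ℝ) (ε : ℝ) where
  /-- the curve, as a `T`-periodic map on `ℝ` -/
  curve : ℝ → Link G
  /-- the number `T` -/
  period : ℝ
  period_pos : 0 < period
  periodic : Function.Periodic curve period
  trajectory : IsQuotientReebTrajectory G f ε curve

variable {G : Subgroup SU2} {f : S2 → ℝ} {ε : ℝ}

/-- Two parametrized closed trajectories are identified when they have the same period and differ
by a translation of time. -/
instance ReebLoop.setoid (G : Subgroup SU2) (f : S2 → ℝ) (ε : ℝ) : Setoid (ReebLoop G f ε) where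
  r c c' := c.period = c'.period ∧ ∃ s, ∀ t, c'.curve t = c.curve (t + s)
  iseqv :=
    { refl := fun c => ⟨rfl, 0, fun t => by rw [add_zero]⟩
      symm := by
        rintro c c' ⟨h, s, hs⟩
        exact ⟨h.symm, -s, fun t => by rw [hs, neg_add_cancel_right]⟩
      trans := by
        rintro c c' c'' ⟨h, s, hs⟩ ⟨h', s', hs'⟩
        exact ⟨h.trans h', s' + s, fun t => by rw [hs', hs, add_assoc]⟩ }

/-- The `k`-fold iterate of a parametrized closed trajectory. -/
def ReebLoop.iterate (c : ReebLoop G f ε) (k : ℕ+) : ReebLoop G f ε where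
  curve := c.curve
  period := k * c.period
  period_pos := mul_pos (by exact_mod_cast k.pos) c.period_pos
  periodic := c.periodic.nat_mul k
  trajectory := c.trajectory

/-- The set `𝒫(λ_{G,ε})` of Reeb orbits in `S³/G`. -/
def ReebOrbit (G : Subgroup SU2) (f : S2 → ℝ) (ε : ℝ) : Type :=
  Quotient (ReebLoop.setoid G f ε)

namespace ReebOrbit

/-- The action `∫_γ λ_{G,ε}`, that is, the period. -/
def action (γ : ReebOrbit G f ε) : ℝ :=
  Quotient.lift (fun c : ReebLoop G f ε => c.period) (by rintro c c' ⟨h, -⟩; exact h) γ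

/-- The `k`-fold iterate `γ^k`. -/
def iterate (γ : ReebOrbit G f ε) (k : ℕ+) : ReebOrbit G f ε :=
  Quotient.map (fun c : ReebLoop G f ε => c.iterate k)
    (by
      rintro c c' ⟨h, s, hs⟩
      exact ⟨congrArg (fun T : ℝ => (k : ℝ) * T) h, s, hs⟩) γ

/-- The matrix path `M_t`, `0 ≤ t ≤ T`, of the linearized Reeb flow along `γ` in the global
trivialization of `ξ_G` induced by the invariant frame. Since `π_G` is a local diffeomorphism that
respects the contact forms and the frames, the path is computed along a lift to `S³`. It does not
depend on the lift; another starting point on `γ` conjugates the matrix `M_T` and deforms the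
path. -/
def flowMatrix (γ : ReebOrbit G f ε) (t : ℝ) : Matrix (Fin 2) (Fin 2) ℝ :=
  linearizedFlow f ε t (Quotient.out ((Quotient.out γ : ReebLoop G f ε).curve 0))

/-- The linearized return map `P_γ`. -/
def returnMap (γ : ReebOrbit G f ε) : Matrix (Fin 2) (Fin 2) ℝ := γ.flowMatrix γ.action

/-- `1` is not an eigenvalue of the linearized return map. -/
def IsNondegenerate (γ : ReebOrbit G f ε) : Prop := (1 : ℝ) ∉ spectrum ℝ γ.returnMap

/-- Both eigenvalues of the linearized return map are negative real numbers. -/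
def IsNegativeHyperbolic (γ : ReebOrbit G f ε) : Prop :=
  ∀ x ∈ spectrum ℂ (γ.returnMap.map ((↑) : ℝ → ℂ)), ∃ r : ℝ, r < 0 ∧ x = r

/-- Bad orbits: the even iterates of negative hyperbolic orbits. -/
def IsBad (γ : ReebOrbit G f ε) : Prop :=
  ∃ (β : ReebOrbit G f ε) (k : ℕ+), β.IsNegativeHyperbolic ∧ Even (k : ℕ) ∧ γ = β.iterate k

/-- Orbits that are not bad. -/
def IsGood (γ : ReebOrbit G f ε) : Prop := ¬ γ.IsBad

/-- `μ_CZ(γ) = μ`, with respect to the global trivialization. -/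
def HasIndex (γ : ReebOrbit G f ε) (μ : ℤ) : Prop :=
  HasConleyZehnderIndex γ.flowMatrix γ.action μ

/-- `|γ| = i`, where `|γ| = μ_CZ(γ) - 1`. -/
def HasDegree (γ : ReebOrbit G f ε) (i : ℤ) : Prop := γ.HasIndex (i + 1)

/-- `γ` is embedded: `ℝ/Tℤ → S³/G` is injective. -/
def IsEmbedded (γ : ReebOrbit G f ε) : Prop :=
  ∀ c : ReebLoop G f ε, (⟦c⟧ : ReebOrbit G f ε) = γ →
    Set.InjOn c.curve (Set.Ico 0 c.period)

/-- `γ` projects to the point `q` of `S²/H` under the Seifert projection. -/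
def ProjectsTo (γ : ReebOrbit G f ε) (q : Base G) : Prop :=
  ∀ c : ReebLoop G f ε, (⟦c⟧ : ReebOrbit G f ε) = γ → ∀ t, seifert G (c.curve t) = q

end ReebOrbit

/-! ### The binary dihedral group and its invariant Morse functions -/

/-- The generator `diag(ζ, ζ̄)`, where `ζ = exp(iπ/n)`. -/
def matA (n : ℕ) : SU2 :=
  ⟨!![Complex.exp ((Real.pi / n : ℝ) * Complex.I), 0;
      0, Complex.exp (-((Real.pi / n : ℝ) * Complex.I))], by
    have h : star (Complex.exp ((Real.pi / n : ℝ) * Complex.I))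
        = Complex.exp (-((Real.pi / n : ℝ) * Complex.I)) := by
      rw [Complex.star_def, ← Complex.exp_conj, map_mul, Complex.conj_ofReal, Complex.conj_I,
        mul_neg]
    have h' : star (Complex.exp (-((Real.pi / n : ℝ) * Complex.I)))
        = Complex.exp ((Real.pi / n : ℝ) * Complex.I) := by
      rw [← h, star_star]
    have e : Complex.exp ((Real.pi / n : ℝ) * Complex.I)
        * Complex.exp (-((Real.pi / n : ℝ) * Complex.I)) = 1 := by
      rw [← Complex.exp_add, add_neg_cancel, Complex.exp_zero]
    generalize Complex.exp ((Real.pi / n : ℝ) * Complex.I) = ζ at *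
    generalize Complex.exp (-((Real.pi / n : ℝ) * Complex.I)) = η at *
    rw [Matrix.mem_specialUnitaryGroup_iff, Matrix.mem_unitaryGroup_iff]
    constructor
    · ext i j
      fin_cases i <;> fin_cases j <;> simp [Matrix.mul_apply, Matrix.star_apply]
      · exact (congrArg (ζ * ·) h).trans e
      · exact (congrArg (η * ·) h').trans ((mul_comm _ _).trans e)
    · rw [Matrix.det_fin_two]
      simpa using e⟩

/-- The generator `B`. -/
def matB : SU2 :=
  ⟨!![0, -1; 1, 0], by
    rw [Matrix.mem_specialUnitaryGroup_iff, Matrix.mem_unitaryGroup_iff]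
    constructor
    · ext i j
      fin_cases i <;> fin_cases j <;> simp [Matrix.mul_apply, Matrix.star_apply]
    · simp [Matrix.det_fin_two]⟩

/-- The binary dihedral group `𝔻*_{2n} ⊂ SU(2)`, of order `4n`. -/
def binaryDihedral (n : ℕ) : Subgroup SU2 := Subgroup.closure {matA n, matB}

/-- The dihedral group `𝔻_{2n} = P(𝔻*_{2n}) ⊂ SO(3)`, of order `2n`. -/
def dihedral (n : ℕ) : Subgroup SO3 := (binaryDihedral n).map cover

/-- The point `(0, cos θ, sin θ)` of the equator. -/
def equator (θ : ℝ) : S2 :=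
  ⟨!₂[0, Real.cos θ, Real.sin θ], by
    rw [mem_sphere_zero_iff_norm, ← sq_eq_sq₀ (norm_nonneg _) zero_le_one,
      EuclideanSpace.norm_sq_eq]
    simp [Fin.sum_univ_three]⟩

/-- The points `p_{-,k}`. -/
def pMinus (n k : ℕ) : S2 := equator ((Real.pi + 2 * k * Real.pi) / n)

/-- The points `p_{h,k}`. -/
def pH (n k : ℕ) : S2 := equator (2 * k * Real.pi / n)

/-- The point `p_{+,1} = (1, 0, 0)`. -/
def pPlus : S2 := ⟨!₂[1, 0, 0], by
  rw [mem_sphere_zero_iff_norm, ← sq_eq_sq₀ (norm_nonneg _) zero_le_one,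
    EuclideanSpace.norm_sq_eq]
  simp [Fin.sum_univ_three]⟩

/-- Inverse stereographic projection `(x, y) ↦ (2x, 2y, 1 - x² - y²)/(1 + x² + y²)`. -/
def stereo (x y : ℝ) : S2 :=
  ⟨!₂[2 * x / (1 + x ^ 2 + y ^ 2), 2 * y / (1 + x ^ 2 + y ^ 2),
      (1 - x ^ 2 - y ^ 2) / (1 + x ^ 2 + y ^ 2)], by
    have h : (1 + x ^ 2 + y ^ 2) ≠ 0 := by positivity
    rw [mem_sphere_zero_iff_norm, ← sq_eq_sq₀ (norm_nonneg _) zero_le_one,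
      EuclideanSpace.norm_sq_eq]
    simp [Fin.sum_univ_three]
    field_simp
    ring⟩

/-- In some stereographic coordinates at `p`, the function `f` is equal to `q` near the origin. -/
def HasStereographicForm (f : S2 → ℝ) (p : S2) (q : ℝ → ℝ → ℝ) : Prop :=
  ∃ g : SO3, g • stereo 0 0 = p ∧
    ∀ᶠ u : ℝ × ℝ in 𝓝 (0, 0), f (g • stereo u.1 u.2) = q u.1 u.2

/-- The `𝔻_{2n}`-invariant smooth functions on `S²` whose critical points are the fixed points of
`𝔻_{2n}`, in the prescribed normal forms: minima at the `p_{-,k}`, saddles at the `p_{h,k}` and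
maxima at the `p_{+,k}`. Such a function is Morse, and it is Smale for every metric because
its saddles lie at the same level. -/
structure IsDihedralMorse (n : ℕ) (f : S2 → ℝ) : Prop where
  smooth : ContMDiff (𝓡 2) 𝓘(ℝ, ℝ) ∞ f
  invariant : ∀ g ∈ dihedral n, ∀ p : S2, f (g • p) = f p
  crit : critPoints f = fixedPoints (dihedral n)
  minimum : ∀ k, 1 ≤ k → k ≤ n →
    HasStereographicForm f (pMinus n k) (fun x y => (x ^ 2 + y ^ 2) / 2 - 1)
  saddle : ∀ k, 1 ≤ k → k ≤ n →
    HasStereographicForm f (pH n k) (fun x y => (x ^ 2 - y ^ 2) / 2)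
  maximum : ∀ p, p = pPlus ∨ p = -pPlus →
    HasStereographicForm f p (fun x y => 1 - (x ^ 2 + y ^ 2) / 2)

/-- The action threshold `L_N = 2πN - π/(2n)`. -/
def threshold (n N : ℕ) : ℝ := 2 * Real.pi * N - Real.pi / (2 * n)

/-- The Reeb orbits of `λ_{𝔻*,ε}` in `S³/𝔻*_{2n}`. -/
abbrev Orbit (n : ℕ) (f : S2 → ℝ) (ε : ℝ) : Type := ReebOrbit (binaryDihedral n) f ε

/-- The set of Reeb orbits of action less than `L_N` and degree `i`, whose cardinality
is `c_i`. -/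
def orbitsOfDegree (n N : ℕ) (f : S2 → ℝ) (ε : ℝ) (i : ℤ) : Set (Orbit n f ε) :=
  {γ | γ.action < threshold n N ∧ γ.HasDegree i}

/-- The generators of the filtered complex: the good Reeb orbits of action less than `L_N`. -/
def GoodOrbit (n N : ℕ) (f : S2 → ℝ) (ε : ℝ) : Type :=
  {γ : Orbit n f ε // γ.action < threshold n N ∧ γ.IsGood}

/-- An endomorphism of the `ℚ`-vector space generated by the good orbits of action less than `L_N`
has degree `-1`: its matrix entry at a pair of generators is zero unless their degrees
differ by `1`. -/
def LowersDegree {n N : ℕ} {f : S2 → ℝ} {ε : ℝ}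
    (d : (GoodOrbit n N f ε →₀ ℚ) →ₗ[ℚ] (GoodOrbit n N f ε →₀ ℚ)) : Prop :=
  ∀ a b : GoodOrbit n N f ε, d (Finsupp.single a 1) b ≠ 0 →
    ∃ i : ℤ, a.1.HasDegree i ∧ b.1.HasDegree (i - 1)

end BinaryDihedral

end

/-! Write `a = 1 + ε 𝔓^*f`. The Reeb field of `aλ` is `(1/a) i z - (ε/a²) i W`, where `W` is half
the gradient of `𝔓^*f` on `ℂ²`. It commutes with the phase rotation, preserves `a`, and projects to
`S²` as the field `-(2ε/a²) ∇f × x`, whose Lipschitz constant on each level of `a` is `O(ε)`.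

A closed trajectory of period `T < L_N` in the quotient lifts to a closed trajectory of period `|G|
T` in `S³`. A closed orbit of a Lipschitz field whose period is short compared with the inverse
Lipschitz constant is constant (`deriv_eq_zero_of_short_period`), so for small `ε` every such
trajectory lies over a critical point (`exists_short_orbits_critical`). The critical points are the
fixed points of the dihedral group and form three orbits (`fixedPoints_cases`). Over a critical
point the flow is phase rotation at speed `1/a`, and the stabilizer of the Hopf circle rotates it by
multiples of `π/2` (minima, saddles) or `π/n` (maxima); this is recorded by `IsAxis`. Hence the list
of orbits and their actions, and `L_N` separates the actions as claimed.

For the indices, undo the phase rotation along a critical fibre. The point becomes an equilibrium of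
an autonomous field, and the linearized flow solves a constant-coefficient equation in the contact
plane `≅ ℂ` (`hasDerivAt_flow_of_equilibrium`, `NormalFrame.linearizedFlow_apply`). The invariant
frame itself turns by `e^{-it/a}` along the fibre, so the linearized flow is `e^{2it/a}` times that
solution. At an extremum with Hessian sign `q` the result is a rotation at speed `2/a - εq/(2a²)`;
over the whole period this is slightly less than `k/2` turns for `e_-^k` and slightly more than
`k/n` turns for `e_+^k`. At a saddle it is `e^{2it}` times a hyperbolic flow which turns no vector
by a right angle and fixes some direction, so `h^k` has index `k`, with return map `(-1)^k` times a
hyperbolic matrix with positive eigenvalues.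

Elliptic orbits in the range have nonreal return eigenvalues, so the bad orbits are exactly the even
iterates of `h`, and these are exactly the orbits of odd degree. All good generators have even
degree, and a map of degree `-1` between them vanishes. In degree `2j` one generically finds two
iterates of `e_-`, one of `h` and `n` of `e_+`. The lowest degree loses one `e_+` (the excluded `k =
0`) and the top degree loses one `e_-` (the excluded `k = 4N`). -/

open scoped Manifold ContDiff Topology

noncomputable section

/-! ### Ordinary differential equations: completeness, linearization at an equilibrium, short
periodic orbits. -/

section ODE

variable {E : Type*} [NormedAddCommGroup E] [NormedSpace ℝ E]

/-- A bounded Lipschitz vector field on a Banach space is complete. -/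
theorem exists_global_solution_of_bounded_lipschitz [CompleteSpace E] {V : E → E} {K : NNReal}
    (hV : LipschitzWith K V) {M : NNReal} (hM : ∀ x, ‖V x‖ ≤ M) (x : E) :
    ∃ γ : ℝ → E, γ 0 = x ∧ ∀ t, HasDerivAt γ (V (γ t)) t := by
  have loc : ∀ a : ℕ, ∃ γ : ℝ → E, γ 0 = x ∧
      ∀ t ∈ Set.Ioo (-(a + 1 : ℝ)) (a + 1), HasDerivAt γ (V (γ t)) t := by
    intro a
    have ha : (0 : ℝ) ∈ Set.Icc (-(a + 1 : ℝ)) (a + 1) := by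
      constructor <;> [(have : (0 : ℝ) ≤ a := a.cast_nonneg; linarith); positivity]
    -- Since `V` is bounded by `M` everywhere, a solution cannot leave the ball of radius `M (a +
    -- 1)` within time `a + 1`, so one application of Picard–Lindelöf covers the whole interval.
    have hP : IsPicardLindelof (fun _ => V) (⟨0, ha⟩ : Set.Icc (-(a + 1 : ℝ)) (a + 1)) x
        (M * (a + 1)) 0 M K :=
      { lipschitzOnWith := fun _ _ => hV.lipschitzOnWith
        continuousOn := fun _ _ => continuousOn_const
        norm_le := fun _ _ y _ => hM y
        mul_max_le := by simp }
    obtain ⟨γ, h0, h⟩ := hP.exists_eq_forall_mem_Icc_hasDerivWithinAt₀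
    exact ⟨γ, h0, fun t ht => (h t (Set.Ioo_subset_Icc_self ht)).hasDerivAt
      (Icc_mem_nhds ht.1 ht.2)⟩
  choose γ h0 h using loc
  have agree : ∀ a b : ℕ, a ≤ b → Set.EqOn (γ a) (γ b) (Set.Ioo (-(a + 1 : ℝ)) (a + 1)) := by
    intro a b hab
    have hab' : (a : ℝ) ≤ b := by exact_mod_cast hab
    refine ODE_solution_unique_of_mem_Ioo (v := fun _ => V) (s := fun _ => Set.univ) (K := K)
      (t₀ := 0) (fun _ _ => hV.lipschitzOnWith) ?_ (fun t ht => ⟨h a t ht, trivial⟩)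
      (fun t ht => ⟨h b t ⟨?_, ?_⟩, trivial⟩) ((h0 a).trans (h0 b).symm)
    · have : (0 : ℝ) ≤ a := a.cast_nonneg
      constructor <;> linarith
    · linarith [ht.1]
    · linarith [ht.2]
  -- The local solutions agree where they overlap, so each time may use its own index. Near `t` all
  -- the indices in use are at most `⌈|t|⌉ + 1`, and comparison with that single solution gives the
  -- derivative.
  refine ⟨fun t => γ ⌈|t|⌉₊ t, by simpa using h0 0, fun t => ?_⟩
  set b : ℕ := ⌈|t|⌉₊ + 1 with hb
  have hlt : |t| < b := by
    rw [hb]; push_cast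
    linarith [Nat.le_ceil |t|]
  have hmem : t ∈ Set.Ioo (-(b : ℝ)) b := abs_lt.mp hlt
  have hev : (fun t => γ ⌈|t|⌉₊ t) =ᶠ[𝓝 t] γ b := by
    filter_upwards [Ioo_mem_nhds hmem.1 hmem.2] with s hs
    refine agree _ _ ?_ ?_
    · exact Nat.ceil_le.mpr (abs_lt.mpr hs).le
    · rw [Set.mem_Ioo, ← abs_lt]
      linarith [Nat.le_ceil |s|]
  have hd := h b t ⟨by linarith [hmem.1], by linarith [hmem.2]⟩
  rw [show (fun t => γ ⌈|t|⌉₊ t) t = γ b t from hev.self_of_nhds]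
  exact hd.congr_of_eventuallyEq hev

/-- Forward continuous dependence of solutions on the initial value. -/
theorem dist_solution_le {V : E → E} {K : NNReal} (hV : LipschitzWith K V) {y z : ℝ → E}
    (hy : ∀ t, HasDerivAt y (V (y t)) t) (hz : ∀ t, HasDerivAt z (V (z t)) t) {t : ℝ}
    (ht : 0 ≤ t) : dist (y t) (z t) ≤ dist (y 0) (z 0) * Real.exp (K * t) := by
  have := dist_le_of_trajectories_ODE (v := fun _ => V) (K := K) (a := 0) (b := t)
    (fun _ => hV) (fun s _ => (hy s).continuousAt.continuousWithinAt)
    (fun s _ => (hy s).hasDerivWithinAt) (fun s _ => (hz s).continuousAt.continuousWithinAt)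
    (fun s _ => (hz s).hasDerivWithinAt) le_rfl t ⟨ht, le_rfl⟩
  simpa using this

/-- Homogeneity of the Gronwall bound lets the factor `|s| η` be pulled out of the error estimate
for the linearized flow. -/
theorem gronwallBound_mul (c δ K e x : ℝ) :
    gronwallBound (c * δ) K (c * e) x = c * gronwallBound δ K e x := by
  unfold gronwallBound
  split_ifs <;> ring

/-- At an equilibrium the derivative of the flow in the initial value is the solution of the
linearized equation. -/
theorem hasDerivAt_flow_of_equilibrium {V : E → E} {K : NNReal} (hV : LipschitzWith K V)
    {z₀ : E} (hz₀ : V z₀ = 0) {B : E →L[ℝ] E} (hB : HasFDerivAt V B z₀) {y : ℝ → ℝ → E}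
    (hy : ∀ s t, HasDerivAt (y s) (V (y s t)) t) (hy0 : y 0 0 = z₀) {w : ℝ → E}
    (hw : ∀ t, HasDerivAt w (B (w t)) t) (hyw : HasDerivAt (fun s => y s 0) (w 0) 0)
    {t : ℝ} (ht : 0 ≤ t) : HasDerivAt (fun s => y s t) (w t) 0 := by
  have hconst : ∀ τ, y 0 τ = z₀ := by
    have := ODE_solution_unique_univ (v := fun _ => V) (s := fun _ => Set.univ) (K := K)
      (f := y 0) (g := fun _ => z₀) (t₀ := 0) (fun _ => hV.lipschitzOnWith)
      (fun τ => ⟨hy 0 τ, trivial⟩)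
      (fun τ => ⟨by rw [hz₀]; exact hasDerivAt_const τ z₀, trivial⟩) hy0
    exact fun τ => congrFun this τ
  rw [hasDerivAt_iff_isLittleO] at hyw ⊢
  simp only [sub_zero, hconst] at hyw ⊢
  set C₁ : ℝ := Real.exp (K * t) * (‖w 0‖ + 1) with hC₁
  set C : ℝ := gronwallBound 1 ‖B‖ C₁ t with hC
  have hCpos : 0 < C := by
    have h1 : (1 : ℝ) ≤ C := by
      have := gronwallBound_mono (δ := 1) (K := ‖B‖) (ε := C₁) zero_le_one (by positivity)
        (norm_nonneg _) ht
      rwa [gronwallBound_x0] at this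
    linarith
  rw [Asymptotics.isLittleO_iff]
  intro c hc
  -- The target is an error of at most `c |s|`; Gronwall will give `η C |s|`. The cap `1` is what
  -- yields the uniform bound `(‖w 0‖ + 1) |s|` on the initial displacement.
  set η : ℝ := min (c / C) 1 with hη
  have hηpos : 0 < η := by positivity
  rw [hasFDerivAt_iff_isLittleO, Asymptotics.isLittleO_iff] at hB
  obtain ⟨δ, hδ, hδB⟩ := Metric.eventually_nhds_iff.mp (hB hηpos)
  rw [Asymptotics.isLittleO_iff] at hyw
  have hsmall : ∀ᶠ s : ℝ in 𝓝 0, |s| * C₁ < δ := by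
    have : ContinuousAt (fun s : ℝ => |s| * C₁) 0 := by fun_prop
    exact this.eventually_lt continuousAt_const (by simpa using hδ)
  filter_upwards [hyw hηpos, hsmall] with s hs hsδ
  have hs0 : ‖y s 0 - z₀‖ ≤ (‖w 0‖ + 1) * |s| := by
    calc ‖y s 0 - z₀‖ = ‖(y s 0 - z₀ - s • w 0) + s • w 0‖ := by rw [sub_add_cancel]
      _ ≤ η * ‖s‖ + ‖s‖ * ‖w 0‖ := by
        refine (norm_add_le _ _).trans (add_le_add hs ?_)
        rw [norm_smul]
      _ ≤ (‖w 0‖ + 1) * |s| := by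
        rw [Real.norm_eq_abs]
        nlinarith [min_le_right (c / C) 1, abs_nonneg s]
  have hclose : ∀ τ ∈ Set.Icc 0 t, ‖y s τ - z₀‖ ≤ |s| * C₁ := by
    intro τ hτ
    have h1 := dist_solution_le hV (hy s) (hy 0) hτ.1
    rw [hconst, hconst, dist_eq_norm, dist_eq_norm] at h1
    refine h1.trans ?_
    have h2 : Real.exp (K * τ) ≤ Real.exp (K * t) :=
      Real.exp_le_exp.mpr (mul_le_mul_of_nonneg_left hτ.2 K.2)
    calc _ ≤ ((‖w 0‖ + 1) * |s|) * Real.exp (K * t) := by gcongr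
      _ = |s| * C₁ := by rw [hC₁]; ring
  -- The error `e = y s - z₀ - s w` satisfies `e' = B e + r`, where `r` is the Taylor remainder of
  -- `V` at `z₀`. Its size is at most `η |s| C₁`, and `e` starts with size at most `η |s|`.
  have hd : ∀ τ, HasDerivAt (fun τ => y s τ - z₀ - s • w τ) (V (y s τ) - s • B (w τ)) τ :=
    fun τ => ((hy s τ).sub_const z₀).sub ((hw τ).const_smul s)
  have key := norm_le_gronwallBound_of_norm_deriv_right_le (a := 0) (b := t)
    (δ := |s| * η * 1) (K := ‖B‖) (ε := |s| * η * C₁)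
    (fun τ _ => (hd τ).continuousAt.continuousWithinAt)
    (fun τ _ => (hd τ).hasDerivWithinAt) (by rw [mul_one, mul_comm]; exact hs)
    (fun τ hτ => by
      have hτ' : τ ∈ Set.Icc 0 t := ⟨hτ.1, hτ.2.le⟩
      have h1 : ‖V (y s τ) - B (y s τ - z₀)‖ ≤ η * ‖y s τ - z₀‖ := by
        have := hδB (y := y s τ) (by rw [dist_eq_norm]; exact (hclose τ hτ').trans_lt hsδ)
        rwa [hz₀, sub_zero] at this
      have h2 : V (y s τ) - s • B (w τ)
          = B (y s τ - z₀ - s • w τ) + (V (y s τ) - B (y s τ - z₀)) := by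
        simp only [map_sub, map_smul]; abel
      rw [h2]
      refine (norm_add_le _ _).trans (add_le_add (B.le_opNorm _) (h1.trans ?_))
      calc η * ‖y s τ - z₀‖ ≤ η * (|s| * C₁) := by gcongr; exact hclose τ hτ'
        _ = |s| * η * C₁ := by ring) t ⟨ht, le_rfl⟩
  rw [sub_zero, gronwallBound_mul, ← hC] at key
  refine key.trans ?_
  rw [Real.norm_eq_abs]
  have : η * C ≤ c := by
    calc η * C ≤ c / C * C := by gcongr; exact min_le_left _ _
      _ = c := div_mul_cancel₀ _ hCpos.ne'
  nlinarith [abs_nonneg s]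

/-- A periodic orbit of a Lipschitz vector field whose period is short compared with the Lipschitz
constant is constant. -/
theorem deriv_eq_zero_of_short_period {V : E → E} {K : NNReal} {S : Set E}
    (hV : LipschitzOnWith K V S) {y : ℝ → E} (hyS : ∀ t, y t ∈ S)
    (hy : ∀ t, HasDerivAt y (V (y t)) t) {T : ℝ} (hT : 0 < T) (hper : Function.Periodic y T)
    (hKT : K * T < 1) (t : ℝ) : V (y t) = 0 := by
  have hcont : Continuous fun t => V (y t) := by
    rw [continuous_iff_continuousAt]
    intro t
    have hc : Continuous fun t => (⟨y t, hyS t⟩ : S) :=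
      Continuous.subtype_mk (continuous_iff_continuousAt.mpr fun t => (hy t).continuousAt) _
    have := (continuousOn_iff_continuous_domRestrict.mp hV.continuousOn).comp hc
    exact this.continuousAt
  -- By periodicity the speed attains a global maximum, at some time `m`.
  obtain ⟨m, -, hm⟩ := isCompact_Icc.exists_isMaxOn (Set.nonempty_Icc.mpr hT.le)
    hcont.norm.continuousOn
  have hmax : ∀ t, ‖V (y t)‖ ≤ ‖V (y m)‖ := by
    intro t
    obtain ⟨s, hs, hst⟩ := hper.exists_mem_Ico₀ hT t
    rw [hst]
    exact hm (Set.Ico_subset_Icc_self hs)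
  have hmove : ∀ s ∈ Set.Icc m (m + T), ‖y s - y m‖ ≤ ‖V (y m)‖ * (s - m) :=
    norm_image_sub_le_of_norm_deriv_le_segment' (fun s _ => (hy s).hasDerivWithinAt)
      (fun s _ => hmax s)
  -- Integrate `V (y s) - V (y m)` over one period. The displacement `y (m + T) - y m` is zero, so
  -- `T ‖V (y m)‖` is at most `K T · T ‖V (y m)‖`, which with `K T < 1` forces the maximal speed to
  -- vanish.
  have hfinal := norm_image_sub_le_of_norm_deriv_le_segment' (a := m) (b := m + T)
    (f := fun s => y s - (s - m) • V (y m)) (f' := fun s => V (y s) - V (y m))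
    (C := K * (‖V (y m)‖ * T))
    (fun s _ => by
      have := (hy s).sub (((hasDerivAt_id s).sub_const m).smul_const (V (y m)))
      rw [one_smul] at this
      exact this.hasDerivWithinAt)
    (fun s hs => by
      have h1 := hV.norm_sub_le (hyS s) (hyS m)
      refine h1.trans ?_
      gcongr
      refine (hmove s ⟨hs.1, hs.2.le⟩).trans ?_
      gcongr
      linarith [hs.2]) (m + T) ⟨by linarith, le_rfl⟩
  have hle : T * ‖V (y m)‖ ≤ K * (‖V (y m)‖ * T) * T := by
    simpa [hper m, norm_smul, abs_of_pos hT] using hfinal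
  have hzero : ‖V (y m)‖ = 0 := by
    by_contra hne
    have hpos : 0 < ‖V (y m)‖ := lt_of_le_of_ne (norm_nonneg _) (Ne.symm hne)
    have : 0 < T * ‖V (y m)‖ := by positivity
    nlinarith
  exact norm_le_zero_iff.mp ((hmax t).trans hzero.le)

end ODE

namespace BinaryDihedral

/-! ### Quadratic Hopf map and the traceless Hermitian matrices -/

abbrev C2 : Type := EuclideanSpace ℂ (Fin 2)

abbrev R3 : Type := EuclideanSpace ℝ (Fin 3)

theorem inner_C2 (z w : C2) : inner ℂ z w = star (z 0) * w 0 + star (z 1) * w 1 := by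
  simp [PiLp.inner_apply, Fin.sum_univ_two, mul_comm]

theorem inner_R3 (x y : R3) : inner ℝ x y = x 0 * y 0 + x 1 * y 1 + x 2 * y 2 := by
  simp [PiLp.inner_apply, Fin.sum_univ_three, mul_comm]

theorem norm_sq_C2 (z : C2) : ‖z‖ ^ 2 = Complex.normSq (z 0) + Complex.normSq (z 1) := by
  rw [EuclideanSpace.norm_sq_eq]
  simp [Fin.sum_univ_two, Complex.normSq_eq_norm_sq]

theorem norm_sq_R3 (x : R3) : ‖x‖ ^ 2 = x 0 ^ 2 + x 1 ^ 2 + x 2 ^ 2 := by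
  rw [EuclideanSpace.norm_sq_eq]
  simp [Fin.sum_univ_three]

theorem re_inner_self_C2 (z : C2) : inner ℂ z z = ((‖z‖ ^ 2 : ℝ) : ℂ) := by
  rw [inner_self_eq_norm_sq_to_K]; norm_cast

/-- The quadratic extension of the Hopf fibration to `ℂ²`. -/
def hopfMap (z : C2) : R3 :=
  !₂[Complex.normSq (z 0) - Complex.normSq (z 1), -2 * (star (z 0) * z 1).im,
    -2 * (star (z 0) * z 1).re]

/-- The polarization of `hopfMap`. -/
def hopfPolar : C2 →L[ℝ] C2 →L[ℝ] R3 :=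
  LinearMap.toContinuousLinearMap <| (LinearMap.toContinuousLinearMap.toLinearMap).comp <|
    LinearMap.mk₂ ℝ (fun z v : C2 => (!₂[2 * (star (z 0) * v 0 - star (z 1) * v 1).re,
      -2 * (star (z 0) * v 1 + star (v 0) * z 1).im,
      -2 * (star (z 0) * v 1 + star (v 0) * z 1).re] : R3))
    (by intros; ext i; fin_cases i <;> simp <;> ring)
    (by intros; ext i; fin_cases i <;> simp <;> ring)
    (by intros; ext i; fin_cases i <;> simp <;> ring)
    (by intros; ext i; fin_cases i <;> simp <;> ring)

/-- The traceless Hermitian matrix with coordinates `x`, applied to `z`. -/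
def pauli : R3 →L[ℝ] C2 →L[ℝ] C2 :=
  LinearMap.toContinuousLinearMap <| (LinearMap.toContinuousLinearMap.toLinearMap).comp <|
    LinearMap.mk₂ ℝ (fun (x : R3) (z : C2) =>
      (!₂[(x 0 : ℂ) * z 0 + (Complex.I * x 1 - x 2) * z 1,
        (-Complex.I * x 1 - x 2) * z 0 - x 0 * z 1] : C2))
    (by intros; ext i; fin_cases i <;> simp <;> ring)
    (by intros; ext i; fin_cases i <;> simp <;> ring)
    (by intros; ext i; fin_cases i <;> simp <;> ring)
    (by intros; ext i; fin_cases i <;> simp <;> ring)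

theorem pauli_apply (x : R3) (z : C2) :
    pauli x z = !₂[(x 0 : ℂ) * z 0 + (Complex.I * x 1 - x 2) * z 1,
        (-Complex.I * x 1 - x 2) * z 0 - x 0 * z 1] := rfl

theorem hopfPolar_apply (z v : C2) : hopfPolar z v =
    !₂[2 * (star (z 0) * v 0 - star (z 1) * v 1).re,
      -2 * (star (z 0) * v 1 + star (v 0) * z 1).im,
      -2 * (star (z 0) * v 1 + star (v 0) * z 1).re] := rfl

theorem pauli_smul (c : ℂ) (x : R3) (z : C2) : pauli x (c • z) = c • pauli x z := by
  ext i
  fin_cases i <;> simp [pauli_apply] <;> ring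

/-- The Hopf map is the moment map of `SU(2)`: its components are the quadratic forms of the Pauli
matrices. The signs in `pauli` are fixed by this identity. -/
theorem inner_pauli (x : R3) (z : C2) :
    inner ℂ z (pauli x z) = ((inner ℝ x (hopfMap z) : ℝ) : ℂ) := by
  rw [inner_C2, inner_R3]
  apply Complex.ext <;> simp [pauli_apply, hopfMap, Complex.normSq_apply] <;> ring

/-- Polarization of the moment map identity. It says that the gradient of `x · hopfMap` at `z` is `2
pauli x z`, the source of the formula for `halfGrad`. -/
theorem inner_hopfPolar (x : R3) (z v : C2) :
    inner ℝ x (hopfPolar z v) = 2 * (inner ℂ (pauli x z) v).re := by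
  rw [inner_C2, inner_R3, hopfPolar_apply]
  simp [pauli_apply]
  ring

/-- Anticommutation of the Pauli matrices. For `‖z‖ = 1` an orthonormal pair in `ℝ³` becomes a
real-orthonormal pair in `ℂ²`. -/
theorem re_inner_pauli_pauli (x y : R3) (z : C2) :
    (inner ℂ (pauli x z) (pauli y z)).re = inner ℝ x y * ‖z‖ ^ 2 := by
  rw [inner_C2, inner_R3, norm_sq_C2]
  simp [pauli_apply, Complex.normSq_apply]
  ring

theorem norm_hopfMap (z : C2) : ‖hopfMap z‖ = ‖z‖ ^ 2 := by
  rw [← sq_eq_sq₀ (norm_nonneg _) (by positivity), norm_sq_R3, norm_sq_C2]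
  simp [hopfMap, Complex.normSq_apply]
  ring

theorem hopfMap_ne_zero {z : C2} (hz : z ≠ 0) : hopfMap z ≠ 0 := by
  rw [← norm_ne_zero_iff, norm_hopfMap]
  exact pow_ne_zero 2 (norm_ne_zero_iff.mpr hz)

theorem hopfMap_smul (c : ℂ) (z : C2) : hopfMap (c • z) = (‖c‖ ^ 2 : ℝ) • hopfMap z := by
  rw [← Complex.normSq_eq_norm_sq]
  ext i
  fin_cases i <;> simp [hopfMap, Complex.normSq_apply] <;> ring

theorem hopfMap_eq_half_polar (z : C2) : hopfMap z = (1 / 2 : ℝ) • hopfPolar z z := by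
  rw [hopfPolar_apply]
  ext i
  fin_cases i <;> simp [hopfMap, Complex.normSq_apply] <;> ring

theorem hopfPolar_comm (z v : C2) : hopfPolar z v = hopfPolar v z := by
  rw [hopfPolar_apply, hopfPolar_apply]
  ext i
  fin_cases i <;> simp <;> ring

theorem hasFDerivAt_hopfMap (z : C2) : HasFDerivAt hopfMap (hopfPolar z) z := by
  have h := ((hopfPolar.hasFDerivAt (x := z)).clm_apply (hasFDerivAt_id z)).const_smul (1 / 2 : ℝ)
  have e : hopfMap = fun z => (1 / 2 : ℝ) • hopfPolar z (id z) :=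
    funext hopfMap_eq_half_polar
  rw [e]
  refine h.congr_fderiv ?_
  ext1 v
  simp [hopfPolar_comm v z, ← two_smul ℝ, smul_smul]

theorem contDiff_hopfMap {m : WithTop ℕ∞} : ContDiff ℝ m hopfMap := by
  have e : hopfMap = fun z => (1 / 2 : ℝ) • hopfPolar z z := funext hopfMap_eq_half_polar
  rw [e]
  fun_prop

/-- The cross product as it appears in the velocity of the projected Reeb flow. -/
def cross (x y : R3) : R3 := !₂[x 1 * y 2 - x 2 * y 1, x 2 * y 0 - x 0 * y 2,
  x 0 * y 1 - x 1 * y 0]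

/-- The commutator relation of the Pauli matrices: multiplication by `i` upstairs corresponds to the
cross product on `S²`, so the perturbation term projects to a Hamiltonian direction of `f`. -/
theorem hopfPolar_I_smul_pauli (x : R3) (z : C2) :
    hopfPolar z (Complex.I • pauli x z) = (2 : ℝ) • cross x (hopfMap z) := by
  rw [hopfPolar_apply]
  ext i
  fin_cases i <;> simp [hopfMap, pauli_apply, cross, Complex.normSq_apply] <;> ring

theorem hopfPolar_I_smul (z : C2) : hopfPolar z (Complex.I • z) = 0 := by
  rw [hopfPolar_apply]
  ext i
  fin_cases i <;> simp <;> ring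

/-- Lagrange's identity. As the gradient of the homogeneous extension is tangent to the sphere, it
vanishes as soon as its cross product with the base point does. -/
theorem norm_sq_cross (x y : R3) :
    ‖cross x y‖ ^ 2 + (inner ℝ x y) ^ 2 = ‖x‖ ^ 2 * ‖y‖ ^ 2 := by
  rw [norm_sq_R3, norm_sq_R3, norm_sq_R3, inner_R3]
  simp [cross]
  ring

theorem hopf_val (z : S3) : (hopf z).1 = hopfMap z.1 := rfl

/-! ### The degree zero homogeneous extension of a function on the sphere -/

/-- Radial projection onto the unit sphere. -/
def radialProj (x : R3) (hx : x ≠ 0) : S2 := ⟨‖x‖⁻¹ • x, by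
  rw [mem_sphere_zero_iff_norm, norm_smul, norm_inv, norm_norm,
    inv_mul_cancel₀ (norm_ne_zero_iff.mpr hx)]⟩

/-- The extension of a function on `S²` to `ℝ³` that is constant on open rays. -/
def homExt (f : S2 → ℝ) (x : R3) : ℝ :=
  open Classical in if h : x ≠ 0 then f (radialProj x h) else 0

theorem homExt_of_ne_zero (f : S2 → ℝ) {x : R3} (hx : x ≠ 0) :
    homExt f x = f (radialProj x hx) := dif_pos hx

theorem S2.ne_zero (p : S2) : p.1 ≠ 0 := by
  rw [← norm_ne_zero_iff, mem_sphere_zero_iff_norm.mp p.2]; exact one_ne_zero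

theorem S3.norm_eq_one (z : S3) : ‖z.1‖ = 1 := mem_sphere_zero_iff_norm.mp z.2

theorem S2.norm_eq_one (z : S2) : ‖z.1‖ = 1 := mem_sphere_zero_iff_norm.mp z.2

theorem S3.ne_zero (z : S3) : z.1 ≠ 0 := by
  rw [← norm_ne_zero_iff, z.norm_eq_one]; exact one_ne_zero

theorem homExt_coe (f : S2 → ℝ) (p : S2) : homExt f p.1 = f p := by
  rw [homExt_of_ne_zero f p.ne_zero]
  congr 1
  apply Subtype.ext
  simp [radialProj, mem_sphere_zero_iff_norm.mp p.2]

theorem homExt_smul (f : S2 → ℝ) {r : ℝ} (hr : 0 < r) (x : R3) :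
    homExt f (r • x) = homExt f x := by
  by_cases hx : x = 0
  · simp [hx]
  · have hrx : r • x ≠ 0 := smul_ne_zero hr.ne' hx
    rw [homExt_of_ne_zero f hx, homExt_of_ne_zero f hrx]
    congr 1
    apply Subtype.ext
    simp [radialProj, norm_smul, smul_smul, abs_of_pos hr]
    congr 1
    field_simp

/-- Away from the origin the extension is `f` after radial projection, and the latter is smooth as a
map from the open submanifold `ℝ³ ∖ {0}` to the sphere. This converts smoothness on the manifold
`S²` into ordinary calculus on `ℝ³`. -/
theorem contDiffAt_homExt {f : S2 → ℝ} (hf : ContMDiff (𝓡 2) 𝓘(ℝ, ℝ) ∞ f) {x : R3}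
    (hx : x ≠ 0) : ContDiffAt ℝ ∞ (homExt f) x := by
  have : Fact (Module.finrank ℝ R3 = 2 + 1) := ⟨finrank_euclideanSpace_fin⟩
  let U : TopologicalSpace.Opens R3 := ⟨{0}ᶜ, isOpen_compl_singleton⟩
  have hU : ∀ y : U, y.1 ≠ 0 := fun y => y.2
  let F : U → R3 := fun y => ‖y.1‖⁻¹ • y.1
  have hF : ContMDiff 𝓘(ℝ, R3) 𝓘(ℝ, R3) ∞ F := by
    intro y
    have : ContMDiffAt 𝓘(ℝ, R3) 𝓘(ℝ, R3) ∞ (fun x : R3 => ‖x‖⁻¹ • x) y.1 := by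
      apply ContDiffAt.contMDiffAt
      exact ((contDiffAt_norm ℝ (hU y)).inv (norm_ne_zero_iff.mpr (hU y))).smul contDiffAt_id
    exact contMDiffAt_subtype_iff.mpr this
  have hFs : ∀ y, F y ∈ Metric.sphere (0 : R3) 1 := fun y => (radialProj y.1 (hU y)).2
  have h := hf.comp (hF.codRestrict_sphere hFs)
  have h2 : ContMDiffAt 𝓘(ℝ, R3) 𝓘(ℝ, ℝ) ∞ (fun y : U => homExt f y.1) ⟨x, hx⟩ := by
    refine (h ⟨x, hx⟩).congr_of_eventuallyEq (Filter.Eventually.of_forall fun y => ?_)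
    exact homExt_of_ne_zero f (hU y)
  exact contMDiffAt_iff_contDiffAt.mp (contMDiffAt_subtype_iff.mp h2)

theorem differentiableAt_homExt {f : S2 → ℝ} (hf : ContMDiff (𝓡 2) 𝓘(ℝ, ℝ) ∞ f) {x : R3}
    (hx : x ≠ 0) : DifferentiableAt ℝ (homExt f) x :=
  (contDiffAt_homExt hf hx).differentiableAt (by simp)

/-- The gradient of the homogeneous extension. -/
def homGrad (f : S2 → ℝ) (x : R3) : R3 := gradient (homExt f) x

theorem fderiv_homExt_apply (f : S2 → ℝ) (x v : R3) :
    fderiv ℝ (homExt f) x v = inner ℝ (homGrad f x) v := by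
  simp [homGrad, gradient]

theorem homGrad_eq_zero_iff (f : S2 → ℝ) (x : R3) :
    homGrad f x = 0 ↔ fderiv ℝ (homExt f) x = 0 := by
  simp [homGrad, gradient]

theorem contDiffAt_homGrad {f : S2 → ℝ} (hf : ContMDiff (𝓡 2) 𝓘(ℝ, ℝ) ∞ f) {x : R3}
    (hx : x ≠ 0) : ContDiffAt ℝ 1 (homGrad f) x := by
  have h : ContDiffAt ℝ 1 (fderiv ℝ (homExt f)) x :=
    (contDiffAt_homExt hf hx).fderiv_right (by norm_cast)
  exact ((InnerProductSpace.toDual ℝ R3).symm.toContinuousLinearEquiv.contDiff.contDiffAt).comp x h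

/-- Euler's relation in degree zero: differentiate along the ray through `x`, where the extension is
constant. -/
theorem inner_homGrad_self {f : S2 → ℝ} (hf : ContMDiff (𝓡 2) 𝓘(ℝ, ℝ) ∞ f) {x : R3}
    (hx : x ≠ 0) : inner ℝ (homGrad f x) x = 0 := by
  rw [← fderiv_homExt_apply]
  have h1 : HasDerivAt (fun r : ℝ => (1 + r) • x) x 0 := by
    simpa using ((hasDerivAt_id (0 : ℝ)).const_add 1).smul_const x
  have h2 : HasFDerivAt (homExt f) (fderiv ℝ (homExt f) x) ((1 + (0 : ℝ)) • x) := by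
    simpa using (differentiableAt_homExt hf hx).hasFDerivAt
  have h3 := h2.comp_hasDerivAt 0 h1
  have h4 : (homExt f ∘ fun r : ℝ => (1 + r) • x) =ᶠ[𝓝 0] fun _ => homExt f x := by
    filter_upwards [Ioi_mem_nhds (show (-1 : ℝ) < 0 by norm_num)] with r hr
    exact homExt_smul f (by linarith [Set.mem_Ioi.mp hr]) x
  exact h3.unique ((hasDerivAt_const 0 (homExt f x)).congr_of_eventuallyEq h4)

/-- Chain rule for `f` as the composite of its extension with the inclusion of the sphere. It links
the gradient condition produced by the dynamics to the intrinsic critical set of the hypothesis. -/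
theorem mem_critPoints_of_homGrad_eq_zero {f : S2 → ℝ} (hf : ContMDiff (𝓡 2) 𝓘(ℝ, ℝ) ∞ f)
    {p : S2} (hp : homGrad f p.1 = 0) : p ∈ critPoints f := by
  have : Fact (Module.finrank ℝ R3 = 2 + 1) := ⟨finrank_euclideanSpace_fin⟩
  rw [homGrad_eq_zero_iff] at hp
  have e : f = homExt f ∘ (fun q : S2 => q.1) := funext fun q => (homExt_coe f q).symm
  have h1 : MDifferentiableAt 𝓘(ℝ, R3) 𝓘(ℝ, ℝ) (homExt f) p.1 :=
    (differentiableAt_homExt hf p.ne_zero).mdifferentiableAt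
  have h2 : MDifferentiableAt (𝓡 2) 𝓘(ℝ, R3) (fun q : S2 => q.1) p :=
    (contMDiff_coe_sphere (E := R3) (n := 2) (m := 1)).mdifferentiable (by simp) p
  change mfderiv (𝓡 2) 𝓘(ℝ, ℝ) f p = 0
  rw [e, mfderiv_comp p h1 h2, mfderiv_eq_fderiv, hp]
  rfl

/-! ### The Reeb vector field -/

/-- The conformal factor `1 + ε 𝔓^* f`. -/
def factor (f : S2 → ℝ) (ε : ℝ) (z : C2) : ℝ := 1 + ε * homExt f (hopfMap z)

/-- Half the gradient of `𝔓^* f`. -/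
def halfGrad (f : S2 → ℝ) (z : C2) : C2 := pauli (homGrad f (hopfMap z)) z

/-- The Reeb vector field of `λ_ε`. -/
def reebField (f : S2 → ℝ) (ε : ℝ) (z : C2) : C2 :=
  (factor f ε z)⁻¹ • (Complex.I • z) - (ε / factor f ε z ^ 2) • (Complex.I • halfGrad f z)

/-- Both extensions are constant on rays, because `hopfMap` scales by a positive factor when `z`
does. -/
theorem perturbedForm_eq (f : S2 → ℝ) (ε : ℝ) {z : C2} (hz : z ≠ 0) :
    perturbedForm f ε z = factor f ε z • stdForm z := by
  unfold perturbedForm factor radialExt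
  rw [dif_pos hz]
  congr 3
  have hz' : 0 < ‖z‖ := norm_pos_iff.mpr hz
  refine (homExt_coe f _).symm.trans ?_
  change homExt f (hopfMap ((‖z‖⁻¹ : ℝ) • z)) = _
  have : ((‖z‖⁻¹ : ℝ) • z) = ((‖z‖⁻¹ : ℝ) : ℂ) • z := by
    rw [Complex.coe_smul]
  rw [this, hopfMap_smul, homExt_smul]
  simp [hz]

theorem stdForm_apply (z v : C2) : stdForm z v = (inner ℂ z v).im := rfl

/-- With the vector frozen, the form is linear in the base point, and antisymmetry of `Im ⟨·,·⟩`
identifies it with `-λ_v`. -/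
theorem hasFDerivAt_stdForm_apply (z v : C2) :
    HasFDerivAt (fun x => stdForm x v) (-(stdForm v)) z := by
  have h : (fun x => stdForm x v) = fun x => (-(stdForm v)) x := by
    funext x
    simp only [neg_apply, stdForm_apply]
    rw [← inner_conj_symm, Complex.conj_im]
  rw [h]
  exact (-(stdForm v)).hasFDerivAt

theorem hasFDerivAt_factor {f : S2 → ℝ} (hf : ContMDiff (𝓡 2) 𝓘(ℝ, ℝ) ∞ f) (ε : ℝ) {z : C2}
    (hz : z ≠ 0) : HasFDerivAt (factor f ε)
      (ε • (fderiv ℝ (homExt f) (hopfMap z)).comp (hopfPolar z)) z :=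
  (((differentiableAt_homExt hf (hopfMap_ne_zero hz)).hasFDerivAt.comp z
    (hasFDerivAt_hopfMap z)).const_mul ε).const_add 1

theorem fderiv_factor_apply {f : S2 → ℝ} (hf : ContMDiff (𝓡 2) 𝓘(ℝ, ℝ) ∞ f) (ε : ℝ) {z : C2}
    (hz : z ≠ 0) (v : C2) :
    fderiv ℝ (factor f ε) z v = 2 * ε * (inner ℂ (halfGrad f z) v).re := by
  rw [(hasFDerivAt_factor hf ε hz).fderiv]
  simp only [smul_apply, ContinuousLinearMap.comp_apply, smul_eq_mul]
  rw [fderiv_homExt_apply, inner_hopfPolar, halfGrad]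
  ring

theorem differentiable_stdForm : Differentiable ℝ stdForm := by
  unfold stdForm
  have : Differentiable ℝ fun z : C2 => ((innerSL ℂ z).restrictScalars ℝ : C2 →L[ℝ] ℂ) := by
    have h2 : Differentiable ℝ fun z : C2 => (innerSL ℂ z : C2 →L[ℂ] ℂ) := by
      -- `z ↦ ⟨z, ·⟩` is conjugate-linear, hence only real-linear, and so is packaged as a
      -- continuous `ℝ`-linear map.
      let L : C2 →L[ℝ] (C2 →L[ℂ] ℂ) := LinearMap.toContinuousLinearMap
        { toFun := fun z => innerSL ℂ z
          map_add' := by intro x y; simp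
          map_smul' := by
            intro r x; ext y
            simp only [innerSL_apply_apply, smul_apply, RingHom.id_apply]
            rw [← Complex.coe_smul, inner_smul_left, Complex.conj_ofReal]
            simp }
      exact L.differentiable
    exact (ContinuousLinearMap.restrictScalarsL ℂ C2 ℂ ℝ ℝ).differentiable.comp h2
  exact (ContinuousLinearMap.compL ℝ C2 ℂ ℝ Complex.imCLM).differentiable.comp this

/-- This is `d(aλ) = da ∧ λ + a dλ`, with `dλ(u, v) = 2 Im ⟨u, v⟩`. -/
theorem dForm_perturbedForm {f : S2 → ℝ} (hf : ContMDiff (𝓡 2) 𝓘(ℝ, ℝ) ∞ f) (ε : ℝ) {z : C2}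
    (hz : z ≠ 0) (u v : C2) : dForm (perturbedForm f ε) z u v =
      fderiv ℝ (factor f ε) z u * (inner ℂ z v).im - fderiv ℝ (factor f ε) z v * (inner ℂ z u).im
        + 2 * factor f ε z * (inner ℂ u v).im := by
  have hev : perturbedForm f ε =ᶠ[𝓝 z] fun x => factor f ε x • stdForm x := by
    filter_upwards [isOpen_ne.mem_nhds hz] with x hx using perturbedForm_eq f ε hx
  have hfac := hasFDerivAt_factor hf ε hz
  have hdiff : DifferentiableAt ℝ (perturbedForm f ε) z :=
    DifferentiableAt.congr_of_eventuallyEq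
      (hfac.differentiableAt.smul differentiable_stdForm.differentiableAt) hev
  have key : ∀ w : C2, fderiv ℝ (fun x => perturbedForm f ε x w) z
      = factor f ε z • (-(stdForm w)) + (stdForm z w) • fderiv ℝ (factor f ε) z := by
    intro w
    have h1 : (fun x => perturbedForm f ε x w) =ᶠ[𝓝 z] fun x => factor f ε x * stdForm x w :=
      hev.mono fun x hx => by simp only [hx, smul_apply, smul_eq_mul]
    rw [h1.fderiv_eq]
    exact (hfac.differentiableAt.hasFDerivAt.mul (hasFDerivAt_stdForm_apply z w)).fderiv
  have hd2 : DifferentiableAt ℝ (fun x => ContinuousAlternatingMap.ofSubsingleton ℝ C2 ℝ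
      (0 : Fin 1) (perturbedForm f ε x)) z :=
    (ContinuousAlternatingMap.ofSubsingletonLIE (𝕜 := ℝ) (E := C2) (F := ℝ)
      (0 : Fin 1)).differentiable.differentiableAt.comp z hdiff
  rw [dForm, extDeriv_apply hd2]
  refine (Fin.sum_univ_two _).trans ?_
  change (-1 : ℤ) ^ 0 • fderiv ℝ (fun x => perturbedForm f ε x v) z u
    + (-1 : ℤ) ^ 1 • fderiv ℝ (fun x => perturbedForm f ε x u) z v = _
  simp only [key]
  have e3 : (inner ℂ v u).im = - (inner ℂ u v).im := by
    rw [← inner_conj_symm, Complex.conj_im]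
  simp [stdForm_apply, e3]
  ring

theorem inner_halfGrad_right {f : S2 → ℝ} (hf : ContMDiff (𝓡 2) 𝓘(ℝ, ℝ) ∞ f) {z : C2}
    (hz : z ≠ 0) : inner ℂ z (halfGrad f z) = 0 := by
  rw [halfGrad, inner_pauli, inner_homGrad_self hf (hopfMap_ne_zero hz), Complex.ofReal_zero]

theorem inner_halfGrad_left {f : S2 → ℝ} (hf : ContMDiff (𝓡 2) 𝓘(ℝ, ℝ) ∞ f) {z : C2}
    (hz : z ≠ 0) : inner ℂ (halfGrad f z) z = 0 := by
  rw [← inner_conj_symm, inner_halfGrad_right hf hz, map_zero]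

theorem inner_reebField {f : S2 → ℝ} (ε : ℝ) (z v : C2) :
    inner ℂ (reebField f ε z) v = -Complex.I * (((factor f ε z)⁻¹ : ℝ) * inner ℂ z v
      - ((ε / factor f ε z ^ 2 : ℝ) : ℂ) * inner ℂ (halfGrad f z) v) := by
  rw [reebField, inner_sub_left, ← Complex.coe_smul, ← Complex.coe_smul, inner_smul_left,
    inner_smul_left, inner_smul_left, inner_smul_left, Complex.conj_ofReal, Complex.conj_ofReal,
    Complex.conj_I]
  ring

/-- The term `i z / a` normalizes the value of the form. The correction by `i W` lies in the contact
plane, because `W` is complex-orthogonal to `z`, and its pairing under `a dλ` cancels the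
contribution of `da`. -/
theorem isReebVector_reebField {f : S2 → ℝ} (hf : ContMDiff (𝓡 2) 𝓘(ℝ, ℝ) ∞ f) {ε : ℝ} {z : S3}
    (ha : factor f ε z.1 ≠ 0) : IsReebVector (perturbedForm f ε) z (reebField f ε z.1) := by
  have hself : inner ℂ z.1 z.1 = 1 := by rw [re_inner_self_C2, z.norm_eq_one]; simp
  have h1 : inner ℂ (reebField f ε z.1) z.1 = -Complex.I * ((factor f ε z.1)⁻¹ : ℝ) := by
    rw [inner_reebField, hself, inner_halfGrad_left hf z.ne_zero]
    ring
  have h2 : inner ℂ z.1 (reebField f ε z.1) = Complex.I * ((factor f ε z.1)⁻¹ : ℝ) := by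
    rw [← inner_conj_symm, h1, map_mul, map_neg, Complex.conj_I, Complex.conj_ofReal, neg_neg]
  refine ⟨?_, ?_, fun v hv => ?_⟩
  · change (inner ℂ z.1 _).re = 0
    rw [h2]; simp
  · rw [perturbedForm_eq f ε z.ne_zero, smul_apply, stdForm_apply, h2]
    simp [ha]
  · have hv' : (inner ℂ z.1 v).re = 0 := hv
    have h3 : (inner ℂ (halfGrad f z.1) (reebField f ε z.1)).re = 0 := by
      rw [← inner_conj_symm, Complex.conj_re, inner_reebField, inner_halfGrad_right hf z.ne_zero,
        re_inner_self_C2]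
      simp only [Complex.mul_im, Complex.mul_re, Complex.sub_re, Complex.sub_im, Complex.ofReal_re,
      Complex.ofReal_im, Complex.I_re, Complex.I_im, Complex.neg_re, Complex.neg_im, Complex.zero_re,
      Complex.zero_im]
      ring
    rw [dForm_perturbedForm hf ε z.ne_zero, fderiv_factor_apply hf ε z.ne_zero,
      fderiv_factor_apply hf ε z.ne_zero, h3, h2, inner_reebField]
    simp only [Complex.mul_im, Complex.mul_re, Complex.sub_re, Complex.sub_im, Complex.ofReal_re,
      Complex.ofReal_im, Complex.I_re, Complex.I_im, Complex.neg_re, Complex.neg_im, hv']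
    field_simp
    ring

/-- The Reeb vector of `λ_ε` is unique, and given by the formula for `reebField`. -/
theorem isReebVector_iff {f : S2 → ℝ} (hf : ContMDiff (𝓡 2) 𝓘(ℝ, ℝ) ∞ f) {ε : ℝ} {z : S3}
    (ha : factor f ε z.1 ≠ 0) (w : C2) :
    IsReebVector (perturbedForm f ε) z w ↔ w = reebField f ε z.1 := by
  refine ⟨fun h => ?_, fun h => h ▸ isReebVector_reebField hf ha⟩
  obtain ⟨h1, h2, h3⟩ := h
  obtain ⟨k1, k2, k3⟩ := isReebVector_reebField hf ha
  set X := reebField f ε z.1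
  set d := w - X with hd
  have e1 : (inner ℂ z.1 d).re = 0 := by
    have h1' : (inner ℂ z.1 w).re = 0 := h1
    have k1' : (inner ℂ z.1 X).re = 0 := k1
    rw [hd, inner_sub_right, Complex.sub_re, h1', k1', sub_zero]
  have e2 : (inner ℂ z.1 d).im = 0 := by
    have : perturbedForm f ε z.1 d = 0 := by rw [hd, map_sub, h2, k2, sub_self]
    rw [perturbedForm_eq f ε z.ne_zero, smul_apply, stdForm_apply, smul_eq_mul] at this
    exact (mul_eq_zero.mp this).resolve_left ha
  have e3 : inner ℂ z.1 d = 0 := Complex.ext e1 e2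
  -- The difference `d` of two Reeb vectors lies in the contact plane. Testing against `i d` gives
  -- `2 a ‖d‖² = 0`, which is the nondegeneracy of the form on that plane.
  have hv : Complex.I • d ∈ tangentS3 z := by
    change (inner ℂ z.1 (Complex.I • d)).re = 0
    rw [inner_smul_right, e3]; simp
  have e4 : dForm (perturbedForm f ε) z.1 d (Complex.I • d) = 0 := by
    have a1 := h3 _ hv
    have a2 := k3 _ hv
    rw [dForm_perturbedForm hf ε z.ne_zero] at a1 a2 ⊢
    have : 0 = (0 : ℝ) - 0 := (sub_zero 0).symm
    rw [this]
    nth_rewrite 1 [← a1]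
    rw [← a2, hd]
    simp only [inner_sub_left, inner_sub_right, map_sub, Complex.sub_im]
    ring
  rw [dForm_perturbedForm hf ε z.ne_zero, inner_smul_right, e3, inner_smul_right,
    re_inner_self_C2] at e4
  have e5 : 2 * factor f ε z.1 * ‖d‖ ^ 2 = 0 := by
    simp only [Complex.mul_im, Complex.ofReal_re, Complex.ofReal_im, Complex.I_re,
      Complex.I_im, Complex.zero_re, Complex.zero_im] at e4
    linarith
  have e6 : d = 0 := by
    have := (mul_eq_zero.mp e5).resolve_left (mul_ne_zero two_ne_zero ha)
    exact norm_eq_zero.mp (pow_eq_zero_iff (two_ne_zero) |>.mp this)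
  exact sub_eq_zero.mp e6

theorem hasReebVelocity_iff {f : S2 → ℝ} (hf : ContMDiff (𝓡 2) 𝓘(ℝ, ℝ) ∞ f) {ε : ℝ} {c : ℝ → S3}
    {t : ℝ} (ha : factor f ε (c t).1 ≠ 0) : HasReebVelocity f ε c t ↔
      HasDerivAt (fun s => (c s : C2)) (reebField f ε (c t).1) t := by
  constructor
  · rintro ⟨w, hw, h⟩
    rwa [(isReebVector_iff hf ha w).mp hw] at h
  · exact fun h => ⟨_, isReebVector_reebField hf ha, h⟩

/-! ### Symmetries of the Reeb vector field -/

theorem hopfMap_unit_smul {c : ℂ} (hc : ‖c‖ = 1) (z : C2) : hopfMap (c • z) = hopfMap z := by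
  rw [hopfMap_smul, hc, one_pow, one_smul]

theorem factor_unit_smul (f : S2 → ℝ) (ε : ℝ) {c : ℂ} (hc : ‖c‖ = 1) (z : C2) :
    factor f ε (c • z) = factor f ε z := by
  rw [factor, hopfMap_unit_smul hc, factor]

theorem reebField_unit_smul (f : S2 → ℝ) (ε : ℝ) {c : ℂ} (hc : ‖c‖ = 1) (z : C2) :
    reebField f ε (c • z) = c • reebField f ε z := by
  rw [reebField, reebField, factor_unit_smul f ε hc, halfGrad, halfGrad, hopfMap_unit_smul hc,
    pauli_smul, smul_sub, smul_comm c, smul_comm c (ε / _), smul_comm c Complex.I,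
    smul_comm c Complex.I]

/-- The action of `SU(2)` on `ℂ²` by linear isometries. -/
def suIsometry (g : SU2) : C2 →ₗᵢ[ℂ] C2 where
  toLinearMap := Matrix.toEuclideanLin g.1
  norm_map' := norm_mulVec_of_unitary g

theorem suIsometry_coe (g : SU2) (z : S3) : suIsometry g z.1 = (g • z).1 := rfl

theorem suIsometry_inv (g : SU2) (z : C2) : suIsometry g (suIsometry g⁻¹ z) = z := by
  change WithLp.toLp 2 (g.1.mulVec ((g⁻¹).1.mulVec z.ofLp)) = z
  rw [Matrix.mulVec_mulVec]
  change WithLp.toLp 2 ((g * g⁻¹).1.mulVec z.ofLp) = z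
  rw [mul_inv_cancel]
  change WithLp.toLp 2 ((1 : Matrix (Fin 2) (Fin 2) ℂ).mulVec z.ofLp) = z
  rw [Matrix.one_mulVec]

theorem homExt_hopfMap (f : S2 → ℝ) {z : C2} (hz : z ≠ 0) :
    homExt f (hopfMap z) = f (hopf ⟨(‖z‖⁻¹ : ℝ) • z, by
      rw [mem_sphere_zero_iff_norm, norm_smul, norm_inv, norm_norm,
        inv_mul_cancel₀ (norm_ne_zero_iff.mpr hz)]⟩) := by
  refine Eq.trans ?_ (homExt_coe f _)
  change _ = homExt f (hopfMap ((‖z‖⁻¹ : ℝ) • z))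
  rw [← Complex.coe_smul, hopfMap_smul, homExt_smul]
  simp [hz]

theorem homExt_hopfMap_suIsometry {f : S2 → ℝ} {g : SU2} (hg : ∀ p, f (cover g • p) = f p)
    (z : C2) : homExt f (hopfMap (suIsometry g z)) = homExt f (hopfMap z) := by
  by_cases hz : z = 0
  · simp [hz]
  have hz' : suIsometry g z ≠ 0 := by
    rwa [ne_eq, ← norm_eq_zero, LinearIsometry.norm_map, norm_eq_zero]
  rw [homExt_hopfMap f hz, homExt_hopfMap f hz']
  refine Eq.trans ?_ (hg _)
  rw [← hopf_smul]
  congr 2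
  apply Subtype.ext
  change (‖suIsometry g z‖⁻¹ : ℝ) • suIsometry g z = suIsometry g ((‖z‖⁻¹ : ℝ) • z)
  rw [LinearIsometry.norm_map, ← Complex.coe_smul, ← Complex.coe_smul, map_smul]

theorem factor_suIsometry {f : S2 → ℝ} (ε : ℝ) {g : SU2} (hg : ∀ p, f (cover g • p) = f p)
    (z : C2) : factor f ε (suIsometry g z) = factor f ε z := by
  rw [factor, homExt_hopfMap_suIsometry hg, factor]

/-- The gradient of a function invariant under a linear isometry is equivariant. The value `ε = 1`
serves only to obtain the differential of `𝔓^*f` from that of `factor`. -/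
theorem halfGrad_suIsometry {f : S2 → ℝ} (hf : ContMDiff (𝓡 2) 𝓘(ℝ, ℝ) ∞ f) {g : SU2}
    (hg : ∀ p, f (cover g • p) = f p) {z : C2} (hz : z ≠ 0) :
    halfGrad f (suIsometry g z) = suIsometry g (halfGrad f z) := by
  have hz' : suIsometry g z ≠ 0 := by
    rwa [ne_eq, ← norm_eq_zero, LinearIsometry.norm_map, norm_eq_zero]
  have key : ∀ v, (inner ℂ (halfGrad f (suIsometry g z)) (suIsometry g v)).re
      = (inner ℂ (halfGrad f z) v).re := by
    intro v
    have h0 : factor f 1 ∘ suIsometry g = factor f 1 := funext (factor_suIsometry 1 hg)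
    have h1 := ((hasFDerivAt_factor hf 1 hz').comp z
      ((suIsometry g).toContinuousLinearMap.restrictScalars ℝ).hasFDerivAt).fderiv
    have h2 : fderiv ℝ (factor f 1) z v = fderiv ℝ (factor f 1) (suIsometry g z)
        (suIsometry g v) := by
      rw [(hasFDerivAt_factor hf 1 hz').fderiv]
      have := congrArg (fun L => L v) h1
      exact (congrArg (fun F => fderiv ℝ F z v) h0).symm.trans this
    rw [fderiv_factor_apply hf 1 hz, fderiv_factor_apply hf 1 hz'] at h2
    linarith
  set u := halfGrad f (suIsometry g z) - suIsometry g (halfGrad f z) with hu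
  have h3 : ∀ v, (inner ℂ u (suIsometry g v)).re = 0 := by
    intro v
    rw [hu, inner_sub_left, Complex.sub_re, key, LinearIsometry.inner_map_map, sub_self]
  have h4 := h3 (suIsometry g⁻¹ u)
  rw [suIsometry_inv, re_inner_self_C2, Complex.ofReal_re] at h4
  exact sub_eq_zero.mp (norm_eq_zero.mp (pow_eq_zero_iff two_ne_zero |>.mp h4))

theorem reebField_suIsometry {f : S2 → ℝ} (hf : ContMDiff (𝓡 2) 𝓘(ℝ, ℝ) ∞ f) (ε : ℝ) {g : SU2}
    (hg : ∀ p, f (cover g • p) = f p) {z : C2} (hz : z ≠ 0) :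
    reebField f ε (suIsometry g z) = suIsometry g (reebField f ε z) := by
  rw [reebField, reebField, factor_suIsometry ε hg, halfGrad_suIsometry hf hg hz, map_sub,
    ← Complex.coe_smul, ← Complex.coe_smul, ← Complex.coe_smul, ← Complex.coe_smul, map_smul,
    map_smul, map_smul, map_smul]

/-! ### The projection of the Reeb flow to the two-sphere -/

theorem re_inner_reebField {f : S2 → ℝ} (hf : ContMDiff (𝓡 2) 𝓘(ℝ, ℝ) ∞ f) (ε : ℝ) (z : C2) :
    (inner ℂ z (reebField f ε z)).re = 0 := by
  by_cases hz : z = 0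
  · simp [hz]
  rw [← inner_conj_symm, Complex.conj_re, inner_reebField, inner_halfGrad_left hf hz,
    re_inner_self_C2]
  simp only [Complex.mul_im, Complex.mul_re, Complex.sub_re, Complex.sub_im, Complex.ofReal_re,
    Complex.ofReal_im, Complex.I_re, Complex.I_im, Complex.neg_re, Complex.neg_im, Complex.zero_re,
    Complex.zero_im]
  ring

/-- `da` pairs with `v` as `Re ⟨W, v⟩`, and both `i z` and `i W` are real-orthogonal to `W`. So `a`
is conserved, and along a trajectory the factors `1/a` and `ε/a²` are constants. -/
theorem fderiv_factor_reebField {f : S2 → ℝ} (hf : ContMDiff (𝓡 2) 𝓘(ℝ, ℝ) ∞ f) (ε : ℝ) {z : C2}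
    (hz : z ≠ 0) : fderiv ℝ (factor f ε) z (reebField f ε z) = 0 := by
  rw [fderiv_factor_apply hf ε hz, ← inner_conj_symm, Complex.conj_re, inner_reebField,
    inner_halfGrad_right hf hz, re_inner_self_C2]
  simp only [Complex.mul_im, Complex.mul_re, Complex.sub_re, Complex.sub_im, Complex.ofReal_re,
    Complex.ofReal_im, Complex.I_re, Complex.I_im, Complex.neg_re, Complex.neg_im, Complex.zero_re,
    Complex.zero_im]
  ring

/-- The main term `i z` is tangent to the Hopf fibre and disappears, leaving a field of size `ε` on
the two-sphere. -/
theorem hopfPolar_reebField (f : S2 → ℝ) (ε : ℝ) (z : C2) : hopfPolar z (reebField f ε z) =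
    (-(2 * (ε / factor f ε z ^ 2))) • cross (homGrad f (hopfMap z)) (hopfMap z) := by
  rw [reebField, map_sub, (hopfPolar z).map_smul, (hopfPolar z).map_smul, hopfPolar_I_smul, halfGrad, hopfPolar_I_smul_pauli,
    smul_zero, zero_sub, smul_smul, neg_smul, mul_comm 2]

theorem contDiffAt_factor {f : S2 → ℝ} (hf : ContMDiff (𝓡 2) 𝓘(ℝ, ℝ) ∞ f) (ε : ℝ) {z : C2}
    (hz : z ≠ 0) : ContDiffAt ℝ 1 (factor f ε) z := by
  have h : ContDiffAt ℝ 1 (homExt f) (hopfMap z) :=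
    (contDiffAt_homExt hf (hopfMap_ne_zero hz)).of_le (by norm_cast)
  exact contDiffAt_const.add (contDiffAt_const.mul (h.comp z contDiff_hopfMap.contDiffAt))

theorem contDiffAt_halfGrad {f : S2 → ℝ} (hf : ContMDiff (𝓡 2) 𝓘(ℝ, ℝ) ∞ f) {z : C2}
    (hz : z ≠ 0) : ContDiffAt ℝ 1 (halfGrad f) z := by
  have h : ContDiffAt ℝ 1 (fun z => homGrad f (hopfMap z)) z :=
    (contDiffAt_homGrad hf (hopfMap_ne_zero hz)).comp z contDiff_hopfMap.contDiffAt
  exact (pauli.contDiff.contDiffAt.comp z h).clm_apply contDiffAt_id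

theorem contDiff_I_smul : ContDiff ℝ 1 fun z : C2 => Complex.I • z :=
  ((Complex.I • ContinuousLinearMap.id ℂ C2).restrictScalars ℝ).contDiff

theorem contDiffAt_reebField {f : S2 → ℝ} (hf : ContMDiff (𝓡 2) 𝓘(ℝ, ℝ) ∞ f) {ε : ℝ} {z : C2}
    (hz : z ≠ 0) (ha : factor f ε z ≠ 0) : ContDiffAt ℝ 1 (reebField f ε) z := by
  have h1 := contDiffAt_factor hf ε hz
  exact ((h1.inv ha).smul contDiff_I_smul.contDiffAt).sub
    ((contDiffAt_const.div (h1.pow 2) (pow_ne_zero 2 ha)).smul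
      (contDiff_I_smul.contDiffAt.comp z (contDiffAt_halfGrad hf hz)))

theorem contDiff_cross : ContDiff ℝ 1 fun p : R3 × R3 => cross p.1 p.2 := by
  unfold cross
  rw [contDiff_piLp]
  intro i
  fin_cases i <;> simp <;> fun_prop

theorem factor_pos {f : S2 → ℝ} {ε : ℝ} (hpos : ∀ p : S2, 0 < 1 + ε * f p) {z : C2}
    (hz : z ≠ 0) : 0 < factor f ε z := by
  rw [factor, homExt_hopfMap f hz]
  exact hpos _

theorem factor_coe (f : S2 → ℝ) (ε : ℝ) (z : S3) : factor f ε z.1 = 1 + ε * f (hopf z) := by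
  rw [factor, ← hopf_val, homExt_coe]

/-! ### Cutting off the Reeb field, and the global Reeb flow on the three-sphere. -/

/-- A smooth function on `ℂ²` that is `1` near `S³` and has compact support in `ℂ² ∖ {0}`. -/
def cutoff (z : C2) : ℝ :=
  (⟨1 / 4, 1 / 2, by norm_num, by norm_num⟩ : ContDiffBump (1 : ℝ)) (‖z‖ ^ 2)

theorem cutoff_eventually_one (z : S3) : ∀ᶠ w in 𝓝 z.1, cutoff w = 1 := by
  have h : ContinuousAt (fun w : C2 => ‖w‖ ^ 2) z.1 := by fun_prop
  have h1 : Metric.closedBall (1 : ℝ) (1 / 4) ∈ 𝓝 (‖z.1‖ ^ 2) := by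
    rw [z.norm_eq_one, one_pow]
    exact Metric.closedBall_mem_nhds _ (by norm_num)
  filter_upwards [h h1] with w hw
  exact ContDiffBump.one_of_mem_closedBall _ hw

theorem cutoff_eq_zero {z : C2} (hz : 1 / 2 ≤ |‖z‖ ^ 2 - 1|) : cutoff z = 0 :=
  ContDiffBump.zero_of_le_dist _ (by rwa [Real.dist_eq])

theorem contDiff_cutoff : ContDiff ℝ 1 cutoff := by
  have h : ContDiff ℝ 1 fun z : C2 => ‖z‖ ^ 2 := by
    have e : (fun z : C2 => ‖z‖ ^ 2) = fun z => (inner ℂ z z).re := by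
      funext z; rw [re_inner_self_C2, Complex.ofReal_re]
    rw [e]
    simp only [inner_C2]
    have h0 : ContDiff ℝ 1 fun z : C2 => z 0 :=
      ((EuclideanSpace.proj (𝕜 := ℂ) (0 : Fin 2)).restrictScalars ℝ : C2 →L[ℝ] ℂ).contDiff
    have h1 : ContDiff ℝ 1 fun z : C2 => z 1 :=
      ((EuclideanSpace.proj (𝕜 := ℂ) (1 : Fin 2)).restrictScalars ℝ : C2 →L[ℝ] ℂ).contDiff
    have hc : ContDiff ℝ 1 fun w : ℂ => star w := Complex.conjCLE.contDiff
    exact Complex.reCLM.contDiff.comp (((hc.comp h0).mul h0).add ((hc.comp h1).mul h1))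
  exact (ContDiffBump.contDiff _).comp h

/-- The Reeb vector field, cut off away from `S³`. -/
def cutField (f : S2 → ℝ) (ε : ℝ) (z : C2) : C2 := cutoff z • reebField f ε z

theorem cutField_eventuallyEq (f : S2 → ℝ) (ε : ℝ) (z : S3) :
    cutField f ε =ᶠ[𝓝 z.1] reebField f ε := by
  filter_upwards [cutoff_eventually_one z] with w hw
  rw [cutField, hw, one_smul]

theorem cutField_coe (f : S2 → ℝ) (ε : ℝ) (z : S3) : cutField f ε z.1 = reebField f ε z.1 :=
  (cutField_eventuallyEq f ε z).self_of_nhds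

theorem contDiff_cutField {f : S2 → ℝ} (hf : ContMDiff (𝓡 2) 𝓘(ℝ, ℝ) ∞ f) {ε : ℝ}
    (hpos : ∀ p : S2, 0 < 1 + ε * f p) : ContDiff ℝ 1 (cutField f ε) := by
  rw [contDiff_iff_contDiffAt]
  intro z
  by_cases hz : z = 0
  · have h : cutField f ε =ᶠ[𝓝 z] fun _ => 0 := by
      filter_upwards [Metric.ball_mem_nhds z (show (0 : ℝ) < 1 / 2 by norm_num)] with w hw
      rw [hz, mem_ball_zero_iff] at hw
      rw [cutField, cutoff_eq_zero, zero_smul]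
      have := norm_nonneg w
      rw [abs_of_nonpos] <;> nlinarith
    exact contDiffAt_const.congr_of_eventuallyEq h
  · exact contDiff_cutoff.contDiffAt.smul (contDiffAt_reebField hf hz (factor_pos hpos hz).ne')

theorem hasCompactSupport_cutField (f : S2 → ℝ) (ε : ℝ) : HasCompactSupport (cutField f ε) := by
  refine HasCompactSupport.of_support_subset_isCompact (isCompact_closedBall (0 : C2) 2) ?_
  intro z hz
  by_contra hn
  rw [mem_closedBall_zero_iff, not_le] at hn
  apply hz
  rw [cutField, cutoff_eq_zero, zero_smul]
  rw [abs_of_nonneg] <;> nlinarith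

theorem exists_lipschitz_cutField {f : S2 → ℝ} (hf : ContMDiff (𝓡 2) 𝓘(ℝ, ℝ) ∞ f) {ε : ℝ}
    (hpos : ∀ p : S2, 0 < 1 + ε * f p) : ∃ K, LipschitzWith K (cutField f ε) :=
  (contDiff_cutField hf hpos).lipschitzWith_of_hasCompactSupport (hasCompactSupport_cutField f ε)
    one_ne_zero

theorem re_inner_cutField {f : S2 → ℝ} (hf : ContMDiff (𝓡 2) 𝓘(ℝ, ℝ) ∞ f) (ε : ℝ) (z : C2) :
    (inner ℂ z (cutField f ε z)).re = 0 := by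
  rw [cutField, ← Complex.coe_smul, inner_smul_right, Complex.re_ofReal_mul,
    re_inner_reebField hf, mul_zero]

theorem cutField_unit_smul (f : S2 → ℝ) (ε : ℝ) {c : ℂ} (hc : ‖c‖ = 1) (z : C2) :
    cutField f ε (c • z) = c • cutField f ε z := by
  have : cutoff (c • z) = cutoff z := by rw [cutoff, cutoff, norm_smul, hc, one_mul]
  rw [cutField, cutField, this, reebField_unit_smul f ε hc, smul_comm]

theorem isReebTrajectory_iff {f : S2 → ℝ} (hf : ContMDiff (𝓡 2) 𝓘(ℝ, ℝ) ∞ f) {ε : ℝ}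
    (hpos : ∀ p : S2, 0 < 1 + ε * f p) {c : ℝ → S3} : IsReebTrajectory f ε c ↔
      ∀ t, HasDerivAt (fun s => (c s : C2)) (cutField f ε (c t).1) t := by
  refine forall_congr' fun t => ?_
  rw [hasReebVelocity_iff hf (factor_pos hpos (c t).ne_zero).ne', cutField_coe]

theorem exists_isReebTrajectory {f : S2 → ℝ} (hf : ContMDiff (𝓡 2) 𝓘(ℝ, ℝ) ∞ f) {ε : ℝ}
    (hpos : ∀ p : S2, 0 < 1 + ε * f p) (z : S3) :
    ∃ c : ℝ → S3, IsReebTrajectory f ε c ∧ c 0 = z := by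
  obtain ⟨K, hK⟩ := exists_lipschitz_cutField hf hpos
  obtain ⟨M, hM⟩ := (hasCompactSupport_cutField f ε).exists_bound_of_continuous
    (contDiff_cutField hf hpos).continuous
  obtain ⟨γ, h0, h⟩ := exists_global_solution_of_bounded_lipschitz hK
    (M := M.toNNReal) (fun x => (hM x).trans (Real.le_coe_toNNReal M)) z.1
  -- The cut-off field is tangent to every sphere centred at the origin, so the norm is conserved
  -- and the solution stays on `S³`.
  have hder : ∀ t, HasDerivAt (fun t => (inner ℂ (γ t) (γ t)).re) 0 t := by
    intro t
    have h1 := (h t).inner ℂ (h t)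
    have h2 := Complex.reCLM.hasFDerivAt.comp_hasDerivAt t h1
    have h3 : Complex.reCLM (inner ℂ (γ t) (cutField f ε (γ t))
        + inner ℂ (cutField f ε (γ t)) (γ t)) = 0 := by
      rw [← inner_conj_symm (cutField f ε (γ t)) (γ t), Complex.reCLM_apply, Complex.add_re,
        Complex.conj_re, re_inner_cutField hf, add_zero]
    rw [h3] at h2
    exact h2
  have hnorm : ∀ t, ‖γ t‖ = 1 := by
    intro t
    have hc := is_const_of_deriv_eq_zero (fun t => (hder t).differentiableAt)
      (fun t => (hder t).deriv) t 0
    simp only [re_inner_self_C2, Complex.ofReal_re, h0, z.norm_eq_one] at hc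
    exact (sq_eq_sq₀ (norm_nonneg _) zero_le_one).mp hc
  exact ⟨fun t => ⟨γ t, mem_sphere_zero_iff_norm.mpr (hnorm t)⟩,
    (isReebTrajectory_iff hf hpos).mpr h, Subtype.ext h0⟩

theorem IsReebTrajectory.eq_of_eq_at {f : S2 → ℝ} (hf : ContMDiff (𝓡 2) 𝓘(ℝ, ℝ) ∞ f) {ε : ℝ}
    (hpos : ∀ p : S2, 0 < 1 + ε * f p) {c c' : ℝ → S3} (hc : IsReebTrajectory f ε c)
    (hc' : IsReebTrajectory f ε c') {t₀ : ℝ} (h : c t₀ = c' t₀) : c = c' := by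
  obtain ⟨K, hK⟩ := exists_lipschitz_cutField hf hpos
  rw [isReebTrajectory_iff hf hpos] at hc hc'
  have := ODE_solution_unique_univ (v := fun _ => cutField f ε) (s := fun _ => Set.univ) (K := K)
    (f := fun t => (c t).1) (g := fun t => (c' t).1) (t₀ := t₀) (fun _ => hK.lipschitzOnWith)
    (fun t => ⟨hc t, trivial⟩) (fun t => ⟨hc' t, trivial⟩) (congrArg Subtype.val h)
  exact funext fun t => Subtype.ext (congrFun this t)

theorem IsReebTrajectory.reebFlow_eq {f : S2 → ℝ} (hf : ContMDiff (𝓡 2) 𝓘(ℝ, ℝ) ∞ f) {ε : ℝ}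
    (hpos : ∀ p : S2, 0 < 1 + ε * f p) {c : ℝ → S3} (hc : IsReebTrajectory f ε c) (t : ℝ) :
    reebFlow f ε t (c 0) = c t := by
  have h : ∃ c' : ℝ → S3, IsReebTrajectory f ε c' ∧ c' 0 = c 0 := ⟨c, hc, rfl⟩
  rw [reebFlow, dif_pos h]
  exact congrFun (h.choose_spec.1.eq_of_eq_at hf hpos hc h.choose_spec.2) t

theorem IsReebTrajectory.comp_add_right {f : S2 → ℝ} {ε : ℝ} {c : ℝ → S3}
    (hc : IsReebTrajectory f ε c) (s : ℝ) : IsReebTrajectory f ε fun t => c (t + s) := by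
  intro t
  obtain ⟨w, hw, h⟩ := hc (t + s)
  exact ⟨w, hw, h.comp_add_const t s⟩

theorem IsReebTrajectory.smul {f : S2 → ℝ} (hf : ContMDiff (𝓡 2) 𝓘(ℝ, ℝ) ∞ f) {ε : ℝ}
    (hpos : ∀ p : S2, 0 < 1 + ε * f p) {g : SU2} (hg : ∀ p, f (cover g • p) = f p) {c : ℝ → S3}
    (hc : IsReebTrajectory f ε c) : IsReebTrajectory f ε fun t => g • c t := by
  intro t
  have h := (hasReebVelocity_iff hf (factor_pos hpos (c t).ne_zero).ne').mp (hc t)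
  have h2 := ((suIsometry g).toContinuousLinearMap.restrictScalars
    ℝ).hasFDerivAt.comp_hasDerivAt t h
  have ha : factor f ε (g • c t).1 ≠ 0 := (factor_pos hpos (S3.ne_zero (g • c t))).ne'
  have key := (hasReebVelocity_iff hf (c := fun t => g • c t) ha).mpr
  rw [← suIsometry_coe, reebField_suIsometry hf ε hg (c t).ne_zero] at key
  exact key h2

/-! ### Trajectories in the quotient -/

theorem Link.mk_eq_iff {G : Subgroup SU2} {x y : S3} :
    Link.mk G x = Link.mk G y ↔ ∃ g ∈ G, g • y = x := by
  rw [Link.mk, Link.mk, Quotient.eq]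
  change x ∈ MulAction.orbit G y ↔ _
  rw [MulAction.mem_orbit_iff]
  exact ⟨fun ⟨g, h⟩ => ⟨g.1, g.2, h⟩, fun ⟨g, hg, h⟩ => ⟨⟨g, hg⟩, h⟩⟩

/-- The distance from a point of `S³` to a `G`-orbit. -/
def orbitDist (G : Subgroup SU2) [Fintype G] (w x : S3) : ℝ :=
  Finset.univ.inf' ⟨1, Finset.mem_univ 1⟩ fun g : G => ‖suIsometry g.1 x.1 - w.1‖

theorem orbitDist_le (G : Subgroup SU2) [Fintype G] (w x : S3) (g : G) :
    orbitDist G w x ≤ ‖suIsometry g.1 x.1 - w.1‖ := Finset.inf'_le _ (Finset.mem_univ g)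

theorem exists_orbitDist_eq (G : Subgroup SU2) [Fintype G] (w x : S3) :
    ∃ g : G, orbitDist G w x = ‖suIsometry g.1 x.1 - w.1‖ := by
  obtain ⟨g, -, hg⟩ := Finset.exists_mem_eq_inf' (s := Finset.univ) ⟨(1 : G), Finset.mem_univ 1⟩
    fun g : G => ‖suIsometry g.1 x.1 - w.1‖
  exact ⟨g, hg⟩

theorem orbitDist_congr_le (G : Subgroup SU2) [Fintype G] (w : S3) {x y : S3}
    (h : Link.mk G x = Link.mk G y) : orbitDist G w x ≤ orbitDist G w y := by
  obtain ⟨k, hk, hyx⟩ := Link.mk_eq_iff.mp h.symm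
  obtain ⟨g, hg⟩ := exists_orbitDist_eq G w y
  rw [hg, ← hyx]
  refine (orbitDist_le G w x (g * ⟨k, hk⟩)).trans_eq ?_
  rw [suIsometry_coe, suIsometry_coe, ← mul_smul]
  rfl

/-- The minimum is over a whole orbit, so only the class of the second point matters. An arbitrary,
possibly discontinuous choice of representatives can thus be replaced near each time by a
differentiable lift. -/
theorem orbitDist_congr (G : Subgroup SU2) [Fintype G] (w : S3) {x y : S3}
    (h : Link.mk G x = Link.mk G y) : orbitDist G w x = orbitDist G w y :=
  le_antisymm (orbitDist_congr_le G w h) (orbitDist_congr_le G w h.symm)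

theorem orbitDist_nonneg (G : Subgroup SU2) [Fintype G] (w x : S3) : 0 ≤ orbitDist G w x := by
  obtain ⟨g, hg⟩ := exists_orbitDist_eq G w x
  rw [hg]; exact norm_nonneg _

/-- A trajectory in the quotient is, in forward time, the image of the trajectory through any lift
of its starting point. -/
theorem mk_eq_of_isQuotientReebTrajectory {G : Subgroup SU2} [Finite G] {f : S2 → ℝ}
    (hf : ContMDiff (𝓡 2) 𝓘(ℝ, ℝ) ∞ f) (hG : ∀ g ∈ G, ∀ p, f (cover g • p) = f p) {ε : ℝ}
    (hpos : ∀ p : S2, 0 < 1 + ε * f p) {γ : ℝ → Link G} (hγ : IsQuotientReebTrajectory G f ε γ)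
    {c : ℝ → S3} (hc : IsReebTrajectory f ε c) (h0 : Link.mk G (c 0) = γ 0) {T : ℝ} (hT : 0 ≤ T) :
    Link.mk G (c T) = γ T := by
  have := Fintype.ofFinite G
  obtain ⟨K, hK⟩ := exists_lipschitz_cutField hf hpos
  have hout : ∀ t, Link.mk G (Quotient.out (γ t)) = γ t := fun t => Quotient.out_eq _
  -- The distance in `S³` from `c t` to the orbit representing `γ t`. It starts at `0` and grows at
  -- a rate of at most `K D`, so Gronwall keeps it at `0`; no covering space argument is needed.
  set D : ℝ → ℝ := fun t => orbitDist G (c t) (Quotient.out (γ t)) with hD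
  have hlocal : ∀ t, ∃ l : ℝ → S3, HasReebVelocity f ε l t ∧
      ∀ᶠ s in 𝓝 t, D s = orbitDist G (c s) (l s) := by
    intro t
    obtain ⟨l, hl, hv⟩ := hγ t
    exact ⟨l, hv, hl.mono fun s hs => orbitDist_congr G _ ((hout s).trans hs.symm)⟩
  have hder : ∀ (t : ℝ) (l : ℝ → S3), HasReebVelocity f ε l t → ∀ g : G,
      HasDerivAt (fun s => suIsometry g.1 (l s).1 - (c s).1)
        (cutField f ε (suIsometry g.1 (l t).1) - cutField f ε (c t).1) t := by
    intro t l hl g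
    have h1 := (hasReebVelocity_iff hf (factor_pos hpos (l t).ne_zero).ne').mp hl
    have h2 := ((suIsometry g.1).toContinuousLinearMap.restrictScalars
      ℝ).hasFDerivAt.comp_hasDerivAt t h1
    rw [suIsometry_coe, cutField_coe, ← suIsometry_coe,
      reebField_suIsometry hf ε (hG g.1 g.2) (l t).ne_zero]
    exact h2.sub ((isReebTrajectory_iff hf hpos).mp hc t)
  have hcont : ContinuousOn D (Set.Icc 0 T) := by
    intro t _
    obtain ⟨l, hl, hev⟩ := hlocal t
    refine ContinuousAt.continuousWithinAt (ContinuousAt.congr ?_ (hev.mono fun s hs => hs.symm))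
    exact ContinuousAt.finset_inf'_apply _ fun g _ => (hder t l hl g).continuousAt.norm
  have hbound := le_gronwallBound_of_liminf_deriv_right_le (f' := fun t => K * D t) (δ := 0)
    (K := K) (ε := 0) hcont
    (by
      intro t _ r hr
      obtain ⟨l, hl, hev⟩ := hlocal t
      -- Fix the group element that attains the minimum at time `t`. Its branch agrees with `D` at
      -- `t` and dominates `D` nearby, so the derivative of that one branch bounds the lower right
      -- derivative of `D`.
      obtain ⟨g, hg⟩ := exists_orbitDist_eq G (c t) (l t)
      have hDt : D t = ‖suIsometry g.1 (l t).1 - (c t).1‖ := hev.self_of_nhds.trans hg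
      have h1 : ‖cutField f ε (suIsometry g.1 (l t).1) - cutField f ε (c t).1‖ < r := by
        refine lt_of_le_of_lt (hK.norm_sub_le _ _) ?_
        rw [← hDt]; exact hr
      have h2 := (hder t l hl g).hasDerivWithinAt.liminf_right_slope_norm_le (x := t) h1
      have hev' : ∀ᶠ s in 𝓝[>] t, D s = orbitDist G (c s) (l s) := nhdsWithin_le_nhds hev
      refine (h2.and_eventually (hev'.and self_mem_nhdsWithin)).mono ?_
      rintro s ⟨hs, hDs, hts⟩
      refine lt_of_le_of_lt ?_ hs
      have hts' : 0 < s - t := sub_pos.mpr hts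
      rw [hDs, hDt]
      have := orbitDist_le G (c s) (l s) g
      gcongr)
    (by
      have : D 0 = orbitDist G (c 0) (c 0) := orbitDist_congr G _ ((hout 0).trans h0.symm)
      rw [this]
      refine (orbitDist_le G (c 0) (c 0) 1).trans_eq ?_
      rw [suIsometry_coe, Subgroup.coe_one, one_smul, sub_self, norm_zero])
    (fun t _ => by simp) T ⟨hT, le_rfl⟩
  rw [gronwallBound_ε0_δ0] at hbound
  obtain ⟨g, hg⟩ := exists_orbitDist_eq G (c T) (Quotient.out (γ T))
  have h1 : ‖suIsometry g.1 (Quotient.out (γ T)).1 - (c T).1‖ = 0 := by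
    rw [← hg]; exact le_antisymm hbound (orbitDist_nonneg _ _ _)
  rw [← hout T, Link.mk_eq_iff]
  refine ⟨g.1, g.2, Subtype.ext ?_⟩
  rw [← suIsometry_coe]
  exact sub_eq_zero.mp (norm_eq_zero.mp h1)

/-! ### Rotation of the Hopf fibres -/

/-- The round Reeb flow `z ↦ e^{iθ} z`. -/
def phase (θ : ℝ) (z : S3) : S3 := ⟨Complex.exp (θ * Complex.I) • z.1, by
  rw [mem_sphere_zero_iff_norm, norm_smul, Complex.norm_exp_ofReal_mul_I, one_mul, z.norm_eq_one]⟩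

theorem phase_val (θ : ℝ) (z : S3) : (phase θ z).1 = Complex.exp (θ * Complex.I) • z.1 := rfl

theorem phase_zero (z : S3) : phase 0 z = z := by
  apply Subtype.ext
  simp [phase_val]

theorem phase_phase (θ η : ℝ) (z : S3) : phase θ (phase η z) = phase (θ + η) z := by
  apply Subtype.ext
  rw [phase_val, phase_val, phase_val, smul_smul, ← Complex.exp_add]
  congr 2
  push_cast
  ring

theorem hopf_phase (θ : ℝ) (z : S3) : hopf (phase θ z) = hopf z := by
  apply Subtype.ext
  rw [hopf_val, hopf_val, phase_val, hopfMap_unit_smul (Complex.norm_exp_ofReal_mul_I θ)]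

theorem smul_phase (g : SU2) (θ : ℝ) (z : S3) : g • phase θ z = phase θ (g • z) := by
  apply Subtype.ext
  rw [← suIsometry_coe, phase_val, phase_val, map_smul, suIsometry_coe]

/-- It turns equality of Hopf images into equality in Cauchy–Schwarz, and so into proportionality by
a unit complex number. -/
theorem two_mul_normSq_inner (z w : C2) :
    2 * Complex.normSq (inner ℂ z w) = ‖z‖ ^ 2 * ‖w‖ ^ 2 + inner ℝ (hopfMap z) (hopfMap w) := by
  rw [inner_C2, inner_R3, norm_sq_C2, norm_sq_C2]
  simp [hopfMap, Complex.normSq_apply]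
  ring

/-- The fibres of the Hopf fibration are the orbits of the phase rotation. -/
theorem exists_phase_eq {z w : S3} (h : hopf z = hopf w) : ∃ θ, w = phase θ z := by
  have h1 : hopfMap z.1 = hopfMap w.1 := congrArg Subtype.val h
  have h2 := two_mul_normSq_inner z.1 w.1
  rw [h1, real_inner_self_eq_norm_sq, norm_hopfMap, z.norm_eq_one, w.norm_eq_one] at h2
  have h3 : Complex.normSq (inner ℂ z.1 w.1) = 1 := by linarith
  set c : ℂ := inner ℂ z.1 w.1 with hc
  have h4 : w.1 = c • z.1 := by
    have h5 : inner ℂ (w.1 - c • z.1) (w.1 - c • z.1) = 0 := by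
      rw [inner_sub_left, inner_sub_right, inner_sub_right, inner_smul_left, inner_smul_left,
        inner_smul_right, inner_smul_right, re_inner_self_C2, re_inner_self_C2, z.norm_eq_one,
        w.norm_eq_one, ← inner_conj_symm w.1 z.1, ← hc]
      have h6 : (starRingEnd ℂ) c * c = 1 := by
        rw [← Complex.normSq_eq_conj_mul_self, h3, Complex.ofReal_one]
      push_cast
      linear_combination (-1 : ℂ) * h6
    exact sub_eq_zero.mp (inner_self_eq_zero.mp h5)
  have h7 : ‖c‖ = 1 := by
    rw [Complex.normSq_eq_norm_sq] at h3
    exact (pow_eq_one_iff_of_nonneg (norm_nonneg c) two_ne_zero).mp h3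
  refine ⟨c.arg, Subtype.ext ?_⟩
  rw [phase_val, h4]
  congr 1
  have := Complex.norm_mul_exp_arg_mul_I c
  rw [h7, Complex.ofReal_one, one_mul] at this
  exact this.symm

/-! ### Critical fibres and short periodic orbits -/

theorem hasDerivAt_exp_smul (a : ℝ) (v : C2) (t : ℝ) :
    HasDerivAt (fun t : ℝ => Complex.exp ((t * a : ℝ) * Complex.I) • v)
      ((a * Complex.I) • (Complex.exp ((t * a : ℝ) * Complex.I) • v)) t := by
  have h1 : HasDerivAt (fun t : ℝ => ((t * a : ℝ) : ℂ) * Complex.I) ((a : ℂ) * Complex.I) t := by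
    have := ((hasDerivAt_id t).mul_const a).ofReal_comp.mul_const Complex.I
    simpa using this
  have h2 := h1.cexp.smul_const v
  rwa [smul_smul, mul_comm ((a : ℂ) * Complex.I)]

theorem halfGrad_eq_zero {f : S2 → ℝ} {z : S3} (hz : homGrad f (hopf z).1 = 0) :
    halfGrad f z.1 = 0 := by
  rw [halfGrad, ← hopf_val, hz, map_zero]
  rfl

/-- Over a critical point `W` vanishes along the entire fibre, since it depends on the gradient at
the Hopf image, and the Reeb field reduces to `i z / a`. -/
theorem isReebTrajectory_phase {f : S2 → ℝ} (hf : ContMDiff (𝓡 2) 𝓘(ℝ, ℝ) ∞ f) {ε : ℝ}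
    (hpos : ∀ p : S2, 0 < 1 + ε * f p) {z : S3} (hz : homGrad f (hopf z).1 = 0) :
    IsReebTrajectory f ε fun t => phase (t * (1 + ε * f (hopf z))⁻¹) z := by
  intro t
  set a : ℝ := 1 + ε * f (hopf z) with ha
  have hfac : factor f ε (phase (t * a⁻¹) z).1 = a := by
    rw [factor_coe, hopf_phase]
  have key := (hasReebVelocity_iff hf (c := fun t => phase (t * a⁻¹) z) (t := t)
    (by rw [hfac]; exact (hpos _).ne')).mpr
  apply key
  have h1 : reebField f ε (phase (t * a⁻¹) z).1
      = ((a⁻¹ : ℝ) * Complex.I) • (phase (t * a⁻¹) z).1 := by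
    have h2 : halfGrad f (phase (t * a⁻¹) z).1 = 0 :=
      halfGrad_eq_zero (by rw [hopf_phase]; exact hz)
    rw [reebField, h2, hfac, smul_zero, smul_zero, sub_zero, ← Complex.coe_smul, smul_smul]
  rw [h1]
  exact hasDerivAt_exp_smul a⁻¹ z.1 t

theorem IsReebTrajectory.factor_eq {f : S2 → ℝ} (hf : ContMDiff (𝓡 2) 𝓘(ℝ, ℝ) ∞ f) {ε : ℝ}
    (hpos : ∀ p : S2, 0 < 1 + ε * f p) {c : ℝ → S3} (hc : IsReebTrajectory f ε c) (t s : ℝ) :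
    factor f ε (c t).1 = factor f ε (c s).1 := by
  have h : ∀ t, HasDerivAt (fun t => factor f ε (c t).1) 0 t := by
    intro t
    have h1 := (hasReebVelocity_iff hf (factor_pos hpos (c t).ne_zero).ne').mp (hc t)
    have h2 := (hasFDerivAt_factor hf ε (c t).ne_zero).differentiableAt.hasFDerivAt.comp_hasDerivAt
      t h1
    rwa [fderiv_factor_reebField hf ε (c t).ne_zero] at h2
  exact is_const_of_deriv_eq_zero (fun t => (h t).differentiableAt) (fun t => (h t).deriv) t s

theorem exists_lipschitzOnWith_cross_homGrad {f : S2 → ℝ}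
    (hf : ContMDiff (𝓡 2) 𝓘(ℝ, ℝ) ∞ f) :
    ∃ K, LipschitzOnWith K (fun x => cross (homGrad f x) x) (Metric.sphere (0 : R3) 1) := by
  apply LocallyLipschitzOn.exists_lipschitzOnWith_of_compact (isCompact_sphere _ _)
  intro x hx
  have hx0 : x ≠ 0 := S2.ne_zero ⟨x, hx⟩
  have h : ContDiffAt ℝ 1 (fun x => cross (homGrad f x) x) x :=
    contDiff_cross.contDiffAt.comp x ((contDiffAt_homGrad hf hx0).prodMk contDiffAt_id)
  obtain ⟨K, t, ht, hK⟩ := h.exists_lipschitzOnWith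
  exact ⟨K, t, mem_nhdsWithin_of_mem_nhds ht, hK⟩

/-- For small `ε`, the periodic orbits of bounded period lie over critical points. -/
theorem exists_short_orbits_critical {f : S2 → ℝ} (hf : ContMDiff (𝓡 2) 𝓘(ℝ, ℝ) ∞ f) :
    ∃ C : ℝ, 0 < C ∧ ∀ ε : ℝ, 0 < ε → (∀ p : S2, 1 / 2 ≤ 1 + ε * f p) → ∀ c : ℝ → S3,
      IsReebTrajectory f ε c → ∀ T, 0 < T → Function.Periodic c T → ε * C * T < 1 →
        ∀ t, homGrad f (hopf (c t)).1 = 0 := by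
  obtain ⟨K, hK⟩ := exists_lipschitzOnWith_cross_homGrad hf
  -- The projected field is `κ` times a fixed `K`-Lipschitz field, where `|κ| = 2ε/a² ≤ 8ε` because
  -- `a ≥ 1/2`. The `+ 1` keeps the constant positive.
  refine ⟨8 * (K + 1), by positivity, fun ε hε hhalf c hc T hT hper hCT t => ?_⟩
  have hpos : ∀ p : S2, 0 < 1 + ε * f p := fun p => lt_of_lt_of_le (by norm_num) (hhalf p)
  set a := factor f ε (c 0).1 with ha
  have ha2 : 1 / 2 ≤ a := by rw [ha, factor_coe]; exact hhalf _
  have hapos : 0 < a := by linarith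
  set κ : ℝ := -(2 * (ε / a ^ 2)) with hκ
  have hκle : |κ| ≤ 8 * ε := by
    rw [hκ, abs_neg, abs_of_pos (by positivity)]
    have : ε / a ^ 2 ≤ 4 * ε := by
      rw [div_le_iff₀ (by positivity)]
      have : 1 / 4 ≤ a ^ 2 := by nlinarith
      nlinarith
    linarith
  have hder : ∀ t, HasDerivAt (fun t => (hopf (c t)).1)
      (κ • cross (homGrad f (hopf (c t)).1) (hopf (c t)).1) t := by
    intro t
    have h1 := (hasReebVelocity_iff hf (factor_pos hpos (c t).ne_zero).ne').mp (hc t)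
    have h2 := (hasFDerivAt_hopfMap (c t).1).comp_hasDerivAt t h1
    rw [hopfPolar_reebField, hc.factor_eq hf hpos t 0, ← ha, ← hκ] at h2
    exact h2
  have hV : LipschitzOnWith (‖κ‖₊ * K) (fun x => κ • cross (homGrad f x) x)
      (Metric.sphere (0 : R3) 1) := (lipschitzWith_smul κ).comp_lipschitzOnWith hK
  have h0 := deriv_eq_zero_of_short_period hV (fun t => (hopf (c t)).2) hder hT
    (fun t => by simp only [hper t]) (by
      have h3 : ((‖κ‖₊ * K : NNReal) : ℝ) = |κ| * K := by simp
      rw [h3]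
      have hK0 : (0 : ℝ) ≤ K := K.2
      have : |κ| * K * T ≤ ε * (8 * (K + 1)) * T := by
        gcongr ?_ * T
        nlinarith [abs_nonneg κ]
      linarith) t
  have hκne : κ ≠ 0 := by
    rw [hκ, neg_ne_zero]; positivity
  -- The velocity vanishes, hence so does the cross product; the gradient is orthogonal to the unit
  -- base point, so it vanishes as well.
  have h1 : cross (homGrad f (hopf (c t)).1) (hopf (c t)).1 = 0 :=
    (smul_eq_zero.mp h0).resolve_left hκne
  have h2 := norm_sq_cross (homGrad f (hopf (c t)).1) (hopf (c t)).1
  rw [h1, inner_homGrad_self hf (S2.ne_zero _), S2.norm_eq_one] at h2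
  have h3 : ‖homGrad f (hopf (c t)).1‖ ^ 2 = 0 := by simpa using h2.symm
  exact norm_eq_zero.mp (pow_eq_zero_iff two_ne_zero |>.mp h3)

/-! ### The Hessian at a critical point in normal form -/

/-- The stereographic coordinate of `x / ‖x‖` from the point `-p` along the unit vector `ρ`. -/
def stereoCoord (p ρ x : R3) : ℝ := inner ℝ ρ x * (‖x‖ + inner ℝ p x)⁻¹

/-- The factor `⟨ρ, x⟩` vanishes at `p`, so only it is differentiated, and the denominator there
equals `2`. -/
theorem hasFDerivAt_stereoCoord {p ρ : R3} (hp : ‖p‖ = 1) (hρ : inner ℝ ρ p = (0 : ℝ)) :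
    HasFDerivAt (stereoCoord p ρ) ((1 / 2 : ℝ) • innerSL ℝ ρ) p := by
  have hp0 : p ≠ 0 := by rw [← norm_ne_zero_iff, hp]; exact one_ne_zero
  have hd : (‖p‖ + inner ℝ p p) ≠ 0 := by rw [real_inner_self_eq_norm_sq, hp]; norm_num
  have h1 : DifferentiableAt ℝ (fun x : R3 => (‖x‖ + inner ℝ p x)⁻¹) p :=
    (((contDiffAt_norm (n := 1) ℝ hp0).differentiableAt one_ne_zero).add
      (innerSL ℝ p).differentiableAt).inv hd
  have h2 := ((innerSL ℝ ρ).hasFDerivAt (x := p)).mul h1.hasFDerivAt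
  refine h2.congr_fderiv ?_
  rw [innerSL_apply_apply, hρ, zero_smul, zero_add, real_inner_self_eq_norm_sq, hp]
  norm_num

theorem stereoCoord_self {p ρ : R3} (hρ : inner ℝ ρ p = (0 : ℝ)) : stereoCoord p ρ p = 0 := by
  rw [stereoCoord, hρ, zero_mul]

theorem contDiffAt_stereoCoord {p ρ : R3} (hp : ‖p‖ = 1) :
    ContDiffAt ℝ 2 (stereoCoord p ρ) p := by
  have hp0 : p ≠ 0 := by rw [← norm_ne_zero_iff, hp]; exact one_ne_zero
  have hd : (‖p‖ + inner ℝ p p) ≠ 0 := by rw [real_inner_self_eq_norm_sq, hp]; norm_num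
  exact (innerSL ℝ ρ).contDiff.contDiffAt.mul
    (((contDiffAt_norm ℝ hp0).add (innerSL ℝ p).contDiff.contDiffAt).inv hd)

/-- Near `p`, the homogeneous extension of a function in stereographic normal form. -/
structure NormalFrame (f : S2 → ℝ) (p : S2) (c q₁ q₂ : ℝ) (ρ₁ ρ₂ : R3) : Prop where
  norm_left : ‖ρ₁‖ = 1
  norm_right : ‖ρ₂‖ = 1
  inner_eq : inner ℝ ρ₁ ρ₂ = (0 : ℝ)
  inner_left : inner ℝ ρ₁ p.1 = (0 : ℝ)
  inner_right : inner ℝ ρ₂ p.1 = (0 : ℝ)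
  eventually_eq : ∀ᶠ x in 𝓝 p.1, homExt f x =
    c + (q₁ * stereoCoord p.1 ρ₁ x ^ 2 + q₂ * stereoCoord p.1 ρ₂ x ^ 2) / 2

theorem stereo_zero (x y : ℝ) : (stereo x y).1 0 = 2 * x / (1 + x ^ 2 + y ^ 2) := rfl

theorem stereo_one (x y : ℝ) : (stereo x y).1 1 = 2 * y / (1 + x ^ 2 + y ^ 2) := rfl

theorem stereo_two (x y : ℝ) :
    (stereo x y).1 2 = (1 - x ^ 2 - y ^ 2) / (1 + x ^ 2 + y ^ 2) := rfl

/-- The columns of the rotation `g` supply the data: the third is `p`, the image of the origin of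
the chart, and the first two are `ρ₁` and `ρ₂`. Inverting stereographic projection then expresses
the chart coordinates of `x / ‖x‖` through inner products with the columns. -/
theorem HasStereographicForm.exists_normalFrame {f : S2 → ℝ} {p : S2} {c q₁ q₂ : ℝ}
    (h : HasStereographicForm f p fun x y => c + (q₁ * x ^ 2 + q₂ * y ^ 2) / 2) :
    ∃ ρ₁ ρ₂, NormalFrame f p c q₁ q₂ ρ₁ ρ₂ := by
  obtain ⟨g, hgp, hev⟩ := h
  have hg := Matrix.mem_specialOrthogonalGroup_iff.mp g.2
  have hgt : g.1 * g.1.transpose = 1 := Matrix.mem_orthogonalGroup_iff _ _ |>.mp hg.1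
  have htg : g.1.transpose * g.1 = 1 := Matrix.mem_orthogonalGroup_iff' _ _ |>.mp hg.1
  have hp : ∀ i, p.1 i = g.1 i 2 := by
    intro i
    rw [← hgp]
    change (g.1.mulVec (stereo 0 0).1.ofLp) i = _
    simp [stereo, Matrix.mulVec, dotProduct, Fin.sum_univ_three]
  have hcol : ∀ j k, g.1 0 j * g.1 0 k + g.1 1 j * g.1 1 k + g.1 2 j * g.1 2 k
      = if j = k then 1 else 0 := by
    intro j k
    have := congrFun (congrFun htg j) k
    rw [Matrix.mul_apply, Fin.sum_univ_three, Matrix.one_apply] at this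
    simpa [Matrix.transpose_apply] using this
  have hrow : ∀ j k, g.1 j 0 * g.1 k 0 + g.1 j 1 * g.1 k 1 + g.1 j 2 * g.1 k 2
      = if j = k then 1 else 0 := by
    intro j k
    have := congrFun (congrFun hgt j) k
    rw [Matrix.mul_apply, Fin.sum_univ_three, Matrix.one_apply] at this
    simpa [Matrix.transpose_apply] using this
  let ρ : Fin 3 → R3 := fun k => WithLp.toLp 2 fun i => g.1 i k
  have hρp : p.1 = ρ 2 := by ext i; exact hp i
  have hinner : ∀ j k, inner ℝ (ρ j) (ρ k) = if j = k then (1 : ℝ) else 0 := by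
    intro j k
    rw [inner_R3]
    exact hcol j k
  have hnorm : ∀ j, ‖ρ j‖ = 1 := by
    intro j
    have := hinner j j
    rw [if_pos rfl, real_inner_self_eq_norm_sq] at this
    exact (pow_eq_one_iff_of_nonneg (norm_nonneg _) two_ne_zero).mp this
  refine ⟨ρ 0, ρ 1, hnorm 0, hnorm 1, by simpa using hinner 0 1,
    by rw [hρp]; simpa using hinner 0 2, by rw [hρp]; simpa using hinner 1 2, ?_⟩
  have hi : ∀ k, inner ℝ (ρ k) p.1 = if k = 2 then (1 : ℝ) else 0 := fun k => hρp ▸ hinner k 2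
  have hcont : Filter.Tendsto (fun x => (stereoCoord p.1 (ρ 0) x, stereoCoord p.1 (ρ 1) x))
      (𝓝 p.1) (𝓝 (0, 0)) := by
    have h0 := (contDiffAt_stereoCoord (ρ := ρ 0) p.norm_eq_one).continuousAt.tendsto
    have h1 := (contDiffAt_stereoCoord (ρ := ρ 1) p.norm_eq_one).continuousAt.tendsto
    rw [stereoCoord_self (by simpa using hi 0)] at h0
    rw [stereoCoord_self (by simpa using hi 1)] at h1
    exact h0.prodMk_nhds h1
  have hpos : ∀ᶠ x in 𝓝 p.1, 0 < ‖x‖ + inner ℝ p.1 x := by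
    have hc : ContinuousAt (fun x : R3 => ‖x‖ + inner ℝ p.1 x) p.1 := by fun_prop
    refine hc.eventually_const_lt ?_
    change 0 < ‖p.1‖ + inner ℝ p.1 p.1
    rw [real_inner_self_eq_norm_sq, p.norm_eq_one]; norm_num
  filter_upwards [hcont.eventually hev, hpos, isOpen_ne.mem_nhds p.ne_zero] with x hx hxpos hx0
  rw [← hx, homExt_of_ne_zero f hx0]
  congr 1
  apply Subtype.ext
  ext i
  change ‖x‖⁻¹ * x i = (g.1.mulVec (stereo _ _).1.ofLp) i
  have hr : 0 < ‖x‖ := norm_pos_iff.mpr hx0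
  have hr2 := norm_sq_R3 x
  rw [hρp] at hxpos ⊢
  set r := ‖x‖ with hr_def
  have e : ∀ k, inner ℝ (ρ k) x = g.1 0 k * x 0 + g.1 1 k * x 1 + g.1 2 k * x 2 :=
    fun k => inner_R3 _ _
  have hsum : inner ℝ (ρ 0) x ^ 2 + inner ℝ (ρ 1) x ^ 2 + inner ℝ (ρ 2) x ^ 2 = r ^ 2 := by
    rw [e, e, e, hr2]
    have h00 := hrow 0 0
    have h11 := hrow 1 1
    have h22 := hrow 2 2
    have h01 := hrow 0 1
    have h02 := hrow 0 2
    have h12 := hrow 1 2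
    simp at h00 h11 h22 h01 h02 h12
    linear_combination x 0 ^ 2 * h00 + x 1 ^ 2 * h11 + x 2 ^ 2 * h22 + 2 * x 0 * x 1 * h01
      + 2 * x 0 * x 2 * h02 + 2 * x 1 * x 2 * h12
  have hexp : x i = g.1 i 0 * inner ℝ (ρ 0) x + g.1 i 1 * inner ℝ (ρ 1) x
      + g.1 i 2 * inner ℝ (ρ 2) x := by
    rw [e, e, e]
    have h0 := hrow i 0
    have h1 := hrow i 1
    have h2 := hrow i 2
    have : x i = (if i = 0 then 1 else 0) * x 0 + (if i = 1 then 1 else 0) * x 1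
      + (if i = 2 then 1 else 0) * x 2 := by fin_cases i <;> simp
    rw [this, ← h0, ← h1, ← h2]
    ring
  have hmul : ∀ s : R3, (g.1.mulVec s.ofLp) i = g.1 i 0 * s 0 + g.1 i 1 * s 1 + g.1 i 2 * s 2 :=
    fun s => by simp [Matrix.mulVec, dotProduct, Fin.sum_univ_three]
  rw [hexp, hmul, stereo_zero, stereo_one, stereo_two]
  simp only [stereoCoord, ← hr_def]
  generalize inner ℝ (ρ 0) x = a at *
  generalize inner ℝ (ρ 1) x = b at *
  generalize inner ℝ (ρ 2) x = d at *
  have hne : r + d ≠ 0 := hxpos.ne'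
  -- On a ray of length `r`, `a² + b² = r² - d² = (r - d)(r + d)`, so the stereographic denominators
  -- collapse.
  have hden : 1 + (a * (r + d)⁻¹) ^ 2 + (b * (r + d)⁻¹) ^ 2 = 2 * r * (r + d)⁻¹ := by
    field_simp
    linear_combination hsum
  have hnum : 1 - (a * (r + d)⁻¹) ^ 2 - (b * (r + d)⁻¹) ^ 2 = 2 * d * (r + d)⁻¹ := by
    field_simp
    linear_combination -hsum
  rw [hnum, hden]
  field_simp

/-- The derivative of the gradient at a critical point in normal form. -/
def hessMap (q₁ q₂ : ℝ) (ρ₁ ρ₂ : R3) : R3 →L[ℝ] R3 :=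
  (q₁ / 4) • (innerSL ℝ ρ₁).smulRight ρ₁ + (q₂ / 4) • (innerSL ℝ ρ₂).smulRight ρ₂

theorem NormalFrame.fderiv_eventually_eq {f : S2 → ℝ} {p : S2} {c q₁ q₂ : ℝ} {ρ₁ ρ₂ : R3}
    (h : NormalFrame f p c q₁ q₂ ρ₁ ρ₂) : ∀ᶠ x in 𝓝 p.1, fderiv ℝ (homExt f) x =
      (q₁ * stereoCoord p.1 ρ₁ x) • fderiv ℝ (stereoCoord p.1 ρ₁) x
        + (q₂ * stereoCoord p.1 ρ₂ x) • fderiv ℝ (stereoCoord p.1 ρ₂) x := by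
  have h1 := (contDiffAt_stereoCoord (ρ := ρ₁) p.norm_eq_one).eventually (by simp)
  have h2 := (contDiffAt_stereoCoord (ρ := ρ₂) p.norm_eq_one).eventually (by simp)
  filter_upwards [h1, h2, h.eventually_eq.eventually_nhds] with x hx1 hx2 hx
  rw [Filter.EventuallyEq.fderiv_eq hx]
  have d1 := (hx1.differentiableAt (by simp)).hasFDerivAt
  have d2 := (hx2.differentiableAt (by simp)).hasFDerivAt
  have := (((((d1.pow 2).const_mul q₁).add ((d2.pow 2).const_mul q₂)).mul_const
    (2⁻¹ : ℝ)).const_add c).fderiv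
  simp only [div_eq_mul_inv]
  refine this.trans ?_
  ext v
  simp
  ring

theorem NormalFrame.homGrad_eq_zero {f : S2 → ℝ} {p : S2} {c q₁ q₂ : ℝ} {ρ₁ ρ₂ : R3}
    (h : NormalFrame f p c q₁ q₂ ρ₁ ρ₂) : homGrad f p.1 = 0 := by
  rw [homGrad_eq_zero_iff, h.fderiv_eventually_eq.self_of_nhds, stereoCoord_self h.inner_left,
    stereoCoord_self h.inner_right]
  simp

theorem NormalFrame.value {f : S2 → ℝ} {p : S2} {c q₁ q₂ : ℝ} {ρ₁ ρ₂ : R3}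
    (h : NormalFrame f p c q₁ q₂ ρ₁ ρ₂) : f p = c := by
  rw [← homExt_coe f p, h.eventually_eq.self_of_nhds, stereoCoord_self h.inner_left,
    stereoCoord_self h.inner_right]
  simp

/-- The gradient is a sum of terms `q s ds`. The coordinate `s` vanishes at `p`, so its second
derivative does not contribute, and `ds = ρ/2` gives the coefficient `q/4`. -/
theorem NormalFrame.hasFDerivAt_homGrad {f : S2 → ℝ} {p : S2} {c q₁ q₂ : ℝ} {ρ₁ ρ₂ : R3}
    (h : NormalFrame f p c q₁ q₂ ρ₁ ρ₂) :
    HasFDerivAt (homGrad f) (hessMap q₁ q₂ ρ₁ ρ₂) p.1 := by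
  have aux : ∀ (q : ℝ) (ρ : R3), inner ℝ ρ p.1 = (0 : ℝ) →
      HasFDerivAt (fun x => (q * stereoCoord p.1 ρ x) • fderiv ℝ (stereoCoord p.1 ρ) x)
        ((q / 4) • (innerSL ℝ ρ).smulRight (innerSL ℝ ρ)) p.1 := by
    intro q ρ hρ
    have h1 := (hasFDerivAt_stereoCoord p.norm_eq_one hρ).const_mul q
    have h2 : DifferentiableAt ℝ (fderiv ℝ (stereoCoord p.1 ρ)) p.1 :=
      ((contDiffAt_stereoCoord p.norm_eq_one).fderiv_right (m := 1) (by norm_num)).differentiableAt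
        one_ne_zero
    refine (h1.smul h2.hasFDerivAt).congr_fderiv ?_
    rw [stereoCoord_self hρ, mul_zero, zero_smul, zero_add,
      (hasFDerivAt_stereoCoord p.norm_eq_one hρ).fderiv]
    ext v w
    simp
    ring
  have h1 := ((aux q₁ ρ₁ h.inner_left).add (aux q₂ ρ₂ h.inner_right)).congr_of_eventuallyEq
    h.fderiv_eventually_eq
  have h2 := (InnerProductSpace.toDual ℝ R3).symm.toContinuousLinearEquiv.hasFDerivAt.comp p.1 h1
  refine h2.congr_fderiv ?_
  have e : ∀ ρ : R3, (InnerProductSpace.toDual ℝ R3).symm (innerSL ℝ ρ) = ρ := by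
    intro ρ
    rw [LinearIsometryEquiv.symm_apply_eq]
    rfl
  ext1 v
  simp [hessMap, e]

/-! ### The linearized Reeb flow along a critical fibre -/

/-- The derivative of `halfGrad` at a point over a critical point in normal form. -/
def halfHess (q₁ q₂ : ℝ) (ρ₁ ρ₂ : R3) (z : C2) : C2 →L[ℝ] C2 :=
  (pauli.flip z).comp ((hessMap q₁ q₂ ρ₁ ρ₂).comp (hopfPolar z))

/-- The coefficient `q/4` of the Hessian meets the factor `2` from `inner_hopfPolar`, whence `q/2`.
-/
theorem halfHess_apply (q₁ q₂ : ℝ) (ρ₁ ρ₂ : R3) (z v : C2) : halfHess q₁ q₂ ρ₁ ρ₂ z v =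
    (q₁ / 2 * (inner ℂ (pauli ρ₁ z) v).re) • pauli ρ₁ z
      + (q₂ / 2 * (inner ℂ (pauli ρ₂ z) v).re) • pauli ρ₂ z := by
  simp only [halfHess, hessMap, ContinuousLinearMap.comp_apply, ContinuousLinearMap.flip_apply,
    add_apply, smul_apply, ContinuousLinearMap.smulRight_apply, innerSL_apply_apply,
    inner_hopfPolar, map_add, map_smul, smul_smul]
  congr 2 <;> ring

theorem NormalFrame.hasFDerivAt_halfGrad {f : S2 → ℝ} {z : S3} {c q₁ q₂ : ℝ} {ρ₁ ρ₂ : R3}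
    (h : NormalFrame f (hopf z) c q₁ q₂ ρ₁ ρ₂) :
    HasFDerivAt (halfGrad f) (halfHess q₁ q₂ ρ₁ ρ₂ z.1) z.1 := by
  have h1 : HasFDerivAt (homGrad f) (hessMap q₁ q₂ ρ₁ ρ₂) (hopfMap z.1) := h.hasFDerivAt_homGrad
  have h2 := pauli.hasFDerivAt.comp z.1 (h1.comp z.1 (hasFDerivAt_hopfMap z.1))
  have h3 := h2.clm_apply (hasFDerivAt_id z.1)
  refine h3.congr_fderiv ?_
  have h0 : homGrad f (hopfMap z.1) = 0 := h.homGrad_eq_zero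
  ext1 v
  simp [h0, halfHess]

/-- At a critical point both `da` and `W` vanish, so in the product rule the scalar coefficients
behave as constants. -/
theorem NormalFrame.hasFDerivAt_reebField {f : S2 → ℝ} (hf : ContMDiff (𝓡 2) 𝓘(ℝ, ℝ) ∞ f)
    {ε : ℝ} (hpos : ∀ p : S2, 0 < 1 + ε * f p) {z : S3} {c q₁ q₂ : ℝ} {ρ₁ ρ₂ : R3}
    (h : NormalFrame f (hopf z) c q₁ q₂ ρ₁ ρ₂) :
    ∃ B : C2 →L[ℝ] C2, HasFDerivAt (reebField f ε) B z.1 ∧ ∀ v, B v =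
      (1 + ε * c)⁻¹ • (Complex.I • v)
        - (ε / (1 + ε * c) ^ 2) • (Complex.I • halfHess q₁ q₂ ρ₁ ρ₂ z.1 v) := by
  have hfac : factor f ε z.1 = 1 + ε * c := by rw [factor_coe, h.value]
  have hne : factor f ε z.1 ≠ 0 := (factor_pos hpos z.ne_zero).ne'
  have hW0 : halfGrad f z.1 = 0 := halfGrad_eq_zero h.homGrad_eq_zero
  have hda : HasFDerivAt (factor f ε) (0 : C2 →L[ℝ] ℝ) z.1 := by
    refine (hasFDerivAt_factor hf ε z.ne_zero).differentiableAt.hasFDerivAt.congr_fderiv ?_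
    ext1 v
    rw [fderiv_factor_apply hf ε z.ne_zero, hW0]
    simp
  let J : C2 →L[ℝ] C2 := (Complex.I • ContinuousLinearMap.id ℂ C2).restrictScalars ℝ
  have hJ : ∀ v, J v = Complex.I • v := fun v => rfl
  have hinv : HasFDerivAt (fun z => (factor f ε z)⁻¹) (0 : C2 →L[ℝ] ℝ) z.1 := by
    refine ((hasDerivAt_inv hne).comp_hasFDerivAt z.1 hda).congr_fderiv ?_
    rw [smul_zero]
  have hdiv : HasFDerivAt (fun z => ε / factor f ε z ^ 2) (0 : C2 →L[ℝ] ℝ) z.1 := by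
    refine (((hinv.pow 2).const_mul ε).congr_fderiv (g' := 0) (by simp)).congr_of_eventuallyEq
      (Filter.Eventually.of_forall fun w => ?_)
    simp only [div_eq_mul_inv, inv_pow]
  have h1 := hinv.smul (J.hasFDerivAt (x := z.1))
  have h2 := hdiv.smul (J.hasFDerivAt.comp z.1 h.hasFDerivAt_halfGrad)
  refine ⟨_, h1.sub h2, fun v => ?_⟩
  simp [hJ, hfac]

theorem inner_frame_zero_self (z : S3) : inner ℂ (frame 0 z) (frame 0 z) = 1 := by
  have h := s3_normSq z
  rw [inner_C2]
  simp only [frame]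
  apply Complex.ext
  · simp [Complex.normSq_apply] at h ⊢
    linarith
  · simp
    ring

theorem frame_one (z : S3) : frame 1 z = Complex.I • frame 0 z := by
  simp [frame]

/-- The contact plane is a complex line spanned by `V₁`; this supplies the complex coordinate in
which the linearized flow is computed. -/
theorem eq_smul_frame (z : S3) {v : C2} (hv : inner ℂ z.1 v = 0) :
    v = inner ℂ (frame 0 z) v • frame 0 z := by
  have hz : star (z.1 0) * z.1 0 + star (z.1 1) * z.1 1 = 1 := by
    have := re_inner_self_C2 z.1
    rw [z.norm_eq_one, inner_C2] at this
    simpa using this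
  rw [inner_C2] at hv ⊢
  ext i
  fin_cases i
  · simp [frame] at hv hz ⊢
    linear_combination z.1 0 * hv - v 0 * hz
  · simp [frame] at hv hz ⊢
    linear_combination z.1 1 * hv - v 1 * hz

/-- `V₁` is conjugate-linear in `z`, so it turns against the flow. This is why the linearized flow
rotates with speed `2/a` rather than `1/a` before the Hessian correction. -/
theorem frame_phase (i : Fin 2) (θ : ℝ) (z : S3) :
    frame i (phase θ z) = Complex.exp (-(θ * Complex.I)) • frame i z := by
  have h : star (Complex.exp (θ * Complex.I)) = Complex.exp (-(θ * Complex.I)) := by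
    rw [Complex.star_def, ← Complex.exp_conj, map_mul, Complex.conj_ofReal, Complex.conj_I,
      mul_neg]
  have h' : (starRingEnd ℂ) (Complex.exp (θ * Complex.I)) = Complex.exp (-(θ * Complex.I)) := h
  rw [frame, frame, smul_comm]
  congr 1
  ext j
  fin_cases j <;> simp [phase_val, h']

theorem hasDerivAt_greatCircle (i : Fin 2) (z : S3) :
    HasDerivAt (fun s => (greatCircle i z s : C2)) (frame i z) 0 := by
  have h1 := ((Real.hasDerivAt_cos 0).smul_const z.1).add
    ((Real.hasDerivAt_sin 0).smul_const (frame i z))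
  exact h1.congr_deriv (by simp)

theorem greatCircle_zero (i : Fin 2) (z : S3) : greatCircle i z 0 = z := by
  apply Subtype.ext
  simp [greatCircle]

/-- A vector of the contact plane over a critical point, as a complex coordinate. -/
def toComplex (v : Fin 2 → ℝ) : ℂ := ⟨v 0, v 1⟩

/-- The linearized Reeb flow along a critical fibre, in terms of the linearized equation in the
complex coordinate of the contact plane. -/
theorem NormalFrame.linearizedFlow_apply {f : S2 → ℝ} (hf : ContMDiff (𝓡 2) 𝓘(ℝ, ℝ) ∞ f)
    {ε : ℝ} (hpos : ∀ p : S2, 0 < 1 + ε * f p) {z : S3} {c q₁ q₂ : ℝ} {ρ₁ ρ₂ : R3}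
    (h : NormalFrame f (hopf z) c q₁ q₂ ρ₁ ρ₂) {η₁ η₂ : ℂ}
    (hη₁ : pauli ρ₁ z.1 = η₁ • frame 0 z) (hη₂ : pauli ρ₂ z.1 = η₂ • frame 0 z)
    {ζ : Fin 2 → ℝ → ℂ} (hζ : ∀ j t, HasDerivAt (ζ j)
      (-(ε / (1 + ε * c) ^ 2 : ℝ) * (Complex.I * ((q₁ / 2 * (star η₁ * ζ j t).re : ℝ) * η₁
        + (q₂ / 2 * (star η₂ * ζ j t).re : ℝ) * η₂))) t)
    (hζ0 : ζ 0 0 = 1) (hζ1 : ζ 1 0 = Complex.I) {t : ℝ} (ht : 0 ≤ t) (v : Fin 2 → ℝ) :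
    toComplex ((linearizedFlow f ε t z).mulVec v) =
      Complex.exp ((t * (2 / (1 + ε * c)) : ℝ) * Complex.I) * (v 0 * ζ 0 t + v 1 * ζ 1 t) := by
  set a : ℝ := 1 + ε * c with ha
  have hfz : f (hopf z) = c := h.value
  obtain ⟨K, hK⟩ := exists_lipschitz_cutField hf hpos
  obtain ⟨B, hB, hBv⟩ := h.hasFDerivAt_reebField hf hpos
  let J : C2 →L[ℝ] C2 := ((a⁻¹ * Complex.I : ℂ) • ContinuousLinearMap.id ℂ C2).restrictScalars ℝ
  have hJ : ∀ v, J v = (a⁻¹ * Complex.I : ℂ) • v := fun v => rfl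
  -- By phase equivariance, the field in the frame rotating with speed `1/a` is again autonomous,
  -- namely `Y`, and `z` is an equilibrium of it.
  let Y : C2 → C2 := fun y => cutField f ε y - J y
  have hYlip : LipschitzWith (K + ‖J‖₊) Y := hK.sub J.lipschitz
  have hreeb : reebField f ε z.1 = J z.1 := by
    rw [reebField, halfGrad_eq_zero h.homGrad_eq_zero, factor_coe, hfz, smul_zero, smul_zero,
      sub_zero, hJ, ← Complex.coe_smul, smul_smul, Complex.ofReal_inv]
  have hY0 : Y z.1 = 0 := by
    change cutField f ε z.1 - J z.1 = 0
    rw [cutField_coe, hreeb, sub_self]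
  have hYd : HasFDerivAt Y (B - J) z.1 :=
    (hB.congr_of_eventuallyEq (cutField_eventuallyEq f ε z)).sub J.hasFDerivAt
  have hBJ : ∀ v, (B - J) v
      = -((ε / a ^ 2 : ℝ) * Complex.I : ℂ) • halfHess q₁ q₂ ρ₁ ρ₂ z.1 v := by
    intro v
    change B v - J v = _
    rw [hBv, hJ, ← Complex.coe_smul, ← Complex.coe_smul, smul_smul, smul_smul, Complex.ofReal_inv,
      sub_right_comm, sub_self, zero_sub, neg_smul]
  have hVV := inner_frame_zero_self z
  have hderiv : ∀ j, HasDerivAt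
      (fun s => (reebFlow f ε t (greatCircle j z s) : C2))
      (Complex.exp ((t * a⁻¹ : ℝ) * Complex.I) • (ζ j t • frame 0 z)) 0 := by
    intro j
    have hex : ∀ s, ∃ c : ℝ → S3, IsReebTrajectory f ε c ∧ c 0 = greatCircle j z s :=
      fun s => exists_isReebTrajectory hf hpos _
    choose C hC hC0 using hex
    let y : ℝ → ℝ → C2 := fun s t => Complex.exp (((t * (-a⁻¹) : ℝ) : ℂ) * Complex.I) • (C s t).1
    have hy : ∀ s t, HasDerivAt (y s) (Y (y s t)) t := by
      intro s t
      have h1 := (isReebTrajectory_iff hf hpos).mp (hC s) t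
      have h2 : HasDerivAt (fun t : ℝ => ((t * (-a⁻¹) : ℝ) : ℂ) * Complex.I)
          (((-a⁻¹ : ℝ) : ℂ) * Complex.I) t := by
        have := ((hasDerivAt_id t).mul_const (-a⁻¹)).ofReal_comp.mul_const Complex.I
        simpa using this
      have h3 := h2.cexp.smul h1
      refine h3.congr_deriv ?_
      change _ = cutField f ε (Complex.exp (((t * (-a⁻¹) : ℝ) : ℂ) * Complex.I) • (C s t).1)
        - J (Complex.exp (((t * (-a⁻¹) : ℝ) : ℂ) * Complex.I) • (C s t).1)
      rw [cutField_unit_smul f ε (Complex.norm_exp_ofReal_mul_I _), hJ, sub_eq_add_neg, smul_smul,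
        ← neg_smul]
      congr 2
      push_cast
      ring
    have hy0 : ∀ s, y s 0 = greatCircle j z s := by
      intro s
      change Complex.exp (((0 * (-a⁻¹) : ℝ) : ℂ) * Complex.I) • (C s 0).1 = _
      rw [hC0]
      simp
    -- The equation assumed for `ζ` is exactly the linearization of `Y` at `z`, written in the
    -- coordinate of the contact plane.
    have hw : ∀ t, HasDerivAt (fun t => ζ j t • frame 0 z)
        ((B - J) (ζ j t • frame 0 z)) t := by
      intro t
      refine ((hζ j t).smul_const (frame 0 z)).congr_deriv ?_
      rw [hBJ, halfHess_apply, hη₁, hη₂, inner_smul_left, inner_smul_left, inner_smul_right, hVV,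
        mul_one, ← Complex.coe_smul, ← Complex.coe_smul, smul_smul, smul_smul, ← add_smul,
        smul_smul]
      congr 1
      simp only [Complex.star_def]
      push_cast
      ring
    have hinit : ζ j 0 • frame 0 z = frame j z := by
      fin_cases j
      · change ζ 0 0 • frame 0 z = frame 0 z
        rw [hζ0, one_smul]
      · change ζ 1 0 • frame 0 z = frame 1 z
        rw [hζ1, frame_one]
    have key := hasDerivAt_flow_of_equilibrium hYlip hY0 hYd hy
      (by rw [hy0, greatCircle_zero]) hw
      (by
        simp only [hinit, hy0]
        exact hasDerivAt_greatCircle j z) ht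
    have h4 := key.const_smul (Complex.exp ((t * a⁻¹ : ℝ) * Complex.I))
    refine h4.congr_of_eventuallyEq (Filter.Eventually.of_forall fun s => ?_)
    change (reebFlow f ε t (greatCircle j z s)).1 = Complex.exp ((t * a⁻¹ : ℝ) * Complex.I) •
      (Complex.exp (((t * (-a⁻¹) : ℝ) : ℂ) * Complex.I) • (C s t).1)
    rw [← hC0 s, (hC s).reebFlow_eq hf hpos, smul_smul, ← Complex.exp_add]
    simp
  have hflow : reebFlow f ε t z = phase (t * a⁻¹) z := by
    have h1 := isReebTrajectory_phase hf hpos h.homGrad_eq_zero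
    have h2 := h1.reebFlow_eq hf hpos t
    simp only [zero_mul, phase_zero, hfz] at h2
    exact h2
  have hentry : ∀ i j, linearizedFlow f ε t z i j
      = (inner ℂ (frame i z) (frame 0 z)
        * (Complex.exp ((t * (2 / a) : ℝ) * Complex.I) * ζ j t)).re := by
    intro i j
    change (inner ℂ (frame i (reebFlow f ε t z)) (deriv _ 0)).re = _
    rw [(hderiv j).deriv, hflow, frame_phase, inner_smul_left, inner_smul_right, inner_smul_right,
      ← Complex.exp_conj]
    congr 1
    -- One factor `e^{it/a}` comes from undoing the rotating frame of the flow, the other from the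
    -- counter-rotating `V₁` in the first slot of the inner product.
    have : Complex.exp ((t * (2 / a) : ℝ) * Complex.I)
        = Complex.exp ((starRingEnd ℂ) (-((t * a⁻¹ : ℝ) * Complex.I)))
          * Complex.exp ((t * a⁻¹ : ℝ) * Complex.I) := by
      rw [← Complex.exp_add, map_neg, map_mul, Complex.conj_ofReal, Complex.conj_I]
      congr 1
      push_cast
      ring
    rw [this]
    ring
  have h00 : ∀ j, linearizedFlow f ε t z 0 j
      = (Complex.exp ((t * (2 / a) : ℝ) * Complex.I) * ζ j t).re := by
    intro j
    rw [hentry, hVV, one_mul]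
  have h11 : ∀ j, linearizedFlow f ε t z 1 j
      = (Complex.exp ((t * (2 / a) : ℝ) * Complex.I) * ζ j t).im := by
    intro j
    rw [hentry, frame_one, inner_smul_left, hVV, Complex.conj_I]
    simp
  generalize Complex.exp ((t * (2 / a) : ℝ) * Complex.I) = u at *
  apply Complex.ext
  · change (linearizedFlow f ε t z).mulVec v 0 = _
    rw [Matrix.mulVec, dotProduct, Fin.sum_univ_two, h00, h00]
    simp
    ring
  · change (linearizedFlow f ε t z).mulVec v 1 = _
    rw [Matrix.mulVec, dotProduct, Fin.sum_univ_two, h11, h11]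
    simp
    ring

/-- The coordinates of the normal frame in the contact plane. -/
theorem NormalFrame.exists_coords {f : S2 → ℝ} {z : S3} {c q₁ q₂ : ℝ} {ρ₁ ρ₂ : R3}
    (h : NormalFrame f (hopf z) c q₁ q₂ ρ₁ ρ₂) : ∃ η₁ η₂ : ℂ,
      pauli ρ₁ z.1 = η₁ • frame 0 z ∧ pauli ρ₂ z.1 = η₂ • frame 0 z ∧ star η₁ * η₁ = 1 ∧
      (η₂ = Complex.I * η₁ ∨ η₂ = -Complex.I * η₁) := by
  have hV := inner_frame_zero_self z
  have mem : ∀ ρ, inner ℝ ρ (hopf z).1 = (0 : ℝ) → pauli ρ z.1 =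
      inner ℂ (frame 0 z) (pauli ρ z.1) • frame 0 z := by
    intro ρ hρ
    apply eq_smul_frame
    rw [inner_pauli, ← hopf_val, hρ, Complex.ofReal_zero]
  have e₁ := mem ρ₁ h.inner_left
  have e₂ := mem ρ₂ h.inner_right
  have key : ∀ ρ ρ' : R3, ∀ η η' : ℂ, pauli ρ z.1 = η • frame 0 z → pauli ρ' z.1 = η' • frame 0 z →
      (star η * η').re = inner ℝ ρ ρ' := by
    intro ρ ρ' η η' hη hη'
    have := re_inner_pauli_pauli ρ ρ' z.1
    rw [hη, hη', inner_smul_left, inner_smul_right, hV, z.norm_eq_one, mul_one, one_pow,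
      mul_one] at this
    exact this
  set η₁ := inner ℂ (frame 0 z) (pauli ρ₁ z.1)
  set η₂ := inner ℂ (frame 0 z) (pauli ρ₂ z.1)
  refine ⟨η₁, η₂, e₁, e₂, ?_, ?_⟩
  · have := key _ _ _ _ e₁ e₁
    rw [real_inner_self_eq_norm_sq, h.norm_left] at this
    apply Complex.ext
    · simpa using this
    · simp; ring
  · have h11 := key _ _ _ _ e₁ e₁
    have h22 := key _ _ _ _ e₂ e₂
    have h12 := key _ _ _ _ e₁ e₂
    rw [real_inner_self_eq_norm_sq, h.norm_left] at h11
    rw [real_inner_self_eq_norm_sq, h.norm_right] at h22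
    rw [h.inner_eq] at h12
    generalize η₁ = x at *
    generalize η₂ = y at *
    obtain ⟨p, q⟩ := x
    obtain ⟨r, s⟩ := y
    simp at h11 h22 h12
    -- The determinant of a real orthonormal pair is `±1`. The orientation of the chart is not
    -- tracked, and neither sign affects the flow below.
    have h3 : (p * s - q * r - 1) * (p * s - q * r + 1) = 0 := by
      have : (p * s - q * r) ^ 2 + (p * r + q * s) ^ 2 = (p * p + q * q) * (r * r + s * s) := by
        ring
      rw [h11, h22, h12] at this
      linear_combination this
    rcases mul_eq_zero.mp h3 with h4 | h4
    · left
      apply Complex.ext <;> simp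
      · linear_combination -r * h11 - q * h4 + p * h12
      · linear_combination -s * h11 + p * h4 + q * h12
    · right
      apply Complex.ext <;> simp
      · linear_combination -r * h11 - q * h4 + p * h12
      · linear_combination -s * h11 + p * h4 + q * h12

/-- Along an elliptic critical fibre the linearized flow is a rotation at constant speed. -/
theorem NormalFrame.linearizedFlow_elliptic {f : S2 → ℝ} (hf : ContMDiff (𝓡 2) 𝓘(ℝ, ℝ) ∞ f)
    {ε : ℝ} (hpos : ∀ p : S2, 0 < 1 + ε * f p) {z : S3} {c q : ℝ} {ρ₁ ρ₂ : R3}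
    (h : NormalFrame f (hopf z) c q q ρ₁ ρ₂) {t : ℝ} (ht : 0 ≤ t) (v : Fin 2 → ℝ) :
    toComplex ((linearizedFlow f ε t z).mulVec v) =
      Complex.exp ((t * (2 / (1 + ε * c) - ε * q / (2 * (1 + ε * c) ^ 2)) : ℝ) * Complex.I)
        * toComplex v := by
  obtain ⟨η₁, η₂, e₁, e₂, h1, h2⟩ := h.exists_coords
  set b : ℝ := -(ε * q / (2 * (1 + ε * c) ^ 2)) with hb
  -- Expansion of `ζ` in the real orthonormal basis `η₁, η₂`; it makes the isotropic Hessian act as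
  -- a scalar.
  have hsum : ∀ ζ : ℂ, ((star η₁ * ζ).re : ℂ) * η₁ + ((star η₂ * ζ).re : ℂ) * η₂ = ζ := by
    intro ζ
    obtain ⟨p, r⟩ := η₁
    obtain ⟨x, y⟩ := ζ
    have h1' : p * p + r * r = 1 := by simpa using congrArg Complex.re h1
    rcases h2 with h2 | h2 <;> rw [h2] <;> apply Complex.ext <;> simp
    · linear_combination x * h1'
    · linear_combination y * h1'
    · linear_combination x * h1'
    · linear_combination y * h1'
  have hder : ∀ (u : ℂ) (t : ℝ), HasDerivAt (fun t : ℝ => Complex.exp ((t * b : ℝ) * Complex.I) * u)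
      (b * Complex.I * (Complex.exp ((t * b : ℝ) * Complex.I) * u)) t := by
    intro u t
    have h3 : HasDerivAt (fun t : ℝ => ((t * b : ℝ) : ℂ) * Complex.I) ((b : ℂ) * Complex.I) t := by
      have := ((hasDerivAt_id t).mul_const b).ofReal_comp.mul_const Complex.I
      simpa using this
    refine (h3.cexp.mul_const u).congr_deriv ?_
    ring
  have := h.linearizedFlow_apply hf hpos e₁ e₂
    (ζ := fun j t => Complex.exp ((t * b : ℝ) * Complex.I) * ![1, Complex.I] j)
    (fun j t => by
      refine (hder _ t).congr_deriv ?_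
      generalize Complex.exp ((t * b : ℝ) * Complex.I) * ![1, Complex.I] j = w
      have h3 := hsum w
      rw [hb]
      push_cast
      generalize (1 + (ε : ℂ) * c) = A
      linear_combination (ε / A ^ 2 * Complex.I * q / 2 : ℂ) * h3)
    (by simp) (by simp) ht v
  rw [this]
  have h4 : toComplex v = v 0 + v 1 * Complex.I := by
    apply Complex.ext <;> simp [toComplex]
  have h5 : Complex.exp ((t * (2 / (1 + ε * c) - ε * q / (2 * (1 + ε * c) ^ 2)) : ℝ) * Complex.I)
      = Complex.exp ((t * (2 / (1 + ε * c)) : ℝ) * Complex.I)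
        * Complex.exp ((t * b : ℝ) * Complex.I) := by
    rw [← Complex.exp_add]
    congr 1
    rw [hb]
    push_cast
    ring
  rw [h4, h5]
  simp
  ring

/-- Along a saddle fibre the linearized flow is a rotation composed with a hyperbolic flow. -/
theorem NormalFrame.linearizedFlow_hyperbolic {f : S2 → ℝ}
    (hf : ContMDiff (𝓡 2) 𝓘(ℝ, ℝ) ∞ f) {ε : ℝ} (hpos : ∀ p : S2, 0 < 1 + ε * f p) {z : S3}
    {c : ℝ} {ρ₁ ρ₂ : R3} (h : NormalFrame f (hopf z) c 1 (-1) ρ₁ ρ₂) :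
    ∃ τ : ℂ, ‖τ‖ = 1 ∧ ∀ t : ℝ, 0 ≤ t → ∀ v : Fin 2 → ℝ,
      toComplex ((linearizedFlow f ε t z).mulVec v) =
        Complex.exp ((t * (2 / (1 + ε * c)) : ℝ) * Complex.I)
          * (Real.cosh (ε / (2 * (1 + ε * c) ^ 2) * t) * toComplex v
            + Real.sinh (ε / (2 * (1 + ε * c) ^ 2) * t) * (τ * star (toComplex v))) := by
  obtain ⟨η₁, η₂, e₁, e₂, h1, h2⟩ := h.exists_coords
  set b : ℝ := ε / (2 * (1 + ε * c) ^ 2) with hb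
  -- For opposite signs the Hessian acts as the reflection `ζ ↦ η₁² ζ̄`. The equation becomes `ζ' =
  -- b τ ζ̄` with `τ = -i η₁²`, and `|τ| = 1` makes the right-hand side an involution up to `b`,
  -- hence the `cosh` and `sinh`.
  have hsum : ∀ ζ : ℂ, ((star η₁ * ζ).re : ℂ) * η₁ - ((star η₂ * ζ).re : ℂ) * η₂
      = η₁ ^ 2 * star ζ := by
    intro ζ
    obtain ⟨p, r⟩ := η₁
    obtain ⟨x, y⟩ := ζ
    rcases h2 with h2 | h2 <;> rw [h2] <;> apply Complex.ext <;> simp [pow_two] <;> ring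
  set τ : ℂ := -Complex.I * η₁ ^ 2 with hτ
  have hηn : ‖η₁‖ = 1 := by
    have : Complex.normSq η₁ = 1 := by
      have := congrArg Complex.re h1
      simpa [Complex.normSq_apply] using this
    rw [Complex.normSq_eq_norm_sq] at this
    exact (pow_eq_one_iff_of_nonneg (norm_nonneg _) two_ne_zero).mp this
  have hτn : ‖τ‖ = 1 := by rw [hτ]; simp [hηn]
  have hτs : τ * star τ = 1 := by
    rw [Complex.star_def, Complex.mul_conj, Complex.normSq_eq_norm_sq, hτn]; simp
  refine ⟨τ, hτn, fun t ht v => ?_⟩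
  have hder : ∀ (u : ℂ) (t : ℝ), HasDerivAt (fun t : ℝ => (Real.cosh (b * t) : ℂ) * u
      + (Real.sinh (b * t) : ℂ) * (τ * star u))
      (b * τ * star ((Real.cosh (b * t) : ℂ) * u + (Real.sinh (b * t) : ℂ) * (τ * star u))) t := by
    intro u t
    have h3 : HasDerivAt (fun t : ℝ => b * t) b t := by simpa using (hasDerivAt_id t).const_mul b
    have h4 := (((Real.hasDerivAt_cosh (b * t)).comp t h3).ofReal_comp.mul_const u).add
      (((Real.hasDerivAt_sinh (b * t)).comp t h3).ofReal_comp.mul_const (τ * star u))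
    refine h4.congr_deriv ?_
    simp only [Complex.star_def, map_add, map_mul, Complex.conj_ofReal, Complex.conj_conj] at hτs ⊢
    push_cast
    linear_combination -(b * Complex.sinh (b * t) * u) * hτs
  have := h.linearizedFlow_apply hf hpos e₁ e₂
    (ζ := fun j t => (Real.cosh (b * t) : ℂ) * ![1, Complex.I] j
      + (Real.sinh (b * t) : ℂ) * (τ * star (![1, Complex.I] j)))
    (fun j t => by
      refine (hder _ t).congr_deriv ?_
      generalize (Real.cosh (b * t) : ℂ) * ![1, Complex.I] j
        + (Real.sinh (b * t) : ℂ) * (τ * star (![1, Complex.I] j)) = w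
      have h3 := hsum w
      rw [hb, hτ]
      push_cast
      generalize (1 + (ε : ℂ) * c) = A
      linear_combination (ε / A ^ 2 * Complex.I / 2 : ℂ) * h3)
    (by simp) (by simp) ht v
  rw [this]
  have h4 : toComplex v = v 0 + v 1 * Complex.I := by
    apply Complex.ext <;> simp [toComplex]
  rw [h4]
  simp
  ring

/-! ### Rotation numbers and Conley–Zehnder indices of model paths -/

theorem toComplex_ne_zero {v : Fin 2 → ℝ} (hv : v ≠ 0) : toComplex v ≠ 0 := by
  intro h
  apply hv
  have h0 := congrArg Complex.re h
  have h1 := congrArg Complex.im h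
  ext i
  fin_cases i
  · exact h0
  · exact h1

theorem toComplex_injective : Function.Injective toComplex := by
  intro v w h
  have h0 := congrArg Complex.re h
  have h1 := congrArg Complex.im h
  ext i
  fin_cases i
  · exact h0
  · exact h1

/-- An interval maps to a connected set, and a connected set containing two integers contains a
half-integer between them. -/
theorem eq_of_continuousOn_of_forall_int {φ : ℝ → ℝ} {T : ℝ} (hT : 0 ≤ T)
    (hφ : ContinuousOn φ (Set.Icc 0 T)) (hint : ∀ t ∈ Set.Icc 0 T, ∃ m : ℤ, φ t = m) :
    φ T = φ 0 := by
  have h := isPreconnected_Icc.image φ hφ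
  by_contra hne
  obtain ⟨m, hm⟩ := hint 0 ⟨le_rfl, hT⟩
  obtain ⟨k, hk⟩ := hint T ⟨hT, le_rfl⟩
  have h0 : (m : ℝ) ∈ φ '' Set.Icc 0 T := ⟨0, ⟨le_rfl, hT⟩, hm⟩
  have h1 : (k : ℝ) ∈ φ '' Set.Icc 0 T := ⟨T, ⟨hT, le_rfl⟩, hk⟩
  have hmk : m ≠ k := fun e => hne (by rw [hm, hk, e])
  rcases lt_or_gt_of_ne hmk with hlt | hlt
  · have hlt' : (m : ℝ) + 1 ≤ k := by exact_mod_cast hlt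
    obtain ⟨t, ht, e⟩ := h.ordConnected.out h0 h1
      (show (m : ℝ) + 1 / 2 ∈ Set.Icc (m : ℝ) k by constructor <;> linarith)
    obtain ⟨l, hl⟩ := hint t ht
    rw [hl] at e
    have e2 : (2 * l : ℝ) = 2 * m + 1 := by linarith
    have e3 : 2 * l = 2 * m + 1 := by exact_mod_cast e2
    omega
  · have hlt' : (k : ℝ) + 1 ≤ m := by exact_mod_cast hlt
    obtain ⟨t, ht, e⟩ := h.ordConnected.out h1 h0
      (show (k : ℝ) + 1 / 2 ∈ Set.Icc (k : ℝ) m by constructor <;> linarith)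
    obtain ⟨l, hl⟩ := hint t ht
    rw [hl] at e
    have e2 : (2 * l : ℝ) = 2 * k + 1 := by linarith
    have e3 : 2 * l = 2 * k + 1 := by exact_mod_cast e2
    omega

/-- Two continuous angle functions of the same moving vector differ by a continuous integer multiple
of `2π`. Consequently the index can be characterized by equivalences, which the counts by degree
require. -/
theorem HasRotation.unique {M : ℝ → Matrix (Fin 2) (Fin 2) ℝ} {T : ℝ} (hT : 0 ≤ T)
    {v : Fin 2 → ℝ} {δ δ' : ℝ} (h : HasRotation M T v δ) (h' : HasRotation M T v δ') :
    δ = δ' := by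
  obtain ⟨θ, hθ, hr, hδ⟩ := h
  obtain ⟨θ', hθ', hr', hδ'⟩ := h'
  have hpi := Real.pi_pos
  have key := eq_of_continuousOn_of_forall_int (φ := fun t => (θ t - θ' t) / (2 * Real.pi)) hT
    ((hθ.sub hθ').div_const _) (by
      intro t ht
      obtain ⟨r, hr0, hrv⟩ := hr t ht
      obtain ⟨r', hr0', hrv'⟩ := hr' t ht
      have h0 : r * Real.cos (θ t) = r' * Real.cos (θ' t) := by
        have := congrFun (hrv.symm.trans hrv') 0; simpa using this
      have h1 : r * Real.sin (θ t) = r' * Real.sin (θ' t) := by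
        have := congrFun (hrv.symm.trans hrv') 1; simpa using this
      have hrr : r = r' := by
        have e : r ^ 2 = r' ^ 2 := by
          have a1 := Real.sin_sq_add_cos_sq (θ t)
          have a2 := Real.sin_sq_add_cos_sq (θ' t)
          calc r ^ 2 = (r * Real.cos (θ t)) ^ 2 + (r * Real.sin (θ t)) ^ 2 := by
                linear_combination -r ^ 2 * a1
            _ = r' ^ 2 := by rw [h0, h1]; linear_combination r' ^ 2 * a2
        exact (sq_eq_sq₀ hr0.le hr0'.le).mp e
      subst hrr
      have c0 := mul_left_cancel₀ hr0.ne' h0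
      have c1 := mul_left_cancel₀ hr0.ne' h1
      have hcos : Real.cos (θ t - θ' t) = 1 := by
        rw [Real.cos_sub, c0, c1, ← pow_two, ← pow_two, add_comm, Real.sin_sq_add_cos_sq]
      obtain ⟨m, hm⟩ := (Real.cos_eq_one_iff _).mp hcos
      exact ⟨m, by rw [← hm]; field_simp⟩)
  have : θ T - θ' T = θ 0 - θ' 0 := by
    field_simp at key
    exact key
  have h2 : 2 * Real.pi * δ = 2 * Real.pi * δ' := by linarith
  exact mul_left_cancel₀ (by positivity) h2

/-- The rotation of a vector along a path of the form `e^{iwt} Z_t`, where `Z_t` moves every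
vector by less than a right angle. -/
theorem hasRotation_of_polar {M : ℝ → Matrix (Fin 2) (Fin 2) ℝ} {T w : ℝ} {v : Fin 2 → ℝ}
    {Z : ℝ → ℂ} (hM : ∀ t ∈ Set.Icc 0 T, toComplex ((M t).mulVec v)
      = Complex.exp ((t * w : ℝ) * Complex.I) * Z t) (hv : v ≠ 0)
    (hZ : ContinuousOn Z (Set.Icc 0 T)) (hZ0 : Z 0 = toComplex v)
    (hpos : ∀ t ∈ Set.Icc 0 T, 0 < (Z t / toComplex v).re) :
    HasRotation M T v ((T * w + (Z T / toComplex v).arg) / (2 * Real.pi)) := by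
  have hv' := toComplex_ne_zero hv
  -- Positive real part keeps `Z t / v` off the branch cut, so the principal argument provides a
  -- continuous lift of the angle.
  refine ⟨fun t => (toComplex v).arg + t * w + (Z t / toComplex v).arg, ?_, ?_, ?_⟩
  · refine ContinuousOn.add (by fun_prop) ?_
    intro t ht
    exact ContinuousAt.comp_continuousWithinAt (g := Complex.arg) (f := fun t => Z t / toComplex v)
      (Complex.continuousAt_arg (Or.inl (hpos t ht))) ((hZ t ht).div_const _)
  · intro t ht
    have hz : Z t / toComplex v ≠ 0 := fun h => by simpa [h] using hpos t ht
    refine ⟨‖Z t / toComplex v‖ * ‖toComplex v‖, by positivity, ?_⟩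
    apply toComplex_injective
    rw [hM t ht]
    have e1 : Z t = (Z t / toComplex v) * toComplex v := by field_simp
    have e4 : Z t = (‖Z t / toComplex v‖ * Complex.exp ((Z t / toComplex v).arg * Complex.I))
        * (‖toComplex v‖ * Complex.exp ((toComplex v).arg * Complex.I)) := by
      rw [Complex.norm_mul_exp_arg_mul_I, Complex.norm_mul_exp_arg_mul_I]
      exact e1
    have e2 : ∀ r θ : ℝ, toComplex ![r * Real.cos θ, r * Real.sin θ]
        = r * Complex.exp (θ * Complex.I) := by
      intro r θ
      rw [Complex.exp_mul_I]
      apply Complex.ext <;> simp [toComplex, Complex.cos_ofReal_re, Complex.sin_ofReal_re]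
    rw [e2]
    have e3 : Complex.exp (((toComplex v).arg + t * w + (Z t / toComplex v).arg : ℝ) * Complex.I)
        = Complex.exp ((t * w : ℝ) * Complex.I) * Complex.exp ((Z t / toComplex v).arg * Complex.I)
          * Complex.exp ((toComplex v).arg * Complex.I) := by
      rw [← Complex.exp_add, ← Complex.exp_add]
      congr 1
      push_cast
      ring
    rw [e3]
    generalize Z t / toComplex v = y at e4
    rw [e4]
    push_cast
    ring
  · have hpi := Real.pi_pos
    simp only [hZ0, div_self hv', Complex.arg_one]
    field_simp
    ring

/-- All vectors turn by the same amount `x`, strictly between two consecutive integers, which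
excludes the even alternative. -/
theorem hasConleyZehnderIndex_elliptic_iff {M : ℝ → Matrix (Fin 2) (Fin 2) ℝ} {T w x : ℝ}
    (hT : 0 ≤ T) (hM : ∀ t ∈ Set.Icc 0 T, ∀ v, toComplex ((M t).mulVec v)
      = Complex.exp ((t * w : ℝ) * Complex.I) * toComplex v) (hx : T * w = 2 * Real.pi * x)
    {m : ℤ} (h1 : m < x) (h2 : x < m + 1) (μ : ℤ) :
    HasConleyZehnderIndex M T μ ↔ μ = 2 * m + 1 := by
  have hpi := Real.pi_pos
  have hrot : ∀ v, v ≠ 0 → HasRotation M T v x := by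
    intro v hv
    have := hasRotation_of_polar (Z := fun _ => toComplex v) (fun t ht => hM t ht v) hv
      continuousOn_const rfl (fun t _ => by simp [div_self (toComplex_ne_zero hv)])
    rw [div_self (toComplex_ne_zero hv), Complex.arg_one, add_zero, hx] at this
    rwa [mul_div_cancel_left₀ _ (by positivity)] at this
  constructor
  · rintro (⟨k, -, v, hv, hk⟩ | ⟨k, rfl, hk⟩)
    · have := hk.unique hT (hrot v hv)
      rw [← this] at h1 h2
      have h1' : m < k := by exact_mod_cast h1
      have h2' : k < m + 1 := by exact_mod_cast h2
      omega
    · obtain ⟨δ, hδ1, hδ2, hδ⟩ := hk ![1, 0] (fun h => by simpa using congrFun h 0)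
      rw [hδ.unique hT (hrot _ (fun h => by simpa using congrFun h 0))] at hδ1 hδ2
      have h1' : m < k + 1 := by exact_mod_cast h1.trans hδ2
      have h2' : k < m + 1 := by exact_mod_cast hδ1.trans h2
      omega
  · rintro rfl
    exact Or.inr ⟨m, rfl, fun v hv => ⟨x, h1, h2, hrot v hv⟩⟩

theorem exists_fixed_of_norm_one {τ : ℂ} (hτ : ‖τ‖ = 1) : ∃ ζ : ℂ, ζ ≠ 0 ∧ τ * star ζ = ζ := by
  refine ⟨Complex.exp ((τ.arg / 2 : ℝ) * Complex.I), Complex.exp_ne_zero _, ?_⟩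
  have h1 := Complex.norm_mul_exp_arg_mul_I τ
  rw [hτ, Complex.ofReal_one, one_mul] at h1
  nth_rewrite 1 [← h1]
  rw [Complex.star_def, ← Complex.exp_conj, ← Complex.exp_add, map_mul, Complex.conj_ofReal,
    Complex.conj_I]
  congr 1
  push_cast
  ring

theorem abs_sinh_lt_cosh (s : ℝ) : |Real.sinh s| < Real.cosh s := by
  rw [abs_lt]
  constructor
  · have := Real.sinh_lt_cosh (-s)
    rw [Real.sinh_neg, Real.cosh_neg] at this
    linarith
  · exact Real.sinh_lt_cosh s

/-- The reflected vector has the same length as `ζ` and `|sinh| < cosh`, so the hyperbolic flow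
turns no vector by as much as a right angle. -/
theorem re_hyperbolic_div_pos {τ : ℂ} (hτ : ‖τ‖ = 1) (s : ℝ) {ζ : ℂ} (hζ : ζ ≠ 0) :
    0 < ((Real.cosh s * ζ + Real.sinh s * (τ * star ζ)) / ζ).re := by
  have h1 : (Real.cosh s * ζ + Real.sinh s * (τ * star ζ)) / ζ
      = Real.cosh s + Real.sinh s * (τ * star ζ / ζ) := by
    field_simp
  have h2 : ‖τ * star ζ / ζ‖ = 1 := by
    rw [norm_div, norm_mul, hτ, norm_star, one_mul, div_self (norm_ne_zero_iff.mpr hζ)]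
  rw [h1, Complex.add_re, Complex.ofReal_re, Complex.re_ofReal_mul]
  have h3 : |(τ * star ζ / ζ).re| ≤ 1 := (Complex.abs_re_le_norm _).trans h2.le
  have h4 : |Real.sinh s * (τ * star ζ / ζ).re| ≤ |Real.sinh s| := by
    rw [abs_mul]
    exact mul_le_of_le_one_right (abs_nonneg _) h3
  have h5 := abs_sinh_lt_cosh s
  have h6 := neg_abs_le (Real.sinh s * (τ * star ζ / ζ).re)
  linarith

/-- Every vector turns by `k/2` up to less than a quarter turn, and the direction fixed by `ζ ↦ τ
ζ̄` turns by exactly `k/2`. For even `k` that vector realizes the integer; for odd `k` all the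
rotations lie strictly between the neighbouring integers. -/
theorem hasConleyZehnderIndex_hyperbolic_iff {M : ℝ → Matrix (Fin 2) (Fin 2) ℝ} {T w b : ℝ}
    {τ : ℂ} (hτ : ‖τ‖ = 1) (hT : 0 ≤ T) (hM : ∀ t ∈ Set.Icc 0 T, ∀ v, toComplex ((M t).mulVec v)
      = Complex.exp ((t * w : ℝ) * Complex.I) * (Real.cosh (b * t) * toComplex v
        + Real.sinh (b * t) * (τ * star (toComplex v)))) {k : ℤ} (hk : T * w = k * Real.pi)
    (μ : ℤ) : HasConleyZehnderIndex M T μ ↔ μ = k := by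
  have hpi := Real.pi_pos
  have hrot : ∀ v, v ≠ 0 → ∃ d, |d| < 1 / 4 ∧ HasRotation M T v (k / 2 + d) ∧
      (τ * star (toComplex v) = toComplex v → d = 0) := by
    intro v hv
    have hv' := toComplex_ne_zero hv
    set Z : ℝ → ℂ := fun t => Real.cosh (b * t) * toComplex v
        + Real.sinh (b * t) * (τ * star (toComplex v)) with hZ
    have hpos : ∀ t, 0 < (Z t / toComplex v).re := fun t => re_hyperbolic_div_pos hτ (b * t) hv'
    have := hasRotation_of_polar (Z := Z) (fun t ht => hM t ht v) hv (by fun_prop)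
      (by simp [hZ]) (fun t _ => hpos t)
    refine ⟨(Z T / toComplex v).arg / (2 * Real.pi), ?_, ?_, fun h => ?_⟩
    · have h1 := Complex.abs_arg_lt_pi_div_two_iff.mpr (Or.inl (hpos T))
      rw [abs_div, abs_of_pos (show 0 < 2 * Real.pi by positivity), div_lt_iff₀ (by positivity)]
      linarith
    · convert this using 1
      rw [hk]
      field_simp
    · have h1 : Z T / toComplex v = ((Real.cosh (b * T) + Real.sinh (b * T) : ℝ) : ℂ) := by
        simp only [hZ, h]
        field_simp
        push_cast
        ring
      have h2 : 0 ≤ Real.cosh (b * T) + Real.sinh (b * T) := by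
        rw [Real.cosh_add_sinh]; exact (Real.exp_pos _).le
      rw [h1, Complex.arg_ofReal_of_nonneg h2, zero_div]
  obtain ⟨ζ₀, hζ₀, hfix⟩ := exists_fixed_of_norm_one hτ
  set v₀ : Fin 2 → ℝ := ![ζ₀.re, ζ₀.im] with hv₀
  have hv₀ζ : toComplex v₀ = ζ₀ := rfl
  have hv₀0 : v₀ ≠ 0 := by
    intro h
    apply hζ₀
    rw [← hv₀ζ, h]
    rfl
  have hrot₀ : HasRotation M T v₀ (k / 2) := by
    obtain ⟨d, -, h1, h2⟩ := hrot v₀ hv₀0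
    rw [h2 (by rw [hv₀ζ]; exact hfix), add_zero] at h1
    exact h1
  constructor
  · rintro (⟨l, rfl, v, hv, hl⟩ | ⟨l, rfl, hl⟩)
    · obtain ⟨d, hd, h1, -⟩ := hrot v hv
      have h2 := hl.unique hT h1
      rw [abs_lt] at hd
      have h3 : (2 * l : ℝ) < k + 1 := by linarith
      have h4 : (k : ℝ) < 2 * l + 1 := by linarith
      have h3' : 2 * l < k + 1 := by exact_mod_cast h3
      have h4' : k < 2 * l + 1 := by exact_mod_cast h4
      omega
    · obtain ⟨δ, hδ1, hδ2, hδ⟩ := hl v₀ hv₀0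
      rw [hδ.unique hT hrot₀] at hδ1 hδ2
      have h3 : (2 * l : ℝ) < k := by linarith
      have h4 : (k : ℝ) < 2 * l + 2 := by linarith
      have h3' : 2 * l < k := by exact_mod_cast h3
      have h4' : k < 2 * l + 2 := by exact_mod_cast h4
      omega
  · rintro rfl
    rcases Int.even_or_odd' μ with ⟨m, rfl | rfl⟩
    · left
      refine ⟨m, rfl, v₀, hv₀0, ?_⟩
      have : ((2 * m : ℤ) : ℝ) / 2 = m := by push_cast; ring
      rwa [this] at hrot₀
    · right
      refine ⟨m, rfl, fun v hv => ?_⟩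
      obtain ⟨d, hd, h1, -⟩ := hrot v hv
      rw [abs_lt] at hd
      refine ⟨_, ?_, ?_, h1⟩ <;> push_cast <;> linarith

/-! ### Spectra of return maps -/

theorem mem_spectrum_iff_det {K : Type} [Field K] (A : Matrix (Fin 2) (Fin 2) K) (x : K) :
    x ∈ spectrum K A ↔ (x - A 0 0) * (x - A 1 1) - A 0 1 * A 1 0 = 0 := by
  rw [spectrum.mem_iff, Matrix.isUnit_iff_isUnit_det, isUnit_iff_ne_zero, not_not,
    Matrix.det_fin_two]
  simp [Matrix.algebraMap_matrix_apply]

theorem entries_of_toComplex {R : Matrix (Fin 2) (Fin 2) ℝ} {L : ℂ → ℂ}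
    (h : ∀ v, toComplex (R.mulVec v) = L (toComplex v)) :
    R 0 0 = (L 1).re ∧ R 1 0 = (L 1).im ∧ R 0 1 = (L Complex.I).re ∧
      R 1 1 = (L Complex.I).im := by
  have h0 := h ![1, 0]
  have h1 := h ![0, 1]
  have e0 : toComplex ![1, 0] = 1 := by apply Complex.ext <;> simp [toComplex]
  have e1 : toComplex ![0, 1] = Complex.I := by apply Complex.ext <;> simp [toComplex]
  rw [e0] at h0
  rw [e1] at h1
  rw [← h0, ← h1]
  simp [toComplex, Matrix.mulVec, dotProduct, Fin.sum_univ_two]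

theorem rotation_entries {R : Matrix (Fin 2) (Fin 2) ℝ} {α : ℝ}
    (h : ∀ v, toComplex (R.mulVec v) = Complex.exp (α * Complex.I) * toComplex v) :
    R 0 0 = Real.cos α ∧ R 1 0 = Real.sin α ∧ R 0 1 = -Real.sin α ∧ R 1 1 = Real.cos α := by
  obtain ⟨h1, h2, h3, h4⟩ := entries_of_toComplex (L := fun ζ => Complex.exp (α * Complex.I) * ζ) h
  rw [h1, h2, h3, h4, Complex.exp_mul_I]
  simp [Complex.cos_ofReal_re, Complex.sin_ofReal_re]

/-- The characteristic polynomial at `1` is `(1 - cos α)² + sin² α`. -/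
theorem one_notMem_spectrum_rotation {R : Matrix (Fin 2) (Fin 2) ℝ} {α : ℝ}
    (h : ∀ v, toComplex (R.mulVec v) = Complex.exp (α * Complex.I) * toComplex v)
    (hα : Real.sin α ≠ 0 ∨ Real.cos α ≠ 1) : (1 : ℝ) ∉ spectrum ℝ R := by
  obtain ⟨h1, h2, h3, h4⟩ := rotation_entries h
  rw [mem_spectrum_iff_det, h1, h2, h3, h4]
  intro h5
  have h6 : (1 - Real.cos α) ^ 2 + Real.sin α ^ 2 = 0 := by linear_combination h5
  have h7 : Real.sin α = 0 := by nlinarith [sq_nonneg (1 - Real.cos α), sq_nonneg (Real.sin α)]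
  have h8 : Real.cos α = 1 := by nlinarith [sq_nonneg (1 - Real.cos α), sq_nonneg (Real.sin α)]
  rcases hα with h | h
  · exact h h7
  · exact h h8

theorem exists_nonreal_spectrum_rotation {R : Matrix (Fin 2) (Fin 2) ℝ} {α : ℝ}
    (h : ∀ v, toComplex (R.mulVec v) = Complex.exp (α * Complex.I) * toComplex v)
    (hα : Real.sin α ≠ 0) :
    ¬ ∀ x ∈ spectrum ℂ (R.map ((↑) : ℝ → ℂ)), ∃ r : ℝ, r < 0 ∧ x = r := by
  intro hx
  obtain ⟨h1, h2, h3, h4⟩ := rotation_entries h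
  obtain ⟨r, -, hr⟩ := hx (Complex.exp (α * Complex.I)) (by
    rw [mem_spectrum_iff_det]
    simp only [Matrix.map_apply, h1, h2, h3, h4, Complex.exp_mul_I]
    push_cast
    linear_combination (Complex.sin α) ^ 2 * Complex.I_sq)
  have := congrArg Complex.im hr
  rw [Complex.exp_ofReal_mul_I_im, Complex.ofReal_im] at this
  exact hα this

theorem hyperbolic_entries {R : Matrix (Fin 2) (Fin 2) ℝ} {s σ : ℝ} {τ : ℂ}
    (h : ∀ v, toComplex (R.mulVec v) = σ * (Real.cosh s * toComplex v
      + Real.sinh s * (τ * star (toComplex v)))) :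
    R 0 0 = σ * (Real.cosh s + Real.sinh s * τ.re) ∧ R 1 0 = σ * (Real.sinh s * τ.im) ∧
      R 0 1 = σ * (Real.sinh s * τ.im) ∧ R 1 1 = σ * (Real.cosh s - Real.sinh s * τ.re) := by
  obtain ⟨h1, h2, h3, h4⟩ := entries_of_toComplex
    (L := fun ζ => σ * (Real.cosh s * ζ + Real.sinh s * (τ * star ζ))) h
  rw [h1, h2, h3, h4]
  simp [sub_eq_add_neg,
    -Complex.ofReal_cosh, -Complex.ofReal_sinh]

/-- Only `|τ| = 1` enters: the trace is `2σ cosh s` and the determinant is `1`, so the eigenvalues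
are `σ cosh s ± sinh s`. -/
theorem spectrum_hyperbolic_iff {R : Matrix (Fin 2) (Fin 2) ℝ} {s σ : ℝ} {τ : ℂ}
    (hτ : ‖τ‖ = 1) (hσ : σ ^ 2 = 1)
    (h : ∀ v, toComplex (R.mulVec v) = σ * (Real.cosh s * toComplex v
      + Real.sinh s * (τ * star (toComplex v)))) (x : ℂ) :
    (x - R 0 0) * (x - R 1 1) - R 0 1 * R 1 0
      = (x - σ * Real.cosh s) ^ 2 - (Real.sinh s : ℂ) ^ 2 := by
  obtain ⟨h1, h2, h3, h4⟩ := hyperbolic_entries h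
  have hn : (τ.re : ℂ) ^ 2 + (τ.im : ℂ) ^ 2 = 1 := by
    have : τ.re ^ 2 + τ.im ^ 2 = 1 := by
      have := Complex.normSq_eq_norm_sq τ
      rw [hτ, Complex.normSq_apply] at this
      linarith
    exact_mod_cast this
  have hσ' : (σ : ℂ) ^ 2 = 1 := by exact_mod_cast hσ
  rw [h1, h2, h3, h4]
  push_cast
  linear_combination (-Complex.sinh s ^ 2 * σ ^ 2) * hn - Complex.sinh s ^ 2 * hσ'

theorem one_notMem_spectrum_hyperbolic {R : Matrix (Fin 2) (Fin 2) ℝ} {s σ : ℝ} {τ : ℂ}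
    (hτ : ‖τ‖ = 1) (hσ : σ ^ 2 = 1) (hs : s ≠ 0)
    (h : ∀ v, toComplex (R.mulVec v) = σ * (Real.cosh s * toComplex v
      + Real.sinh s * (τ * star (toComplex v)))) : (1 : ℝ) ∉ spectrum ℝ R := by
  rw [mem_spectrum_iff_det]
  intro h1
  have h2 := spectrum_hyperbolic_iff hτ hσ h 1
  have h3 : (1 - σ * Real.cosh s) ^ 2 - Real.sinh s ^ 2 = 0 := by
    rw [← h1]
    exact_mod_cast h2.symm
  have h4 := Real.cosh_sq s
  have h5 : 1 = σ * Real.cosh s := by nlinarith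
  have h6 := Real.one_lt_cosh.mpr hs
  have h7 : Real.cosh s ^ 2 = 1 := by
    have : (σ * Real.cosh s) ^ 2 = 1 := by rw [← h5]; norm_num
    rw [mul_pow, hσ, one_mul] at this
    exact this
  nlinarith

theorem spectrum_negative_hyperbolic {R : Matrix (Fin 2) (Fin 2) ℝ} {s : ℝ} {τ : ℂ}
    (hτ : ‖τ‖ = 1) (h : ∀ v, toComplex (R.mulVec v) = (-1 : ℝ) * (Real.cosh s * toComplex v
      + Real.sinh s * (τ * star (toComplex v)))) :
    ∀ x ∈ spectrum ℂ (R.map ((↑) : ℝ → ℂ)), ∃ r : ℝ, r < 0 ∧ x = r := by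
  intro x hx
  rw [mem_spectrum_iff_det] at hx
  simp only [Matrix.map_apply] at hx
  rw [spectrum_hyperbolic_iff hτ (by norm_num) h x] at hx
  have h5 := abs_lt.mp (abs_sinh_lt_cosh s)
  have h6 : (x - (-1 : ℝ) * Real.cosh s - Real.sinh s)
      * (x - (-1 : ℝ) * Real.cosh s + Real.sinh s) = 0 := by
    rw [← hx]; ring
  rcases mul_eq_zero.mp h6 with h7 | h7
  · refine ⟨-Real.cosh s + Real.sinh s, by linarith [h5.2], ?_⟩
    push_cast at h7 ⊢
    linear_combination h7
  · refine ⟨-Real.cosh s - Real.sinh s, by linarith [h5.1], ?_⟩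
    push_cast at h7 ⊢
    linear_combination h7

/-! ### The binary dihedral group -/

theorem su2_ext {g h : SU2} (h0 : g.1 0 0 = h.1 0 0) (h1 : g.1 1 0 = h.1 1 0) : g = h := by
  apply Subtype.ext
  ext i j
  fin_cases i <;> fin_cases j
  · exact h0
  · change g.1 0 1 = h.1 0 1
    rw [su2_apply_zero_one, su2_apply_zero_one, h1]
  · exact h1
  · change g.1 1 1 = h.1 1 1
    rw [su2_apply_one_one, su2_apply_one_one, h0]

theorem su2_mul_zero_zero (g h : SU2) :
    (g * h).1 0 0 = g.1 0 0 * h.1 0 0 - star (g.1 1 0) * h.1 1 0 := by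
  change (g.1 * h.1) 0 0 = _
  rw [Matrix.mul_apply, Fin.sum_univ_two, su2_apply_zero_one]
  ring

theorem su2_mul_one_zero (g h : SU2) :
    (g * h).1 1 0 = g.1 1 0 * h.1 0 0 + star (g.1 0 0) * h.1 1 0 := by
  change (g.1 * h.1) 1 0 = _
  rw [Matrix.mul_apply, Fin.sum_univ_two, su2_apply_one_one]

theorem su2_inv_zero_zero (g : SU2) : (g⁻¹).1 0 0 = star (g.1 0 0) := rfl

theorem su2_inv_one_zero (g : SU2) : (g⁻¹).1 1 0 = -g.1 1 0 := by
  change star (g.1 0 1) = _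
  rw [su2_apply_zero_one, star_neg, star_star]

theorem su2_smul_zero (g : SU2) (z : S3) :
    (g • z).1 0 = g.1 0 0 * z.1 0 - star (g.1 1 0) * z.1 1 := by
  change (g.1.mulVec z.1.ofLp) 0 = _
  rw [Matrix.mulVec, dotProduct, Fin.sum_univ_two, su2_apply_zero_one]
  ring

theorem su2_smul_one (g : SU2) (z : S3) :
    (g • z).1 1 = g.1 1 0 * z.1 0 + star (g.1 0 0) * z.1 1 := by
  change (g.1.mulVec z.1.ofLp) 1 = _
  rw [Matrix.mulVec, dotProduct, Fin.sum_univ_two, su2_apply_one_one]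

theorem matA_zero_zero (n : ℕ) :
    (matA n).1 0 0 = Complex.exp ((Real.pi / n : ℝ) * Complex.I) := rfl

theorem matA_one_zero (n : ℕ) : (matA n).1 1 0 = 0 := rfl

theorem matB_zero_zero : matB.1 0 0 = 0 := rfl

theorem matB_one_zero : matB.1 1 0 = 1 := rfl

theorem matA_mem (n : ℕ) : matA n ∈ binaryDihedral n :=
  Subgroup.subset_closure (Set.mem_insert _ _)

theorem matB_mem (n : ℕ) : matB ∈ binaryDihedral n :=
  Subgroup.subset_closure (Set.mem_insert_of_mem _ rfl)

theorem exp_pi_div_pow {n : ℕ} (hn : n ≠ 0) :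
    Complex.exp ((Real.pi / n : ℝ) * Complex.I) ^ (2 * n) = 1 := by
  have hn' : (n : ℂ) ≠ 0 := by exact_mod_cast hn
  rw [← Complex.exp_nat_mul, ← Complex.exp_two_pi_mul_I]
  congr 1
  push_cast
  field_simp

/-- Elements of the binary dihedral group are diagonal or antidiagonal, with entries `2n`-th roots
of unity. -/
theorem binaryDihedral_cases {n : ℕ} (hn : n ≠ 0) {g : SU2} (hg : g ∈ binaryDihedral n) :
    (g.1 1 0 = 0 ∧ g.1 0 0 ^ (2 * n) = 1) ∨ (g.1 0 0 = 0 ∧ g.1 1 0 ^ (2 * n) = 1) := by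
  -- The exponent `2n` is even, so the signs arising from products and inverses of antidiagonal
  -- elements are harmless.
  have hneg : ∀ u : ℂ, (-u) ^ (2 * n) = u ^ (2 * n) := fun u => (even_two_mul n).neg_pow u
  have hstar : ∀ u : ℂ, u ^ (2 * n) = 1 → star u ^ (2 * n) = 1 := fun u hu => by
    rw [← star_pow, hu, star_one]
  induction hg using Subgroup.closure_induction with
  | mem x hx =>
    rcases hx with rfl | rfl
    · exact Or.inl ⟨rfl, exp_pi_div_pow hn⟩
    · exact Or.inr ⟨rfl, one_pow _⟩
  | one => exact Or.inl ⟨rfl, one_pow _⟩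
  | mul x y _ _ hx hy =>
    rw [su2_mul_zero_zero, su2_mul_one_zero]
    rcases hx with ⟨h1, h2⟩ | ⟨h1, h2⟩ <;> rcases hy with ⟨h3, h4⟩ | ⟨h3, h4⟩ <;> rw [h1, h3]
    · left
      simp [mul_pow, h2, h4]
    · right
      simp only [mul_zero, star_zero, zero_mul, sub_zero, zero_add, true_and]
      rw [mul_pow, h4, hstar _ h2, one_mul]
    · right
      simp [mul_pow, h2, h4]
    · left
      simp only [mul_zero, star_zero, zero_mul, zero_sub, add_zero, true_and]
      rw [hneg, mul_pow, h4, hstar _ h2, one_mul]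
  | inv x _ hx =>
    rw [su2_inv_zero_zero, su2_inv_one_zero]
    rcases hx with ⟨h1, h2⟩ | ⟨h1, h2⟩
    · left
      exact ⟨by rw [h1, neg_zero], hstar _ h2⟩
    · right
      exact ⟨by rw [h1, star_zero], by rw [hneg, h2]⟩

/-- The first column determines an element and takes finitely many values. Finiteness suffices
below; the exact order of the group plays no role. -/
theorem finite_binaryDihedral {n : ℕ} (hn : n ≠ 0) : Finite (binaryDihedral n) := by
  have hS : Set.Finite {u : ℂ | u = 0 ∨ u ^ (2 * n) = 1} := by
    refine (Set.finite_singleton (0 : ℂ)).union ?_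
    refine Set.Finite.subset (Polynomial.nthRoots (2 * n) (1 : ℂ)).toFinset.finite_toSet ?_
    intro u hu
    simp only [Finset.mem_coe, Multiset.mem_toFinset]
    exact (Polynomial.mem_nthRoots (by omega)).mpr hu
  have hS2 := hS.prod hS
  have : Finite ({u : ℂ | u = 0 ∨ u ^ (2 * n) = 1} ×ˢ {u : ℂ | u = 0 ∨ u ^ (2 * n) = 1} :
    Set (ℂ × ℂ)) := hS2
  refine Finite.of_injective
    (β := ({u : ℂ | u = 0 ∨ u ^ (2 * n) = 1} ×ˢ {u : ℂ | u = 0 ∨ u ^ (2 * n) = 1} :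
      Set (ℂ × ℂ))) (fun g => ⟨(g.1.1 0 0, g.1.1 1 0), ?_⟩) ?_
  · rcases binaryDihedral_cases hn g.2 with ⟨h1, h2⟩ | ⟨h1, h2⟩
    · exact ⟨Or.inr h2, Or.inl h1⟩
    · exact ⟨Or.inl h1, Or.inr h2⟩
  · intro g h e
    have e' := congrArg Subtype.val e
    exact Subtype.ext (su2_ext (congrArg Prod.fst e') (congrArg Prod.snd e'))

/-! ### Axes: Hopf circles with nontrivial stabilizer -/

/-- The elements of `G` that preserve the Hopf circle through `z` rotate it by the multiples
of the angle `l`. -/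
structure IsAxis (G : Subgroup SU2) (z : S3) (l : ℝ) : Prop where
  pos : 0 < l
  exists_rotation : ∃ g ∈ G, g • z = phase l z
  minimal : ∀ g ∈ G, ∀ θ, g • z = phase θ z → ∃ m : ℤ, θ = m * l

theorem eq_int_mul_of_exp_pow {θ : ℝ} {m : ℕ} (hm : m ≠ 0)
    (h : Complex.exp (θ * Complex.I) ^ m = 1) : ∃ k : ℤ, θ = k * (2 * Real.pi / m) := by
  rw [← Complex.exp_nat_mul, Complex.exp_eq_one_iff] at h
  obtain ⟨k, hk⟩ := h
  refine ⟨k, ?_⟩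
  have hm' : (m : ℝ) ≠ 0 := by exact_mod_cast hm
  have h1 := congrArg Complex.im hk
  simp at h1
  field_simp
  linarith

/-- The point of `S³` over the north pole. -/
def poleLift : S3 := ⟨!₂[1, 0], by
  rw [mem_sphere_zero_iff_norm, ← sq_eq_sq₀ (norm_nonneg _) zero_le_one, norm_sq_C2]
  simp⟩

/-- A point of `S³` over the equator. -/
def equatorLift (φ : ℝ) : S3 :=
  ⟨!₂[((√2)⁻¹ : ℝ), ((√2)⁻¹ : ℝ) * (-Complex.I * Complex.exp ((-φ : ℝ) * Complex.I))], by
    rw [mem_sphere_zero_iff_norm, ← sq_eq_sq₀ (norm_nonneg _) zero_le_one, norm_sq_C2]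
    simp only [Matrix.cons_val_zero, Matrix.cons_val_one, map_mul,
      Complex.normSq_ofReal, Complex.normSq_eq_norm_sq (Complex.exp _),
      Complex.norm_exp_ofReal_mul_I, Complex.normSq_neg, Complex.normSq_I]
    rw [← mul_inv, Real.mul_self_sqrt (by norm_num)]
    norm_num⟩

theorem equatorLift_zero (φ : ℝ) : (equatorLift φ).1 0 = ((√2)⁻¹ : ℝ) := rfl

theorem equatorLift_one (φ : ℝ) : (equatorLift φ).1 1
    = ((√2)⁻¹ : ℝ) * (-Complex.I * Complex.exp ((-φ : ℝ) * Complex.I)) := rfl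

theorem hopf_poleLift : hopf poleLift = pPlus := by
  apply Subtype.ext
  ext i
  fin_cases i <;> simp [hopf, poleLift, pPlus]

theorem hopf_equatorLift (φ : ℝ) : hopf (equatorLift φ) = equator φ := by
  have h2 : (√2)⁻¹ * (√2)⁻¹ = (1 / 2 : ℝ) := by
    rw [← mul_inv, Real.mul_self_sqrt (by norm_num)]; norm_num
  apply Subtype.ext
  ext i
  have e1 := equatorLift_one φ
  rw [Complex.exp_mul_I, ← Complex.ofReal_cos, ← Complex.ofReal_sin, Real.cos_neg, Real.sin_neg]
    at e1
  simp only [hopf, equator, equatorLift_zero, e1]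
  generalize (√2)⁻¹ = r at *
  have hcs := Real.sin_sq_add_cos_sq φ
  fin_cases i <;> simp [Complex.normSq_apply, -Complex.ofReal_cos, -Complex.ofReal_sin]
  · linear_combination (-r * r) * hcs
  · linear_combination 2 * Real.cos φ * h2
  · linear_combination 2 * Real.sin φ * h2

theorem phase_zero_coord (θ : ℝ) (z : S3) :
    (phase θ z).1 0 = Complex.exp (θ * Complex.I) * z.1 0 := rfl

theorem phase_one_coord (θ : ℝ) (z : S3) :
    (phase θ z).1 1 = Complex.exp (θ * Complex.I) * z.1 1 := rfl

theorem s3_ext {z w : S3} (h0 : z.1 0 = w.1 0) (h1 : z.1 1 = w.1 1) : z = w := by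
  apply Subtype.ext
  ext i
  fin_cases i
  · exact h0
  · exact h1

/-- Diagonal elements multiply `(1, 0)` by `2n`-th roots of unity, and the generator `A` achieves
the angle `π/n`. Antidiagonal elements move it to the other coordinate axis, so they do not preserve
the circle. -/
theorem isAxis_poleLift {n : ℕ} (hn : n ≠ 0) :
    IsAxis (binaryDihedral n) poleLift (Real.pi / n) where
  pos := by
    have : (0 : ℝ) < n := by exact_mod_cast Nat.pos_of_ne_zero hn
    positivity
  exists_rotation := by
    refine ⟨matA n, matA_mem n, s3_ext ?_ ?_⟩
    · rw [su2_smul_zero, phase_zero_coord, matA_zero_zero, matA_one_zero]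
      simp
    · rw [su2_smul_one, phase_one_coord, matA_one_zero]
      simp [poleLift]
  minimal g hg θ h := by
    have h0 : g.1 0 0 = Complex.exp (θ * Complex.I) := by
      have := congrArg (fun z : S3 => z.1 0) h
      simpa [su2_smul_zero, phase_zero_coord, poleLift] using this
    rcases binaryDihedral_cases hn hg with ⟨-, h2⟩ | ⟨h1, -⟩
    · rw [h0] at h2
      obtain ⟨k, hk⟩ := eq_int_mul_of_exp_pow (by omega) h2
      refine ⟨k, ?_⟩
      rw [hk]
      push_cast
      congr 1
      rw [mul_div_mul_left _ _ two_ne_zero]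
    · rw [h1] at h0
      exact absurd h0.symm (Complex.exp_ne_zero _)

theorem star_mul_self_of_pow_eq_one {u : ℂ} {m : ℕ} (hm : m ≠ 0) (h : u ^ m = 1) :
    star u * u = 1 := by
  have h1 : ‖u‖ = 1 := Complex.norm_eq_one_of_pow_eq_one h hm
  have := Complex.normSq_eq_conj_mul_self (z := u)
  rw [Complex.star_def, ← this, Complex.normSq_eq_norm_sq, h1]
  norm_num

/-- The element `g₀` multiplies the lift by `i`. Conversely, let `w` be the factor by which an
element acts on the lift: a diagonal element forces `w = w̄`, so `w² = 1`, and an antidiagonal one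
forces `w² = -1`. In either case `w⁴ = 1`. -/
theorem isAxis_equatorLift {n : ℕ} (hn : n ≠ 0) {φ : ℝ} {g₀ : SU2} (hg₀ : g₀ ∈ binaryDihedral n)
    (h0 : g₀.1 0 0 = 0) (h1 : g₀.1 1 0 = Complex.exp ((-φ : ℝ) * Complex.I)) :
    IsAxis (binaryDihedral n) (equatorLift φ) (Real.pi / 2) where
  pos := by positivity
  exists_rotation := by
    have e : star (Complex.exp ((-φ : ℝ) * Complex.I)) * Complex.exp ((-φ : ℝ) * Complex.I)
        = 1 := by
      rw [Complex.star_def, ← Complex.normSq_eq_conj_mul_self, Complex.normSq_eq_norm_sq,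
        Complex.norm_exp_ofReal_mul_I]
      norm_num
    have eI : Complex.exp ((Real.pi / 2 : ℝ) * Complex.I) = Complex.I := by
      push_cast
      exact Complex.exp_pi_div_two_mul_I
    refine ⟨g₀, hg₀, s3_ext ?_ ?_⟩
    · rw [su2_smul_zero, phase_zero_coord, h0, h1, equatorLift_one, equatorLift_zero, eI]
      linear_combination (((√2)⁻¹ : ℝ) * Complex.I) * e
    · rw [su2_smul_one, phase_one_coord, h0, h1, equatorLift_one, equatorLift_zero, eI, star_zero]
      linear_combination (((√2)⁻¹ : ℝ) * Complex.exp ((-φ : ℝ) * Complex.I)) * Complex.I_sq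
  minimal g hg θ h := by
    have hr : (((√2)⁻¹ : ℝ) : ℂ) ≠ 0 := by
      exact_mod_cast inv_ne_zero (Real.sqrt_ne_zero'.mpr two_pos)
    have a0 := congrArg (fun z : S3 => z.1 0) h
    have a1 := congrArg (fun z : S3 => z.1 1) h
    simp only [su2_smul_zero, su2_smul_one, phase_zero_coord, phase_one_coord, equatorLift_one,
      equatorLift_zero] at a0 a1
    have hv : -Complex.I * Complex.exp ((-φ : ℝ) * Complex.I) ≠ 0 :=
      mul_ne_zero (neg_ne_zero.mpr Complex.I_ne_zero) (Complex.exp_ne_zero _)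
    have key : Complex.exp (θ * Complex.I) ^ 4 = 1 := by
      generalize -Complex.I * Complex.exp ((-φ : ℝ) * Complex.I) = v at *
      generalize (((√2)⁻¹ : ℝ) : ℂ) = r at *
      generalize Complex.exp (θ * Complex.I) = w at *
      rcases binaryDihedral_cases hn hg with ⟨b1, b2⟩ | ⟨b1, b2⟩
      · have e := star_mul_self_of_pow_eq_one (by omega) b2
        rw [b1, star_zero, zero_mul, sub_zero] at a0
        rw [b1, zero_mul, zero_add] at a1
        have c0 : g.1 0 0 = w := mul_right_cancel₀ hr a0
        have c1 : star (g.1 0 0) = w := mul_right_cancel₀ (mul_ne_zero hr hv) a1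
        rw [c1, c0] at e
        linear_combination (w * w + 1) * e
      · have e := star_mul_self_of_pow_eq_one (by omega) b2
        rw [b1, zero_mul, zero_sub] at a0
        rw [b1, star_zero, zero_mul, add_zero] at a1
        have c0 : -(star (g.1 1 0) * v) = w := mul_right_cancel₀ hr (by linear_combination a0)
        have c1 : g.1 1 0 = w * v := mul_right_cancel₀ hr (by linear_combination a1)
        have c2 : w * w = -1 := by
          linear_combination (-w) * c0 + star (g.1 1 0) * c1 - e
        linear_combination (w * w - 1) * c2
    obtain ⟨k, hk⟩ := eq_int_mul_of_exp_pow (by norm_num) key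
    refine ⟨k, ?_⟩
    rw [hk]
    push_cast
    ring

/-- The representative `k = n` sits at angle `2π`, where `e^{-iφ} = 1` is the entry of `B`. -/
theorem isAxis_saddle {n : ℕ} (hn : n ≠ 0) :
    IsAxis (binaryDihedral n) (equatorLift (2 * n * Real.pi / n)) (Real.pi / 2) := by
  have hn' : (n : ℝ) ≠ 0 := by exact_mod_cast hn
  refine isAxis_equatorLift hn (matB_mem n) rfl ?_
  rw [matB_one_zero, eq_comm, Complex.exp_eq_one_iff]
  refine ⟨-1, ?_⟩
  rw [mul_right_comm, mul_div_assoc, div_self hn']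
  push_cast
  ring

/-- The representative `k = n` sits at angle `π/n + 2π`, and `AB` has the required entry
`e^{-iπ/n}`. -/
theorem isAxis_minimum {n : ℕ} (hn : n ≠ 0) :
    IsAxis (binaryDihedral n) (equatorLift ((Real.pi + 2 * n * Real.pi) / n)) (Real.pi / 2) := by
  have hn' : (n : ℝ) ≠ 0 := by exact_mod_cast hn
  refine isAxis_equatorLift (g₀ := matA n * matB) hn (mul_mem (matA_mem n) (matB_mem n)) ?_ ?_
  · rw [su2_mul_zero_zero, matB_zero_zero, matA_one_zero]
    simp
  · rw [su2_mul_one_zero, matB_one_zero, matA_one_zero, matA_zero_zero, Complex.star_def,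
      ← Complex.exp_conj, zero_mul, zero_add, mul_one, Complex.exp_eq_exp_iff_exists_int]
    refine ⟨1, ?_⟩
    rw [add_div, mul_right_comm, mul_div_assoc, div_self hn']
    simp
    ring

/-! ### The points fixed by elements of the dihedral group -/

theorem cover_smul_coords (g : SU2) (p : S2) :
    (cover g • p).1 0 = (Complex.normSq (g.1 0 0) - Complex.normSq (g.1 1 0)) * p.1 0
        + 2 * (g.1 0 0 * g.1 1 0).im * p.1 1 + 2 * (g.1 0 0 * g.1 1 0).re * p.1 2 ∧
      (cover g • p).1 1 = -2 * (star (g.1 0 0) * g.1 1 0).im * p.1 0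
        + (g.1 0 0 ^ 2 + g.1 1 0 ^ 2).re * p.1 1 - (g.1 0 0 ^ 2 + g.1 1 0 ^ 2).im * p.1 2 ∧
      (cover g • p).1 2 = -2 * (star (g.1 0 0) * g.1 1 0).re * p.1 0
        + (g.1 0 0 ^ 2 - g.1 1 0 ^ 2).im * p.1 1 + (g.1 0 0 ^ 2 - g.1 1 0 ^ 2).re * p.1 2 := by
  refine ⟨?_, ?_, ?_⟩
  · change ((coverMatrix (g.1 0 0) (g.1 1 0)).mulVec p.1.ofLp) 0 = _
    simp [coverMatrix, Matrix.mulVec, dotProduct, Fin.sum_univ_three]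
  · change ((coverMatrix (g.1 0 0) (g.1 1 0)).mulVec p.1.ofLp) 1 = _
    simp [coverMatrix, Matrix.mulVec, dotProduct, Fin.sum_univ_three]
    ring
  · change ((coverMatrix (g.1 0 0) (g.1 1 0)).mulVec p.1.ofLp) 2 = _
    simp [coverMatrix, Matrix.mulVec, dotProduct, Fin.sum_univ_three]

theorem s2_ext {p q : S2} (h0 : p.1 0 = q.1 0) (h1 : p.1 1 = q.1 1) (h2 : p.1 2 = q.1 2) :
    p = q := by
  apply Subtype.ext
  ext i
  fin_cases i
  · exact h0
  · exact h1
  · exact h2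

theorem cover_matA_equator (n : ℕ) (θ : ℝ) :
    cover (matA n) • equator θ = equator (θ + 2 * Real.pi / n) := by
  obtain ⟨h0, h1, h2⟩ := cover_smul_coords (matA n) (equator θ)
  have e : Complex.exp ((Real.pi / n : ℝ) * Complex.I) ^ 2
      = Real.cos (2 * Real.pi / n) + Real.sin (2 * Real.pi / n) * Complex.I := by
    rw [← Complex.exp_nat_mul, Complex.ofReal_cos, Complex.ofReal_sin, ← Complex.exp_mul_I]
    congr 1
    push_cast
    ring
  rw [matA_zero_zero, matA_one_zero] at h0 h1 h2
  rw [e] at h1 h2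
  refine s2_ext ?_ ?_ ?_
  · rw [h0]; simp [equator]
  · rw [h1]
    simp [equator, Real.cos_add, -Complex.ofReal_cos, -Complex.ofReal_sin]
    ring
  · rw [h2]
    simp [equator, Real.sin_add, -Complex.ofReal_cos, -Complex.ofReal_sin]
    ring

theorem cover_matA_zpow_equator (n : ℕ) (m : ℤ) (θ : ℝ) :
    cover (matA n ^ m) • equator θ = equator (θ + m * (2 * Real.pi / n)) := by
  have hnat : ∀ (k : ℕ) (θ : ℝ),
      cover (matA n ^ k) • equator θ = equator (θ + k * (2 * Real.pi / n)) := by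
    intro k
    induction k with
    | zero => intro θ; simp
    | succ k ih =>
      intro θ
      rw [pow_succ, map_mul, mul_smul, cover_matA_equator, ih]
      congr 1
      push_cast
      ring
  rcases Int.eq_nat_or_neg m with ⟨k, rfl | rfl⟩
  · simpa using hnat k θ
  · have := hnat k (θ + (-k : ℝ) * (2 * Real.pi / n))
    rw [zpow_neg, map_inv, inv_smul_eq_iff, zpow_natCast]
    push_cast
    rw [this]
    congr 1
    ring

theorem cover_matB_pPlus : cover matB • pPlus = -pPlus := by
  obtain ⟨h0, h1, h2⟩ := cover_smul_coords matB pPlus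
  rw [matB_zero_zero, matB_one_zero] at h0 h1 h2
  refine s2_ext ?_ ?_ ?_
  · rw [h0]; simp [pPlus]
  · rw [h1]; simp [pPlus]
  · rw [h2]; simp [pPlus]

/-- A nontrivial diagonal element is a rotation about the axis through `±pPlus` and fixes only these
two points. An antidiagonal element is a half-turn about an equatorial axis at a multiple of `π/n`;
powers of `A` shift this angle by `2π/n`, so the parity of the multiple distinguishes the saddles
from the minima. -/
theorem fixedPoints_cases {n : ℕ} (hn : n ≠ 0) {p : S2} (hp : p ∈ fixedPoints (dihedral n)) :
    ∃ g ∈ binaryDihedral n, p = cover g • pMinus n n ∨ p = cover g • pH n n ∨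
      p = cover g • pPlus := by
  obtain ⟨_, ⟨g, hg, rfl⟩, hne, hfix⟩ := hp
  have hnR : (n : ℝ) ≠ 0 := by exact_mod_cast hn
  obtain ⟨h0, h1, h2⟩ := cover_smul_coords g p
  rw [hfix] at h0 h1 h2
  have hnorm := norm_sq_R3 p.1
  rw [p.norm_eq_one] at hnorm
  rcases binaryDihedral_cases hn hg with ⟨b1, b2⟩ | ⟨b1, b2⟩
  · have hu : g.1 0 0 ^ 2 ≠ 1 := by
      intro hu
      apply hne
      apply Subtype.ext
      change coverMatrix (g.1 0 0) (g.1 1 0) = 1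
      have hu1 : ‖g.1 0 0‖ = 1 := Complex.norm_eq_one_of_pow_eq_one b2 (by omega)
      have hu2 : Complex.normSq (g.1 0 0) = 1 := by
        rw [Complex.normSq_eq_norm_sq, hu1, one_pow]
      rw [b1]
      unfold coverMatrix
      rw [hu2]
      ext i j
      fin_cases i <;> fin_cases j <;> simp [hu]
    have hu3 : ‖g.1 0 0 ^ 2‖ = 1 := by
      rw [norm_pow, Complex.norm_eq_one_of_pow_eq_one b2 (by omega), one_pow]
    rw [b1] at h1 h2
    simp only [mul_zero, Complex.zero_im, Complex.zero_re, zero_mul, zero_add, ne_eq,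
      OfNat.ofNat_ne_zero, not_false_eq_true, zero_pow, add_zero, sub_zero] at h1 h2
    have hv : (g.1 0 0 ^ 2 - 1) * (⟨p.1 1, p.1 2⟩ : ℂ) = 0 := by
      apply Complex.ext
      · simp only [Complex.mul_re, Complex.sub_re, Complex.sub_im, Complex.one_re, Complex.one_im,
          Complex.zero_re]
        linarith
      · simp only [Complex.mul_im, Complex.sub_re, Complex.sub_im, Complex.one_re, Complex.one_im,
          Complex.zero_im]
        linarith
    have hv0 := (mul_eq_zero.mp hv).resolve_left (sub_ne_zero.mpr hu)
    have hp1 : p.1 1 = 0 := congrArg Complex.re hv0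
    have hp2 : p.1 2 = 0 := congrArg Complex.im hv0
    rw [hp1, hp2] at hnorm
    have hp0 : (p.1 0 - 1) * (p.1 0 + 1) = 0 := by linarith
    rcases mul_eq_zero.mp hp0 with hp0 | hp0
    · refine ⟨1, one_mem _, Or.inr (Or.inr ?_)⟩
      rw [map_one, one_smul]
      exact s2_ext (by simpa [pPlus] using sub_eq_zero.mp hp0) (by simpa [pPlus] using hp1)
        (by simpa [pPlus] using hp2)
    · refine ⟨matB, matB_mem n, Or.inr (Or.inr ?_)⟩
      rw [cover_matB_pPlus]
      exact s2_ext (by simpa [pPlus] using eq_neg_of_add_eq_zero_left hp0)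
        (by simpa [pPlus] using hp1) (by simpa [pPlus] using hp2)
  · have hb : ‖g.1 1 0‖ = 1 := Complex.norm_eq_one_of_pow_eq_one b2 (by omega)
    have hb2 : Complex.normSq (g.1 1 0) = 1 := by rw [Complex.normSq_eq_norm_sq, hb, one_pow]
    rw [b1, hb2] at h0
    rw [b1] at h1 h2
    simp only [map_zero, zero_mul, Complex.zero_im, Complex.zero_re, mul_zero, add_zero, zero_sub,
      neg_mul, one_mul, star_zero, zero_add, ne_eq, OfNat.ofNat_ne_zero,
      not_false_eq_true, zero_pow, Complex.neg_im, Complex.neg_re] at h0 h1 h2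
    have hp0 : p.1 0 = 0 := by linarith
    rw [hp0] at hnorm
    set v : ℂ := ⟨p.1 1, p.1 2⟩ with hv
    have hvv : star v * v = 1 := by
      apply Complex.ext <;> simp [hv] <;> linarith
    have e1 : v = star (g.1 1 0 ^ 2 * v) := by
      apply Complex.ext
      · simp only [hv, Complex.star_def, Complex.conj_re, Complex.mul_re]
        linarith
      · simp only [hv, Complex.star_def, Complex.conj_im, Complex.mul_im]
        linarith
    -- In the coordinate `v` on the equatorial plane the element acts by `v ↦ star (b² v)` with `b =
    -- g.1 1 0`, so a fixed unit vector has `v² = b̄²` and is itself a `2n`-th root of unity.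
    have e2 : v ^ 2 = star (g.1 1 0) ^ 2 := by
      rw [star_mul', star_pow] at e1
      linear_combination v * e1 + star (g.1 1 0) ^ 2 * hvv
    have e3 : v ^ (2 * n) = 1 := by
      rw [pow_mul, e2, ← pow_mul, ← star_pow, b2, star_one]
    have e4 : Complex.exp (v.arg * Complex.I) = v := by
      have h := Complex.norm_mul_exp_arg_mul_I v
      rwa [Complex.norm_eq_one_of_pow_eq_one e3 (by omega), Complex.ofReal_one, one_mul] at h
    rw [← e4] at e3
    obtain ⟨k, hk⟩ := eq_int_mul_of_exp_pow (by omega) e3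
    have hk' : v.arg = k * (Real.pi / n) := by
      rw [hk]; push_cast; rw [mul_div_mul_left _ _ two_ne_zero]
    have hpe : p = equator v.arg := by
      refine s2_ext hp0 ?_ ?_
      · have := congrArg Complex.re e4
        rw [Complex.exp_ofReal_mul_I_re] at this
        exact this.symm
      · have := congrArg Complex.im e4
        rw [Complex.exp_ofReal_mul_I_im] at this
        exact this.symm
    rcases Int.even_or_odd' k with ⟨m, rfl | rfl⟩
    -- The shift by `-n` compensates for the base point `k = n`, whose angle includes a full turn.
    · refine ⟨matA n ^ (m - n), zpow_mem (matA_mem n) _, Or.inr (Or.inl ?_)⟩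
      rw [pH, cover_matA_zpow_equator, hpe, hk']
      congr 1
      push_cast
      field_simp
      ring
    · refine ⟨matA n ^ (m - n), zpow_mem (matA_mem n) _, Or.inl ?_⟩
      rw [pMinus, cover_matA_zpow_equator, hpe, hk']
      congr 1
      push_cast
      field_simp
      ring

/-! ### Closed Reeb trajectories over critical points -/

theorem Link.mk_smul {G : Subgroup SU2} {g : SU2} (hg : g ∈ G) (z : S3) :
    Link.mk G (g • z) = Link.mk G z :=
  Link.mk_eq_iff.mpr ⟨g, hg, rfl⟩

theorem IsAxis.mk_phase_eq_iff {G : Subgroup SU2} {z : S3} {l : ℝ} (h : IsAxis G z l)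
    {s t : ℝ} : Link.mk G (phase s z) = Link.mk G (phase t z) ↔ ∃ m : ℤ, s - t = m * l := by
  constructor
  · intro e
    obtain ⟨g, hg, e⟩ := Link.mk_eq_iff.mp e
    apply h.minimal g hg
    have e2 := congrArg (phase (-t)) e
    rw [← smul_phase, phase_phase, phase_phase, neg_add_cancel, phase_zero] at e2
    rw [e2]
    congr 1
    ring
  · rintro ⟨m, hm⟩
    obtain ⟨g, hg, hgl⟩ := h.exists_rotation
    have hnat : ∀ (k : ℕ) (t : ℝ), Link.mk G (phase (t + k * l) z) = Link.mk G (phase t z) := by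
      intro k
      induction k with
      | zero => intro t; simp
      | succ k ih =>
        intro t
        rw [← ih t, show t + (k + 1 : ℕ) * l = (t + k * l) + l by push_cast; ring, ← phase_phase,
          ← hgl, ← smul_phase, Link.mk_smul hg]
    rcases Int.eq_nat_or_neg m with ⟨k, rfl | rfl⟩
    · rw [show s = t + k * l by push_cast at hm; linarith, hnat]
    · rw [show t = s + k * l by push_cast at hm; linarith, hnat]

/-- The closed Reeb trajectory over a critical point. -/
def axisLoop {G : Subgroup SU2} {f : S2 → ℝ} (hf : ContMDiff (𝓡 2) 𝓘(ℝ, ℝ) ∞ f) {ε : ℝ}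
    (hpos : ∀ p : S2, 0 < 1 + ε * f p) {z : S3} {l : ℝ} (h : IsAxis G z l)
    (hz : homGrad f (hopf z).1 = 0) : ReebLoop G f ε where
  curve t := Link.mk G (phase (t * (1 + ε * f (hopf z))⁻¹) z)
  period := l * (1 + ε * f (hopf z))
  period_pos := mul_pos h.pos (hpos _)
  periodic t := by
    refine h.mk_phase_eq_iff.mpr ⟨1, ?_⟩
    have := (hpos (hopf z)).ne'
    field_simp
    push_cast
    ring
  trajectory t := ⟨fun s => phase (s * (1 + ε * f (hopf z))⁻¹) z,
    Filter.Eventually.of_forall fun _ => rfl, isReebTrajectory_phase hf hpos hz t⟩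

/-- The Reeb orbit over a critical point. -/
def axisOrbit {G : Subgroup SU2} {f : S2 → ℝ} (hf : ContMDiff (𝓡 2) 𝓘(ℝ, ℝ) ∞ f) {ε : ℝ}
    (hpos : ∀ p : S2, 0 < 1 + ε * f p) {z : S3} {l : ℝ} (h : IsAxis G z l)
    (hz : homGrad f (hopf z).1 = 0) : ReebOrbit G f ε :=
  ⟦axisLoop hf hpos h hz⟧

section Axis

variable {G : Subgroup SU2} {f : S2 → ℝ} (hf : ContMDiff (𝓡 2) 𝓘(ℝ, ℝ) ∞ f) {ε : ℝ}
  (hpos : ∀ p : S2, 0 < 1 + ε * f p) {z : S3} {l : ℝ} (h : IsAxis G z l)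
  (hz : homGrad f (hopf z).1 = 0)

theorem ReebOrbit.action_iterate (γ : ReebOrbit G f ε) (k : ℕ+) :
    (γ.iterate k).action = k * γ.action := by
  induction γ using Quotient.inductionOn with
  | h c => rfl

theorem ReebOrbit.action_pos (γ : ReebOrbit G f ε) : 0 < γ.action := by
  induction γ using Quotient.inductionOn with
  | h c => exact c.period_pos

theorem ReebOrbit.iterate_iterate (γ : ReebOrbit G f ε) (j k : ℕ+) :
    (γ.iterate j).iterate k = γ.iterate (j * k) := by
  induction γ using Quotient.inductionOn with
  | h c =>
    apply Quotient.sound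
    refine ⟨?_, 0, fun t => by rw [add_zero]; rfl⟩
    change (k : ℝ) * (j * c.period) = ((j * k : ℕ+) : ℕ) * c.period
    rw [PNat.mul_coe]
    push_cast
    ring

theorem action_axisOrbit_iterate (k : ℕ+) : ((axisOrbit hf hpos h hz).iterate k).action
    = k * (l * (1 + ε * f (hopf z))) := by
  rw [ReebOrbit.action_iterate]
  rfl

theorem curve_of_mk_eq_axisOrbit_iterate {k : ℕ+} {c : ReebLoop G f ε}
    (hc : (⟦c⟧ : ReebOrbit G f ε) = (axisOrbit hf hpos h hz).iterate k) :
    c.period = k * (l * (1 + ε * f (hopf z))) ∧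
      ∃ s, ∀ t, c.curve t = Link.mk G (phase (t * (1 + ε * f (hopf z))⁻¹ + s) z) := by
  obtain ⟨h1, s, hs⟩ := Quotient.exact hc.symm
  refine ⟨h1.symm, s * (1 + ε * f (hopf z))⁻¹, fun t => ?_⟩
  rw [hs, ← add_mul]
  rfl

theorem axisOrbit_iterate_one :
    (axisOrbit hf hpos h hz).iterate 1 = axisOrbit hf hpos h hz := by
  apply Quotient.sound
  refine ⟨?_, 0, fun t => by rw [add_zero]; rfl⟩
  change ((1 : ℕ+) : ℕ) * (axisLoop hf hpos h hz).period = _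
  simp

theorem isEmbedded_axisOrbit : (axisOrbit hf hpos h hz).IsEmbedded := by
  intro c hc
  rw [← axisOrbit_iterate_one] at hc
  obtain ⟨h1, s, hs⟩ := curve_of_mk_eq_axisOrbit_iterate hf hpos h hz hc
  have ha := hpos (hopf z)
  intro t₁ ht₁ t₂ ht₂ e
  rw [hs, hs, h.mk_phase_eq_iff] at e
  obtain ⟨m, hm⟩ := e
  rw [h1, PNat.one_coe, Nat.cast_one, one_mul] at ht₁ ht₂
  have hl := h.pos
  set a := 1 + ε * f (hopf z) with ha_def
  have hm' : t₁ - t₂ = m * (l * a) := by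
    field_simp at hm
    linarith
  have hla : 0 < l * a := mul_pos hl ha
  have b1 : (m : ℝ) < 1 := by
    by_contra hcon
    push Not at hcon
    nlinarith [ht₁.1, ht₁.2, ht₂.1, ht₂.2]
  have b2 : (-1 : ℝ) < m := by
    by_contra hcon
    push Not at hcon
    nlinarith [ht₁.1, ht₁.2, ht₂.1, ht₂.2]
  have b3 : m < 1 := by exact_mod_cast b1
  have b4 : -1 < m := by exact_mod_cast b2
  have b5 : m = 0 := by omega
  rw [b5] at hm'
  push_cast at hm'
  linarith

theorem seifert_mk (w : S3) : seifert G (Link.mk G w) = Base.mk G (hopf w) := rfl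

theorem projectsTo_axisOrbit_iterate (k : ℕ+) :
    ((axisOrbit hf hpos h hz).iterate k).ProjectsTo (Base.mk G (hopf z)) := by
  intro c hc t
  obtain ⟨-, s, hs⟩ := curve_of_mk_eq_axisOrbit_iterate hf hpos h hz hc
  rw [hs, seifert_mk, hopf_phase]

theorem Base.mk_eq_iff {p q : S2} : Base.mk G p = Base.mk G q ↔ ∃ g ∈ G, cover g • q = p := by
  rw [Base.mk, Base.mk, Quotient.eq]
  change p ∈ MulAction.orbit (G.map cover) q ↔ _
  rw [MulAction.mem_orbit_iff]
  constructor
  · rintro ⟨⟨_, g, hg, rfl⟩, e⟩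
    exact ⟨g, hg, e⟩
  · rintro ⟨g, hg, e⟩
    exact ⟨⟨cover g, Subgroup.mem_map_of_mem cover hg⟩, e⟩

/-- Invariant functions descend to the orbifold, so they separate projections of orbits. -/
theorem ReebOrbit.ProjectsTo.apply_eq (hG : ∀ g ∈ G, ∀ p, f (cover g • p) = f p)
    {γ : ReebOrbit G f ε} {p q : S2} (hp : γ.ProjectsTo (Base.mk G p))
    (hq : γ.ProjectsTo (Base.mk G q)) : f p = f q := by
  obtain ⟨c, hc⟩ := Quotient.exists_rep γ
  obtain ⟨g, hg, e⟩ := Base.mk_eq_iff.mp ((hp c hc 0).symm.trans (hq c hc 0))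
  rw [← e, hG g hg]

theorem axisOrbit_iterate_injective :
    Function.Injective fun k => (axisOrbit hf hpos h hz).iterate k := by
  intro j k e
  have e' := congrArg ReebOrbit.action e
  simp only [action_axisOrbit_iterate] at e'
  have := mul_right_cancel₀ (mul_pos h.pos (hpos (hopf z))).ne' e'
  exact PNat.coe_injective (by exact_mod_cast this)

/-- The starting point of the linearized flow along an iterate lies over the same critical orbit. -/
theorem flowMatrix_axisOrbit_iterate (k : ℕ+) : ∃ g ∈ G, ∃ s, ∀ t,
    ((axisOrbit hf hpos h hz).iterate k).flowMatrix t = linearizedFlow f ε t (g • phase s z) := by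
  set γ := (axisOrbit hf hpos h hz).iterate k with hγ
  have hout : (⟦(Quotient.out γ : ReebLoop G f ε)⟧ : ReebOrbit G f ε) = γ := Quotient.out_eq γ
  obtain ⟨-, s, hs⟩ := curve_of_mk_eq_axisOrbit_iterate hf hpos h hz hout
  have h0 := hs 0
  have e : Link.mk G (Quotient.out ((Quotient.out γ : ReebLoop G f ε).curve 0))
      = Link.mk G (phase (0 * (1 + ε * f (hopf z))⁻¹ + s) z) :=
    (Quotient.out_eq _).trans h0
  obtain ⟨g, hg, e⟩ := Link.mk_eq_iff.mp e
  refine ⟨g, hg, 0 * (1 + ε * f (hopf z))⁻¹ + s, fun t => ?_⟩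
  rw [e]
  rfl

/-- A closed Reeb trajectory through a Hopf circle over a critical point is an iterate of the
closed trajectory along this circle. -/
theorem mk_eq_axisOrbit_iterate [Finite G] (hG : ∀ g ∈ G, ∀ p, f (cover g • p) = f p) (c : ReebLoop G f ε)
    {s : ℝ} (h0 : c.curve 0 = Link.mk G (phase s z)) :
    ∃ k : ℕ+, (⟦c⟧ : ReebOrbit G f ε) = (axisOrbit hf hpos h hz).iterate k := by
  set a := 1 + ε * f (hopf z) with ha
  have hapos : 0 < a := hpos _
  have htraj : IsReebTrajectory f ε fun t => phase (t * a⁻¹ + s) z := by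
    have := (isReebTrajectory_phase hf hpos hz).comp_add_right (s * a)
    convert this using 3 with t
    rw [← ha]
    field_simp
  -- Uniqueness in the quotient is available in forward time only; negative times are reached below
  -- by adding multiples of the period.
  have hnonneg : ∀ t, 0 ≤ t → c.curve t = Link.mk G (phase (t * a⁻¹ + s) z) := fun t ht =>
    (mk_eq_of_isQuotientReebTrajectory hf hG hpos c.trajectory htraj
      (by rw [zero_mul, zero_add, h0]) ht).symm
  have hT := c.periodic 0
  rw [zero_add, hnonneg _ c.period_pos.le, h0, h.mk_phase_eq_iff] at hT
  obtain ⟨m, hm⟩ := hT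
  have hm' : c.period = m * (l * a) := by
    field_simp at hm
    linarith
  have hla : 0 < l * a := mul_pos h.pos hapos
  have hmpos : 0 < m := by
    have : (0 : ℝ) < m := by
      by_contra hcon
      push Not at hcon
      nlinarith [c.period_pos]
    exact_mod_cast this
  lift m to ℕ using hmpos.le
  have hmpos' : 0 < m := by exact_mod_cast hmpos
  refine ⟨⟨m, hmpos'⟩, Quotient.sound (Setoid.symm ⟨hm'.symm, s * a, fun t => ?_⟩)⟩
  change c.curve t = Link.mk G (phase ((t + s * a) * a⁻¹) z)
  obtain ⟨j, hj⟩ := exists_nat_ge (-t / c.period)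
  have hj' : 0 ≤ t + j * c.period := by
    rw [div_le_iff₀ c.period_pos] at hj
    linarith
  have e1 : c.curve (t + j * c.period) = c.curve t := c.periodic.nat_mul j t
  rw [← e1, hnonneg _ hj', h.mk_phase_eq_iff, hm']
  refine ⟨j * m, ?_⟩
  push_cast
  field_simp
  ring

end Axis

/-- Periodic orbits of bounded period lift to periodic trajectories. -/
theorem ReebLoop.exists_lift {G : Subgroup SU2} [Finite G] {f : S2 → ℝ}
    (hf : ContMDiff (𝓡 2) 𝓘(ℝ, ℝ) ∞ f) {ε : ℝ} (hpos : ∀ p : S2, 0 < 1 + ε * f p)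
    (hG : ∀ g ∈ G, ∀ p, f (cover g • p) = f p)
    (c : ReebLoop G f ε) : ∃ l : ℝ → S3, IsReebTrajectory f ε l ∧ Link.mk G (l 0) = c.curve 0 ∧
      Function.Periodic l (Nat.card G * c.period) := by
  obtain ⟨l, hl, hl0⟩ := exists_isReebTrajectory hf hpos (Quotient.out (c.curve 0))
  have h0 : Link.mk G (l 0) = c.curve 0 := by rw [hl0]; exact Quotient.out_eq _
  have hT := mk_eq_of_isQuotientReebTrajectory hf hG hpos c.trajectory hl h0 c.period_pos.le
  have hT2 : Link.mk G (l c.period) = Link.mk G (l 0) := by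
    rw [hT, h0, ← c.periodic 0, zero_add]
  obtain ⟨g, hg, e⟩ := Link.mk_eq_iff.mp hT2
  -- Closing up in the quotient means that one period upstairs is the action of some `g ∈ G`. Both
  -- sides are trajectories with the same initial point, so the relation persists, and after `|G|`
  -- periods `g ^ |G| = 1` closes the lift.
  have hshift : (fun t => l (t + c.period)) = fun t => g • l t :=
    (hl.comp_add_right c.period).eq_of_eq_at hf hpos (hl.smul hf hpos (hG g hg)) (t₀ := 0)
      (by rw [zero_add, e])
  have hiter : ∀ (k : ℕ) (t : ℝ), l (t + k * c.period) = g ^ k • l t := by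
    intro k
    induction k with
    | zero => intro t; simp
    | succ k ih =>
      intro t
      have : l (t + k * c.period + c.period) = g • l (t + k * c.period) :=
        congrFun hshift (t + k * c.period)
      rw [show t + (k + 1 : ℕ) * c.period = t + k * c.period + c.period by push_cast; ring, this,
        ih, ← mul_smul, pow_succ']
  refine ⟨l, hl, h0, fun t => ?_⟩
  have hg1 : g ^ Nat.card G = 1 := by
    have := pow_card_eq_one' (x := (⟨g, hg⟩ : G))
    exact congrArg Subtype.val this
  rw [hiter, hg1, one_smul]

/-! ### Normal forms along group orbits -/

/-- The rotation defining the chart is composed with `cover g`. This is needed because the starting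
point of the linearized flow is known only up to `G`. -/
theorem HasStereographicForm.smul {f : S2 → ℝ} {p : S2} {q : ℝ → ℝ → ℝ}
    (h : HasStereographicForm f p q) {g : SU2} (hg : ∀ p, f (cover g • p) = f p) :
    HasStereographicForm f (cover g • p) q := by
  obtain ⟨r, hr, hev⟩ := h
  refine ⟨cover g * r, by rw [mul_smul, hr], ?_⟩
  filter_upwards [hev] with u hu
  rw [mul_smul, hg, hu]

/-! ### Return maps and indices of the orbits over critical points -/

/-- An integer `y` would make `d y` an integer strictly between two consecutive integers. The
multiplier `d` allows `y` with denominator `n`. -/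
theorem sin_pi_mul_ne_zero {d i : ℤ} {y : ℝ} (h1 : i < d * y) (h2 : d * y < i + 1) :
    Real.sin (Real.pi * y) ≠ 0 := by
  intro h
  obtain ⟨j, hj⟩ := Real.sin_eq_zero_iff.mp h
  have hy : y = j := mul_left_cancel₀ Real.pi_ne_zero (by rw [← hj]; ring)
  rw [hy] at h1 h2
  have h1' : i < d * j := by exact_mod_cast h1
  have h2' : d * j < i + 1 := by exact_mod_cast h2
  omega

section Flow

variable {G : Subgroup SU2} {f : S2 → ℝ} (hf : ContMDiff (𝓡 2) 𝓘(ℝ, ℝ) ∞ f) {ε : ℝ}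
  (hpos : ∀ p : S2, 0 < 1 + ε * f p) {z : S3} {l : ℝ} (h : IsAxis G z l)
  (hz : homGrad f (hopf z).1 = 0) {c : ℝ}

/-- The chosen starting point is some `g • phase s z`. The normal form is transported there, and the
rotation speed depends only on `c`, `q` and `ε`. -/
theorem flowMatrix_elliptic (hG : ∀ g ∈ G, ∀ p, f (cover g • p) = f p) {q : ℝ}
    (hform : HasStereographicForm f (hopf z) fun x y => c + (q * x ^ 2 + q * y ^ 2) / 2)
    (k : ℕ+) {t : ℝ} (ht : 0 ≤ t) (v : Fin 2 → ℝ) :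
    toComplex ((((axisOrbit hf hpos h hz).iterate k).flowMatrix t).mulVec v) =
      Complex.exp ((t * (2 / (1 + ε * c) - ε * q / (2 * (1 + ε * c) ^ 2)) : ℝ) * Complex.I)
        * toComplex v := by
  obtain ⟨g, hg, s, hgs⟩ := flowMatrix_axisOrbit_iterate hf hpos h hz k
  have hform' := hform.smul (hG g hg)
  rw [← hopf_phase s z, ← hopf_smul] at hform'
  obtain ⟨ρ₁, ρ₂, hN⟩ := hform'.exists_normalFrame
  rw [hgs, hN.linearizedFlow_elliptic hf hpos ht]

/-- Here the starting point does affect the flow, but only through the unit number `τ`, which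
influences neither the spectrum nor the index. -/
theorem flowMatrix_hyperbolic (hG : ∀ g ∈ G, ∀ p, f (cover g • p) = f p)
    (hform : HasStereographicForm f (hopf z) fun x y => c + (1 * x ^ 2 + -1 * y ^ 2) / 2)
    (k : ℕ+) : ∃ τ : ℂ, ‖τ‖ = 1 ∧ ∀ t : ℝ, 0 ≤ t → ∀ v : Fin 2 → ℝ,
      toComplex ((((axisOrbit hf hpos h hz).iterate k).flowMatrix t).mulVec v) =
        Complex.exp ((t * (2 / (1 + ε * c)) : ℝ) * Complex.I)
          * (Real.cosh (ε / (2 * (1 + ε * c) ^ 2) * t) * toComplex v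
            + Real.sinh (ε / (2 * (1 + ε * c) ^ 2) * t) * (τ * star (toComplex v))) := by
  obtain ⟨g, hg, s, hgs⟩ := flowMatrix_axisOrbit_iterate hf hpos h hz k
  have hform' := hform.smul (hG g hg)
  rw [← hopf_phase s z, ← hopf_smul] at hform'
  obtain ⟨ρ₁, ρ₂, hN⟩ := hform'.exists_normalFrame
  obtain ⟨τ, hτ, hfl⟩ := hN.linearizedFlow_hyperbolic hf hpos
  exact ⟨τ, hτ, fun t ht v => by rw [hgs, hfl t ht]⟩

end Flow

/-- An orbit along which the linearized flow is a rotation with constant speed, by the total angle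
`2πx`. -/
def ReebOrbit.IsElliptic {G : Subgroup SU2} {f : S2 → ℝ} {ε : ℝ} (γ : ReebOrbit G f ε) (x : ℝ) :
    Prop :=
  ∃ w : ℝ, γ.action * w = 2 * Real.pi * x ∧ ∀ t, 0 ≤ t → ∀ v,
    toComplex ((γ.flowMatrix t).mulVec v) = Complex.exp ((t * w : ℝ) * Complex.I) * toComplex v

/-- An orbit along which the linearized flow is the product of a rotation with constant speed, by
the total angle `kπ`, and a hyperbolic flow. -/
def ReebOrbit.IsHyperbolic {G : Subgroup SU2} {f : S2 → ℝ} {ε : ℝ} (γ : ReebOrbit G f ε) (k : ℤ) :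
    Prop :=
  ∃ (w b : ℝ) (τ : ℂ), ‖τ‖ = 1 ∧ b ≠ 0 ∧ γ.action * w = k * Real.pi ∧ ∀ t, 0 ≤ t → ∀ v,
    toComplex ((γ.flowMatrix t).mulVec v) = Complex.exp ((t * w : ℝ) * Complex.I)
      * (Real.cosh (b * t) * toComplex v + Real.sinh (b * t) * (τ * star (toComplex v)))

namespace ReebOrbit

variable {G : Subgroup SU2} {f : S2 → ℝ} {ε : ℝ} {γ : ReebOrbit G f ε}

theorem IsElliptic.hasIndex_iff {x : ℝ} (h : γ.IsElliptic x) {m : ℤ} (h1 : m < x)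
    (h2 : x < m + 1) (μ : ℤ) : γ.HasIndex μ ↔ μ = 2 * m + 1 := by
  obtain ⟨w, hw, hM⟩ := h
  exact hasConleyZehnderIndex_elliptic_iff γ.action_pos.le (fun t ht => hM t ht.1) hw h1 h2 μ

theorem IsElliptic.isNondegenerate {x : ℝ} (h : γ.IsElliptic x)
    (hx : Real.sin (Real.pi * (2 * x)) ≠ 0) : γ.IsNondegenerate := by
  obtain ⟨w, hw, hM⟩ := h
  refine one_notMem_spectrum_rotation (α := γ.action * w) (hM _ γ.action_pos.le) (Or.inl ?_)
  rwa [hw, mul_right_comm, mul_comm, mul_comm 2 x, mul_comm x 2]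

theorem IsElliptic.not_isNegativeHyperbolic {x : ℝ} (h : γ.IsElliptic x)
    (hx : Real.sin (Real.pi * (2 * x)) ≠ 0) : ¬ γ.IsNegativeHyperbolic := by
  obtain ⟨w, hw, hM⟩ := h
  refine exists_nonreal_spectrum_rotation (α := γ.action * w) (hM _ γ.action_pos.le) ?_
  rwa [hw, mul_right_comm, mul_comm, mul_comm 2 x, mul_comm x 2]

theorem IsHyperbolic.hasIndex_iff {k : ℤ} (h : γ.IsHyperbolic k) (μ : ℤ) :
    γ.HasIndex μ ↔ μ = k := by
  obtain ⟨w, b, τ, hτ, -, hw, hM⟩ := h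
  exact hasConleyZehnderIndex_hyperbolic_iff hτ γ.action_pos.le (fun t ht => hM t ht.1) hw μ

/-- The rotational part has total angle `kπ` and contributes `e^{ikπ} = (-1)^k`. -/
theorem IsHyperbolic.returnMap_apply {k : ℤ} (h : γ.IsHyperbolic k) :
    ∃ (s : ℝ) (τ : ℂ), s ≠ 0 ∧ ‖τ‖ = 1 ∧ ∀ v, toComplex (γ.returnMap.mulVec v)
      = ((-1 : ℝ) ^ k : ℝ) * (Real.cosh s * toComplex v
        + Real.sinh s * (τ * star (toComplex v))) := by
  obtain ⟨w, b, τ, hτ, hb, hw, hM⟩ := h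
  refine ⟨b * γ.action, τ, mul_ne_zero hb γ.action_pos.ne', hτ, fun v => ?_⟩
  rw [returnMap, hM _ γ.action_pos.le, hw]
  congr 1
  push_cast
  rw [mul_assoc, Complex.exp_int_mul, Complex.exp_pi_mul_I]

theorem IsHyperbolic.isNondegenerate {k : ℤ} (h : γ.IsHyperbolic k) : γ.IsNondegenerate := by
  obtain ⟨s, τ, hs, hτ, hR⟩ := h.returnMap_apply
  refine one_notMem_spectrum_hyperbolic hτ ?_ hs hR
  rcases Int.even_or_odd k with hk | hk
  · rw [hk.neg_one_zpow, one_pow]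
  · rw [hk.neg_one_zpow]; norm_num

theorem IsHyperbolic.isNegativeHyperbolic {k : ℤ} (h : γ.IsHyperbolic k) (hk : Odd k) :
    γ.IsNegativeHyperbolic := by
  obtain ⟨s, τ, hs, hτ, hR⟩ := h.returnMap_apply
  rw [hk.neg_one_zpow] at hR
  exact spectrum_negative_hyperbolic hτ hR

end ReebOrbit

/-! ### The structure of the low action spectrum -/

/-- The Reeb orbits of action less than the threshold are iterates of two elliptic orbits and one
negative hyperbolic orbit. -/
structure IsLowActionSpectrum (n N : ℕ) {f : S2 → ℝ} {ε : ℝ} (eMinus h ePlus : Orbit n f ε) :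
    Prop where
  action_lt_iff : ∀ γ : Orbit n f ε, γ.action < threshold n N ↔
    (∃ k : ℕ+, (k : ℕ) < 4 * N ∧ γ = eMinus.iterate k) ∨
    (∃ k : ℕ+, (k : ℕ) < 4 * N ∧ γ = h.iterate k) ∨
    (∃ k : ℕ+, (k : ℕ) < 2 * n * N ∧ γ = ePlus.iterate k)
  elliptic_minus : ∀ k : ℕ+, (k : ℕ) < 4 * N → ∃ x : ℝ, (eMinus.iterate k).IsElliptic x ∧
    Real.sin (Real.pi * (2 * x)) ≠ 0 ∧
    (((((k : ℕ) + 1) / 2 : ℕ) : ℤ) - 1 : ℤ) < x ∧ x < (((((k : ℕ) + 1) / 2 : ℕ) : ℤ) - 1 : ℤ) + 1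
  hyperbolic : ∀ k : ℕ+, (h.iterate k).IsHyperbolic (k : ℕ)
  elliptic_plus : ∀ k : ℕ+, (k : ℕ) < 2 * n * N → ∃ x : ℝ, (ePlus.iterate k).IsElliptic x ∧
    Real.sin (Real.pi * (2 * x)) ≠ 0 ∧
    (((k : ℕ) / n : ℕ) : ℤ) < x ∧ x < (((k : ℕ) / n : ℕ) : ℤ) + 1
  iterate_one : h.iterate 1 = h
  injective_minus : Function.Injective fun k => eMinus.iterate k
  injective_hyperbolic : Function.Injective fun k => h.iterate k
  injective_plus : Function.Injective fun k => ePlus.iterate k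
  minus_ne_hyperbolic : ∀ j k, eMinus.iterate j ≠ h.iterate k
  minus_ne_plus : ∀ j k, eMinus.iterate j ≠ ePlus.iterate k
  hyperbolic_ne_plus : ∀ j k, h.iterate j ≠ ePlus.iterate k

namespace IsLowActionSpectrum

variable {n N : ℕ} {f : S2 → ℝ} {ε : ℝ} {eMinus h ePlus : Orbit n f ε}

theorem hasDegree_minus_iff (H : IsLowActionSpectrum n N eMinus h ePlus) {k : ℕ+}
    (hk : (k : ℕ) < 4 * N) (i : ℤ) :
    (eMinus.iterate k).HasDegree i ↔ i = 2 * (((k : ℕ) + 1) / 2 : ℕ) - 2 := by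
  obtain ⟨x, hx, -, h1, h2⟩ := H.elliptic_minus k hk
  rw [ReebOrbit.HasDegree, hx.hasIndex_iff h1 h2]
  omega

theorem hasDegree_hyperbolic_iff (H : IsLowActionSpectrum n N eMinus h ePlus) (k : ℕ+) (i : ℤ) :
    (h.iterate k).HasDegree i ↔ i = (k : ℕ) - 1 := by
  rw [ReebOrbit.HasDegree, (H.hyperbolic k).hasIndex_iff]
  omega

theorem hasDegree_plus_iff (H : IsLowActionSpectrum n N eMinus h ePlus) {k : ℕ+}
    (hk : (k : ℕ) < 2 * n * N) (i : ℤ) :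
    (ePlus.iterate k).HasDegree i ↔ i = 2 * ((k : ℕ) / n : ℕ) := by
  obtain ⟨x, hx, -, h1, h2⟩ := H.elliptic_plus k hk
  rw [ReebOrbit.HasDegree, hx.hasIndex_iff h1 h2]
  omega

theorem isNondegenerate (H : IsLowActionSpectrum n N eMinus h ePlus) {γ : Orbit n f ε}
    (hγ : γ.action < threshold n N) : γ.IsNondegenerate := by
  rcases (H.action_lt_iff γ).mp hγ with ⟨k, hk, rfl⟩ | ⟨k, hk, rfl⟩ | ⟨k, hk, rfl⟩
  · obtain ⟨x, hx, hs, -⟩ := H.elliptic_minus k hk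
    exact hx.isNondegenerate hs
  · exact (H.hyperbolic k).isNondegenerate
  · obtain ⟨x, hx, hs, -⟩ := H.elliptic_plus k hk
    exact hx.isNondegenerate hs

/-- If `γ` is an iterate of a negative hyperbolic `β`, then `β` has no larger action and so appears
in the list; the elliptic iterates there have a nonreal eigenvalue, leaving only iterates of `h`.
Conversely `h` itself is negative hyperbolic. -/
theorem isBad_iff (H : IsLowActionSpectrum n N eMinus h ePlus) {γ : Orbit n f ε}
    (hγ : γ.action < threshold n N) :
    γ.IsBad ↔ ∃ k : ℕ+, Even (k : ℕ) ∧ γ = h.iterate k := by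
  constructor
  · rintro ⟨β, k, hneg, hk, rfl⟩
    have hβ : β.action < threshold n N := by
      refine lt_of_le_of_lt ?_ hγ
      rw [ReebOrbit.action_iterate]
      have : (1 : ℝ) ≤ (k : ℕ) := by exact_mod_cast k.pos
      nlinarith [β.action_pos]
    rcases (H.action_lt_iff β).mp hβ with ⟨j, hj, rfl⟩ | ⟨j, hj, rfl⟩ | ⟨j, hj, rfl⟩
    · obtain ⟨x, hx, hs, -⟩ := H.elliptic_minus j hj
      exact absurd hneg (hx.not_isNegativeHyperbolic hs)
    · refine ⟨j * k, ?_, ReebOrbit.iterate_iterate _ _ _⟩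
      rw [PNat.mul_coe]
      exact hk.mul_left _
    · obtain ⟨x, hx, hs, -⟩ := H.elliptic_plus j hj
      exact absurd hneg (hx.not_isNegativeHyperbolic hs)
  · rintro ⟨k, hk, rfl⟩
    refine ⟨h, k, ?_, hk, rfl⟩
    have := (H.hyperbolic 1).isNegativeHyperbolic (by simp)
    rwa [H.iterate_one] at this

/-- The elliptic families have odd indices by form, and the good iterates of `h` are the odd ones,
of degree `k - 1`. -/
theorem even_of_isGood (H : IsLowActionSpectrum n N eMinus h ePlus) {γ : Orbit n f ε}
    (hγ : γ.action < threshold n N) (hgood : γ.IsGood) {i : ℤ} (hi : γ.HasDegree i) : Even i := by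
  rcases (H.action_lt_iff γ).mp hγ with ⟨k, hk, rfl⟩ | ⟨k, hk, rfl⟩ | ⟨k, hk, rfl⟩
  · rw [(H.hasDegree_minus_iff hk i).mp hi]
    exact ⟨(((k : ℕ) + 1) / 2 : ℕ) - 1, by ring⟩
  · rw [(H.hasDegree_hyperbolic_iff k i).mp hi]
    have hodd : ¬ Even (k : ℕ) := fun he => hgood ((H.isBad_iff hγ).mpr ⟨k, he, rfl⟩)
    rw [Nat.not_even_iff_odd] at hodd
    obtain ⟨m, hm⟩ := hodd
    exact ⟨m, by rw [hm]; push_cast; ring⟩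
  · rw [(H.hasDegree_plus_iff hk i).mp hi]
    exact even_two_mul _

theorem isGood_of_even (H : IsLowActionSpectrum n N eMinus h ePlus) {γ : Orbit n f ε}
    (hγ : γ.action < threshold n N) {i : ℤ} (hi : γ.HasDegree i) (he : Even i) : γ.IsGood := by
  intro hbad
  obtain ⟨k, hk, rfl⟩ := (H.isBad_iff hγ).mp hbad
  rw [(H.hasDegree_hyperbolic_iff k i).mp hi] at he
  obtain ⟨a, ha⟩ := hk
  obtain ⟨b, hb⟩ := he
  omega

theorem isBad_of_odd (H : IsLowActionSpectrum n N eMinus h ePlus) {γ : Orbit n f ε}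
    (hγ : γ.action < threshold n N) {i : ℤ} (hi : γ.HasDegree i) (ho : Odd i) : γ.IsBad := by
  by_contra hgood
  exact (Int.not_even_iff_odd.mpr ho) (H.even_of_isGood hγ hgood hi)

/-- A nonzero matrix entry would join two good orbits whose degrees differ by one, although both are
even. -/
theorem eq_zero_of_lowersDegree (H : IsLowActionSpectrum n N eMinus h ePlus)
    {d : (GoodOrbit n N f ε →₀ ℚ) →ₗ[ℚ] (GoodOrbit n N f ε →₀ ℚ)} (hd : LowersDegree d) :
    d = 0 := by
  have key : ∀ a, d (Finsupp.single a 1) = 0 := by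
    intro a
    ext b
    by_contra hne
    obtain ⟨i, ha, hb⟩ := hd a b hne
    have h1 := H.even_of_isGood a.2.1 a.2.2 ha
    have h2 := H.even_of_isGood b.2.1 b.2.2 hb
    obtain ⟨r, hr⟩ := h1
    obtain ⟨s, hs⟩ := h2
    omega
  ext1 a
  ext1
  simpa using key a

theorem orbitsOfDegree_eq (H : IsLowActionSpectrum n N eMinus h ePlus) (i : ℤ) :
    orbitsOfDegree n N f ε i =
      ((fun k => eMinus.iterate k) ''
          {k : ℕ+ | (k : ℕ) < 4 * N ∧ i = 2 * (((k : ℕ) + 1) / 2 : ℕ) - 2} ∪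
        (fun k => h.iterate k) '' {k : ℕ+ | (k : ℕ) < 4 * N ∧ i = (k : ℕ) - 1}) ∪
        (fun k => ePlus.iterate k) '' {k : ℕ+ | (k : ℕ) < 2 * n * N ∧ i = 2 * ((k : ℕ) / n : ℕ)} := by
  ext γ
  simp only [orbitsOfDegree, Set.mem_ofPred_eq, Set.mem_union, Set.mem_image]
  constructor
  · rintro ⟨hγ, hi⟩
    rcases (H.action_lt_iff γ).mp hγ with ⟨k, hk, rfl⟩ | ⟨k, hk, rfl⟩ | ⟨k, hk, rfl⟩
    · exact Or.inl (Or.inl ⟨k, ⟨hk, (H.hasDegree_minus_iff hk i).mp hi⟩, rfl⟩)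
    · exact Or.inl (Or.inr ⟨k, ⟨hk, (H.hasDegree_hyperbolic_iff k i).mp hi⟩, rfl⟩)
    · exact Or.inr ⟨k, ⟨hk, (H.hasDegree_plus_iff hk i).mp hi⟩, rfl⟩
  · rintro ((⟨k, ⟨hk, hi⟩, rfl⟩ | ⟨k, ⟨hk, hi⟩, rfl⟩) | ⟨k, ⟨hk, hi⟩, rfl⟩)
    · exact ⟨(H.action_lt_iff _).mpr (Or.inl ⟨k, hk, rfl⟩), (H.hasDegree_minus_iff hk i).mpr hi⟩
    · exact ⟨(H.action_lt_iff _).mpr (Or.inr (Or.inl ⟨k, hk, rfl⟩)),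
        (H.hasDegree_hyperbolic_iff k i).mpr hi⟩
    · exact ⟨(H.action_lt_iff _).mpr (Or.inr (Or.inr ⟨k, hk, rfl⟩)),
        (H.hasDegree_plus_iff hk i).mpr hi⟩

theorem encard_orbitsOfDegree (H : IsLowActionSpectrum n N eMinus h ePlus) (i : ℤ) :
    (orbitsOfDegree n N f ε i).encard =
      {k : ℕ+ | (k : ℕ) < 4 * N ∧ i = 2 * (((k : ℕ) + 1) / 2 : ℕ) - 2}.encard
        + {k : ℕ+ | (k : ℕ) < 4 * N ∧ i = (k : ℕ) - 1}.encard
        + {k : ℕ+ | (k : ℕ) < 2 * n * N ∧ i = 2 * ((k : ℕ) / n : ℕ)}.encard := by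
  rw [H.orbitsOfDegree_eq, Set.encard_union_eq, Set.encard_union_eq,
    H.injective_minus.encard_image, H.injective_hyperbolic.encard_image,
    H.injective_plus.encard_image]
  · rw [Set.disjoint_left]
    rintro _ ⟨j, -, rfl⟩ ⟨k, -, e⟩
    exact H.minus_ne_hyperbolic j k e.symm
  · rw [Set.disjoint_left]
    rintro _ (⟨j, -, rfl⟩ | ⟨j, -, rfl⟩) ⟨k, -, e⟩
    · exact H.minus_ne_plus j k e.symm
    · exact H.hyperbolic_ne_plus j k e.symm

end IsLowActionSpectrum

/-! ### Counting indices -/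

theorem encard_pnat_eq {P : ℕ → Prop} {a b : ℕ} (ha : 1 ≤ a)
    (h : ∀ k, 1 ≤ k → (P k ↔ a ≤ k ∧ k ≤ b)) :
    {k : ℕ+ | P k}.encard = ((b + 1 - a : ℕ) : ℕ∞) := by
  have h1 : ((fun k : ℕ+ => (k : ℕ)) '' {k : ℕ+ | P k}) = (Finset.Icc a b : Set ℕ) := by
    ext k
    simp only [Set.mem_image, Set.mem_ofPred_eq, Finset.coe_Icc, Set.mem_Icc]
    constructor
    · rintro ⟨k, hk, rfl⟩
      exact (h k k.pos).mp hk
    · intro hk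
      have hk1 : 1 ≤ k := ha.trans hk.1
      exact ⟨⟨k, hk1⟩, (h k hk1).mpr hk, rfl⟩
  rw [← PNat.coe_injective.encard_image, h1, Set.encard_coe_eq_coe_finsetCard, Nat.card_Icc]

theorem div_eq_iff_bounds {n k j : ℕ} (hn : 0 < n) : k / n = j ↔ n * j ≤ k ∧ k < n * j + n := by
  rw [Nat.div_eq_iff hn, mul_comm n j]
  omega

section Counting

variable {n N : ℕ}

/-- The solutions are `k = 2j + 1` and `k = 2j + 2`; the minimum removes the second when it reaches
`4N`. -/
theorem encard_minus (j : ℕ) : {k : ℕ+ | (k : ℕ) < 4 * N ∧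
    (2 * j : ℤ) = 2 * (((k : ℕ) + 1) / 2 : ℕ) - 2}.encard
      = ((min (2 * j + 2) (4 * N - 1) + 1 - (2 * j + 1) : ℕ) : ℕ∞) :=
  encard_pnat_eq (P := fun k => k < 4 * N ∧ (2 * j : ℤ) = 2 * ((k + 1) / 2 : ℕ) - 2) (by omega)
    fun k hk => by omega

theorem encard_hyperbolic {i : ℤ} (h0 : 0 ≤ i) (h1 : i < 4 * N - 1) :
    {k : ℕ+ | (k : ℕ) < 4 * N ∧ i = (k : ℕ) - 1}.encard = 1 := by
  rw [encard_pnat_eq (P := fun k => k < 4 * N ∧ i = k - 1) (a := i.toNat + 1) (b := i.toNat + 1)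
    (by omega) fun k hk => by omega]
  simp

/-- The solutions are `n j ≤ k < n j + n`; the maximum with `1` removes `k = 0`, which matters only
for `j = 0`. -/
theorem encard_plus (hn : 0 < n) {j : ℕ} (hj : j < 2 * N) : {k : ℕ+ | (k : ℕ) < 2 * n * N ∧
    (2 * j : ℤ) = 2 * ((k : ℕ) / n : ℕ)}.encard
      = ((n * j + n - max 1 (n * j) : ℕ) : ℕ∞) := by
  have hjn : n * j + n ≤ 2 * n * N := by nlinarith
  rw [encard_pnat_eq (P := fun k => k < 2 * n * N ∧ (2 * j : ℤ) = 2 * (k / n : ℕ))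
    (a := max 1 (n * j)) (b := n * j + n - 1) (by omega) fun k hk => ?_]
  · congr 1
    omega
  · have := div_eq_iff_bounds (k := k) (j := j) hn
    omega

end Counting

/-! ### The low action spectrum of the perturbed contact forms -/

/-! ### Numerical estimates separating rotation numbers from integers and actions from the
threshold. -/

section Angles

variable {n N k : ℕ} {ε : ℝ}

/-- The rotation number is `k/2 - δ` with `0 < δ < 1/2`, and the natural quotient `(k + 1) / 2` is
`⌈k/2⌉`. Doubling gives `k - 2δ`, strictly between `k - 1` and `k`. -/
theorem angle_minus_bounds (hk : 0 < k) (hε : 0 < ε) (hkε : k * ε < 1) (hε2 : ε ≤ 1 / 2) :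
    Real.sin (Real.pi * (2 * (k / 2 - k * ε / (8 * (1 - ε)) : ℝ))) ≠ 0 ∧
    ((((k + 1) / 2 : ℕ) : ℤ) - 1 : ℤ) < (k / 2 - k * ε / (8 * (1 - ε)) : ℝ) ∧
    (k / 2 - k * ε / (8 * (1 - ε)) : ℝ) < ((((k + 1) / 2 : ℕ) : ℤ) - 1 : ℤ) + 1 := by
  have hk' : (0 : ℝ) < k := by exact_mod_cast hk
  have h1 : 0 < k * ε / (8 * (1 - ε)) := div_pos (by positivity) (by linarith)
  have h2 : k * ε / (8 * (1 - ε)) < 1 / 2 := by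
    rw [div_lt_iff₀ (by linarith)]
    linarith
  set δ := k * ε / (8 * (1 - ε)) with hδ
  have h3 : k ≤ 2 * ((k + 1) / 2) := by omega
  have h4 : 2 * ((k + 1) / 2) ≤ k + 1 := by omega
  have h3' : (k : ℝ) ≤ 2 * ((k + 1) / 2 : ℕ) := by exact_mod_cast h3
  have h4' : 2 * (((k + 1) / 2 : ℕ) : ℝ) ≤ k + 1 := by exact_mod_cast h4
  generalize (k + 1) / 2 = j at *
  refine ⟨sin_pi_mul_ne_zero (d := 1) (i := k - 1) ?_ ?_, ?_, ?_⟩ <;> push_cast <;> linarith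

theorem angle_plus_bounds (hn : 0 < n) (hk : 0 < k) (hε : 0 < ε) (hkε : k * ε < 1) :
    Real.sin (Real.pi * (2 * (k / n + k * ε / (4 * n * (1 + ε)) : ℝ))) ≠ 0 ∧
    ((k / n : ℕ) : ℤ) < (k / n + k * ε / (4 * n * (1 + ε)) : ℝ) ∧
    (k / n + k * ε / (4 * n * (1 + ε)) : ℝ) < ((k / n : ℕ) : ℤ) + 1 := by
  have hk' : (0 : ℝ) < k := by exact_mod_cast hk
  have hn' : (0 : ℝ) < n := by exact_mod_cast hn
  set δ := k * ε / (4 * (1 + ε)) with hδ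
  have h1 : 0 < δ := div_pos (by positivity) (by linarith)
  have h2 : δ < 1 / 4 := by
    rw [div_lt_iff₀ (by linarith)]
    linarith
  have e : (k / n + k * ε / (4 * n * (1 + ε)) : ℝ) = (k + δ) / n := by
    rw [hδ]
    field_simp
  have h3 : n * (k / n) ≤ k := Nat.mul_div_le k n
  have h4 : k + 1 ≤ n * (k / n) + n := Nat.lt_mul_div_succ k hn
  have h3' : (n : ℝ) * (k / n : ℕ) ≤ k := by exact_mod_cast h3
  have h4' : (k : ℝ) + 1 ≤ n * (k / n : ℕ) + n := by exact_mod_cast h4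
  have e2 : ((n : ℤ) : ℝ) * (2 * ((k + δ) / n)) = 2 * k + 2 * δ := by
    push_cast
    field_simp
  rw [e]
  generalize k / n = j at *
  -- Multiplied by `n`, twice the rotation number is `2k + 2δ` with `δ < 1/4`, so it lies strictly
  -- between `2k` and `2k + 1`.
  refine ⟨sin_pi_mul_ne_zero (d := n) (i := 2 * k) ?_ ?_, ?_, ?_⟩
  · rw [e2]; push_cast; linarith
  · rw [e2]; push_cast; linarith
  · rw [lt_div_iff₀ hn']; push_cast; linarith
  · rw [div_lt_iff₀ hn']; push_cast; linarith

/-- After division by `π`, the iterate `k = 4N` gives `2N - 2Nε`, which stays above `2N - 1/(2n)`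
exactly when `4nNε ≤ 1`. The iterate `k = 4N - 1` lies below `2N - 1/2`, hence below the threshold.
-/
theorem action_minus_lt_iff (hn : 2 ≤ n) (hN : 1 ≤ N) (hε : 0 < ε) (hnN : 4 * n * N * ε ≤ 1) :
    k * (Real.pi / 2 * (1 - ε)) < threshold n N ↔ k < 4 * N := by
  have hpi := Real.pi_pos
  have hn' : (2 : ℝ) ≤ n := by exact_mod_cast hn
  have hN' : (1 : ℝ) ≤ N := by exact_mod_cast hN
  have e : threshold n N = Real.pi * (2 * N - 1 / (2 * n)) := by
    rw [threshold]; ring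
  have e1 : (k : ℝ) * (Real.pi / 2 * (1 - ε)) = Real.pi * (k * (1 - ε) / 2) := by ring
  rw [e, e1, mul_lt_mul_iff_right₀ hpi]
  have h1 : 1 / (2 * n) ≤ (1 / 4 : ℝ) := by
    rw [div_le_div_iff₀ (by positivity) (by norm_num)]
    linarith
  have h0 : 0 < 1 / (2 * n : ℝ) := by positivity
  have h2 : 2 * N * ε ≤ 1 / (2 * n) := by
    rw [le_div_iff₀ (by positivity)]
    linarith
  have hε1 : ε < 1 := by nlinarith
  constructor
  · intro h
    by_contra hcon
    have hk : (4 * N : ℝ) ≤ k := by exact_mod_cast not_lt.mp hcon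
    nlinarith
  · intro h
    have hk : (k : ℝ) + 1 ≤ 4 * N := by exact_mod_cast h
    nlinarith

theorem action_hyperbolic_lt_iff (hn : 2 ≤ n) :
    k * (Real.pi / 2) < threshold n N ↔ k < 4 * N := by
  have hpi := Real.pi_pos
  have hn' : (2 : ℝ) ≤ n := by exact_mod_cast hn
  have e : threshold n N = Real.pi * (2 * N - 1 / (2 * n)) := by
    rw [threshold]; ring
  have e1 : (k : ℝ) * (Real.pi / 2) = Real.pi * (k / 2) := by ring
  rw [e, e1, mul_lt_mul_iff_right₀ hpi]
  have h1 : 1 / (2 * n) ≤ (1 / 4 : ℝ) := by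
    rw [div_le_div_iff₀ (by positivity) (by norm_num)]
    linarith
  have h0 : 0 < 1 / (2 * n : ℝ) := by positivity
  constructor
  · intro h
    have hk : (k : ℝ) < 4 * N := by linarith
    exact_mod_cast hk
  · intro h
    have hk : (k : ℝ) + 1 ≤ 4 * N := by exact_mod_cast h
    linarith

/-- In units of `π/n` the threshold is `2nN - 1/2`. The same smallness of `ε` keeps `(2nN - 1)(1 +
ε)` below it. -/
theorem action_plus_lt_iff (hn : 2 ≤ n) (hε : 0 < ε) (hnN : 4 * n * N * ε ≤ 1) :
    k * (Real.pi / n * (1 + ε)) < threshold n N ↔ k < 2 * n * N := by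
  have hpi := Real.pi_pos
  have hn' : (2 : ℝ) ≤ n := by exact_mod_cast hn
  have e : threshold n N = Real.pi / n * (2 * n * N - 1 / 2) := by
    rw [threshold]
    field_simp
  have e1 : (k : ℝ) * (Real.pi / n * (1 + ε)) = Real.pi / n * (k * (1 + ε)) := by ring
  rw [e, e1, mul_lt_mul_iff_right₀ (by positivity)]
  constructor
  · intro h
    have hk : (k : ℝ) < 2 * n * N := by
      have : (0 : ℝ) ≤ k * ε := by positivity
      linarith
    exact_mod_cast hk
  · intro h
    have hk : (k : ℝ) + 1 ≤ 2 * n * N := by exact_mod_cast h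
    nlinarith

end Angles

theorem IsDihedralMorse.cover_invariant {n : ℕ} {f : S2 → ℝ} (hf : IsDihedralMorse n f) :
    ∀ g ∈ binaryDihedral n, ∀ p, f (cover g • p) = f p :=
  fun _ hg p => hf.invariant _ (Subgroup.mem_map_of_mem cover hg) p

/-- Here dynamics and group theory meet: low action confines an orbit to a critical fibre, the
dihedral symmetry moves that fibre to one of three standard ones, and the flow there is explicit. -/
theorem exists_isLowActionSpectrum {n N : ℕ} (hn : 2 ≤ n) (hN : 1 ≤ N) {f : S2 → ℝ}
    (hf : IsDihedralMorse n f) :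
    ∃ ε₀ : ℝ, 0 < ε₀ ∧ ∀ ε : ℝ, 0 < ε → ε ≤ ε₀ → (∀ p : S2, 0 < 1 + ε * f p) ∧
      ∃ eMinus h ePlus : Orbit n f ε, IsLowActionSpectrum n N eMinus h ePlus ∧
        eMinus.IsEmbedded ∧ h.IsEmbedded ∧ ePlus.IsEmbedded ∧
        (∀ k, (eMinus.iterate k).ProjectsTo (Base.mk (binaryDihedral n) (pMinus n n))) ∧
        (∀ k, (h.iterate k).ProjectsTo (Base.mk (binaryDihedral n) (pH n n))) ∧
        (∀ k, (ePlus.iterate k).ProjectsTo (Base.mk (binaryDihedral n) pPlus)) ∧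
        (∀ k : ℕ+, (eMinus.iterate k).action = k * Real.pi * (1 - ε) / 2) ∧
        (∀ k : ℕ+, (h.iterate k).action = k * Real.pi / 2) ∧
        (∀ k : ℕ+, (ePlus.iterate k).action = k * Real.pi * (1 + ε) / n) ∧
        ePlus.iterate 1 = ePlus ∧ eMinus.iterate 1 = eMinus ∧
        pMinus n n ∈ critPoints f ∧ pH n n ∈ critPoints f ∧ pPlus ∈ critPoints f := by
  have hn0 : n ≠ 0 := by omega
  have hnR : (2 : ℝ) ≤ n := by exact_mod_cast hn
  have hNR : (1 : ℝ) ≤ N := by exact_mod_cast hN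
  have hpi := Real.pi_pos
  have hfs := hf.smooth
  have hG := hf.cover_invariant
  have : Finite (binaryDihedral n) := finite_binaryDihedral hn0
  have hcard : (0 : ℝ) < Nat.card (binaryDihedral n) := by exact_mod_cast Nat.card_pos
  have hthr : 0 < threshold n N := by
    have e : threshold n N = Real.pi * (2 * N - 1 / (2 * n)) := by
      rw [threshold]; ring
    have h1 : 1 / (2 * n) ≤ (1 / 4 : ℝ) := by
      rw [div_le_div_iff₀ (by positivity) (by norm_num)]
      linarith
    rw [e]
    exact mul_pos hpi (by linarith)
  obtain ⟨C, hC, hcrit⟩ := exists_short_orbits_critical hfs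
  obtain ⟨b, hb⟩ := isCompact_univ.exists_bound_of_continuousOn hfs.continuous.continuousOn
  have hb' : ∀ p, |f p| ≤ |b| := fun p => (hb p trivial).trans (le_abs_self b)
  have hM0 := hopf_equatorLift ((Real.pi + 2 * n * Real.pi) / n)
  have hH0 := hopf_equatorLift (2 * n * Real.pi / n)
  have hP0 := hopf_poleLift
  have aM := isAxis_minimum hn0
  have aH := isAxis_saddle hn0
  have aP := isAxis_poleLift hn0
  set zM := equatorLift ((Real.pi + 2 * n * Real.pi) / n) with hzM
  set zH := equatorLift (2 * n * Real.pi / n) with hzH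
  set zP := poleLift with hzP
  have fM : HasStereographicForm f (hopf zM) fun x y => -1 + (1 * x ^ 2 + 1 * y ^ 2) / 2 := by
    rw [hM0]
    refine Eq.subst (motive := HasStereographicForm f _) ?_ (hf.minimum n (by omega) le_rfl)
    funext x y
    ring
  have fH : HasStereographicForm f (hopf zH) fun x y => 0 + (1 * x ^ 2 + -1 * y ^ 2) / 2 := by
    rw [hH0]
    refine Eq.subst (motive := HasStereographicForm f _) ?_ (hf.saddle n (by omega) le_rfl)
    funext x y
    ring
  have fP : HasStereographicForm f (hopf zP) fun x y => 1 + (-1 * x ^ 2 + -1 * y ^ 2) / 2 := by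
    rw [hP0]
    refine Eq.subst (motive := HasStereographicForm f _) ?_ (hf.maximum pPlus (Or.inl rfl))
    funext x y
    ring
  obtain ⟨_, _, nM⟩ := fM.exists_normalFrame
  obtain ⟨_, _, nH⟩ := fH.exists_normalFrame
  obtain ⟨_, _, nP⟩ := fP.exists_normalFrame
  have cM := nM.homGrad_eq_zero
  have cH := nH.homGrad_eq_zero
  have cP := nP.homGrad_eq_zero
  have vM := nM.value
  have vH := nH.value
  have vP := nP.value
  -- The three bounds serve, in order, the comparison of actions with the threshold and of rotation
  -- numbers with integers, the inequality `1 + ε f ≥ 1/2`, and the short period criterion for the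
  -- lifted period, which is below `|G| L_N`.
  refine ⟨min (1 / (4 * n * N)) (min (1 / (2 * (|b| + 1)))
    (1 / (C * (Nat.card (binaryDihedral n) * threshold n N)))), by positivity,
    fun ε hε hle => ?_⟩
  have hnN : 4 * n * N * ε ≤ 1 := by
    have := hle.trans (min_le_left _ _)
    rw [le_div_iff₀ (by positivity)] at this
    linarith
  have hεb : ε * |b| ≤ 1 / 2 := by
    have := hle.trans ((min_le_right _ _).trans (min_le_left _ _))
    rw [le_div_iff₀ (by positivity)] at this
    nlinarith
  have hεC : ε * (C * (Nat.card (binaryDihedral n) * threshold n N)) ≤ 1 := by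
    have := hle.trans ((min_le_right _ _).trans (min_le_right _ _))
    rwa [le_div_iff₀ (by positivity)] at this
  have hNn : (2 : ℝ) ≤ n * N := by nlinarith
  have hε2 : ε ≤ 1 / 8 := by nlinarith
  have hhalf : ∀ p : S2, 1 / 2 ≤ 1 + ε * f p := by
    intro p
    have h1 := (abs_le.mp (hb' p)).1
    nlinarith
  have hpos : ∀ p : S2, 0 < 1 + ε * f p := fun p => lt_of_lt_of_le (by norm_num) (hhalf p)
  set eM := axisOrbit hfs hpos aM cM with heM
  set eH := axisOrbit hfs hpos aH cH with heH
  set eP := axisOrbit hfs hpos aP cP with heP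
  have actM : ∀ k : ℕ+, (eM.iterate k).action = k * (Real.pi / 2 * (1 - ε)) := fun k => by
    rw [heM, action_axisOrbit_iterate, vM]; ring
  have actH : ∀ k : ℕ+, (eH.iterate k).action = k * (Real.pi / 2) := fun k => by
    rw [heH, action_axisOrbit_iterate, vH]; ring
  have actP : ∀ k : ℕ+, (eP.iterate k).action = k * (Real.pi / n * (1 + ε)) := fun k => by
    rw [heP, action_axisOrbit_iterate, vP]; ring
  have projM := projectsTo_axisOrbit_iterate hfs hpos aM cM
  have projH := projectsTo_axisOrbit_iterate hfs hpos aH cH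
  have projP := projectsTo_axisOrbit_iterate hfs hpos aP cP
  have hexists : ∀ γ : Orbit n f ε, γ.action < threshold n N →
      (∃ k, γ = eM.iterate k) ∨ (∃ k, γ = eH.iterate k) ∨ (∃ k, γ = eP.iterate k) := by
    intro γ hγ
    obtain ⟨c, rfl⟩ := Quotient.exists_rep γ
    have hγ' : c.period < threshold n N := hγ
    obtain ⟨l, hl, hl0, hlper⟩ := c.exists_lift hfs hpos hG
    -- The criterion applies to the closed lift in `S³`; its strict inequality comes from `c.period
    -- < threshold n N`.
    have hgrad := hcrit ε hε hhalf l hl _ (mul_pos hcard c.period_pos) hlper (by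
      refine lt_of_lt_of_le ?_ hεC
      rw [mul_assoc]
      have := c.period_pos
      gcongr) 0
    have hfix := mem_critPoints_of_homGrad_eq_zero hfs hgrad
    rw [hf.crit] at hfix
    obtain ⟨g, hg, hcases⟩ := fixedPoints_cases hn0 hfix
    have hphase : ∀ z : S3, hopf (l 0) = cover g • hopf z →
        ∃ s, c.curve 0 = Link.mk _ (phase s z) := by
      intro z hz
      rw [← hopf_smul] at hz
      obtain ⟨θ, hθ⟩ := exists_phase_eq hz.symm
      exact ⟨θ, by rw [← hl0, hθ, ← smul_phase, Link.mk_smul hg]⟩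
    rcases hcases with h | h | h
    · obtain ⟨s, hs⟩ := hphase zM (by rw [hM0]; exact h)
      exact Or.inl (mk_eq_axisOrbit_iterate hfs hpos aM cM hG c hs)
    · obtain ⟨s, hs⟩ := hphase zH (by rw [hH0]; exact h)
      exact Or.inr (Or.inl (mk_eq_axisOrbit_iterate hfs hpos aH cH hG c hs))
    · obtain ⟨s, hs⟩ := hphase zP (by rw [hP0]; exact h)
      exact Or.inr (Or.inr (mk_eq_axisOrbit_iterate hfs hpos aP cP hG c hs))
  have hspec : IsLowActionSpectrum n N eM eH eP :=
    { action_lt_iff := by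
        intro γ
        constructor
        · intro hγ
          rcases hexists γ hγ with ⟨k, rfl⟩ | ⟨k, rfl⟩ | ⟨k, rfl⟩
          · rw [actM, action_minus_lt_iff hn hN hε hnN] at hγ
            exact Or.inl ⟨k, hγ, rfl⟩
          · rw [actH, action_hyperbolic_lt_iff hn] at hγ
            exact Or.inr (Or.inl ⟨k, hγ, rfl⟩)
          · rw [actP, action_plus_lt_iff hn hε hnN] at hγ
            exact Or.inr (Or.inr ⟨k, hγ, rfl⟩)
        · rintro (⟨k, hk, rfl⟩ | ⟨k, hk, rfl⟩ | ⟨k, hk, rfl⟩)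
          · rwa [actM, action_minus_lt_iff hn hN hε hnN]
          · rwa [actH, action_hyperbolic_lt_iff hn]
          · rwa [actP, action_plus_lt_iff hn hε hnN]
      elliptic_minus := by
        intro k hk
        have hkε : (k : ℕ) * ε < 1 := by
          have h1 : ((k : ℕ) : ℝ) < 4 * N := by exact_mod_cast hk
          nlinarith
        refine ⟨_, ⟨_, ?_, fun t ht v => flowMatrix_elliptic hfs hpos aM cM hG fM k ht v⟩,
          angle_minus_bounds k.pos hε hkε (by linarith)⟩
        rw [actM]
        have : (1 - ε) ≠ 0 := by linarith
        rw [show 1 + ε * -1 = 1 - ε by ring]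
        field_simp
        ring
      hyperbolic := by
        intro k
        obtain ⟨τ, hτ, hfl⟩ := flowMatrix_hyperbolic hfs hpos aH cH hG fH k
        refine ⟨_, _, τ, hτ, ?_, ?_, hfl⟩
        · rw [mul_zero, add_zero]
          positivity
        · rw [actH, mul_zero, add_zero]
          push_cast
          ring
      elliptic_plus := by
        intro k hk
        have hkε : (k : ℕ) * ε < 1 := by
          have h1 : ((k : ℕ) : ℝ) < 2 * n * N := by exact_mod_cast hk
          nlinarith
        refine ⟨_, ⟨_, ?_, fun t ht v => flowMatrix_elliptic hfs hpos aP cP hG fP k ht v⟩,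
          angle_plus_bounds (by omega) k.pos hε hkε⟩
        rw [actP, mul_one]
        field_simp
        ring
      iterate_one := axisOrbit_iterate_one hfs hpos aH cH
      injective_minus := axisOrbit_iterate_injective hfs hpos aM cM
      injective_hyperbolic := axisOrbit_iterate_injective hfs hpos aH cH
      injective_plus := axisOrbit_iterate_injective hfs hpos aP cP
      -- The three families are told apart by the critical values `-1`, `0` and `1`, which an
      -- invariant function carries down to the orbifold.
      minus_ne_hyperbolic := by
        intro j k e
        have := (projM j).apply_eq hG (e ▸ projH k)
        rw [vM, vH] at this
        norm_num at this
      minus_ne_plus := by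
        intro j k e
        have := (projM j).apply_eq hG (e ▸ projP k)
        rw [vM, vP] at this
        norm_num at this
      hyperbolic_ne_plus := by
        intro j k e
        have := (projH j).apply_eq hG (e ▸ projP k)
        rw [vH, vP] at this
        norm_num at this }
  rw [hM0] at projM
  rw [hH0] at projH
  rw [hP0] at projP
  refine ⟨hpos, eM, eH, eP, hspec, isEmbedded_axisOrbit hfs hpos aM cM,
    isEmbedded_axisOrbit hfs hpos aH cH, isEmbedded_axisOrbit hfs hpos aP cP, projM, projH, projP,
    fun k => by rw [actM]; ring, fun k => by rw [actH]; ring, fun k => by rw [actP]; ring,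
    axisOrbit_iterate_one hfs hpos aP cP, axisOrbit_iterate_one hfs hpos aM cM, ?_, ?_, ?_⟩
  · have := mem_critPoints_of_homGrad_eq_zero hfs cM
    rwa [hM0] at this
  · have := mem_critPoints_of_homGrad_eq_zero hfs cH
    rwa [hH0] at this
  · have := mem_critPoints_of_homGrad_eq_zero hfs cP
    rwa [hP0] at this

end BinaryDihedral

end

/-! ### Assembling the statement: indices, counts in each degree, vanishing of the differential. -/

open BinaryDihedral in
theorem lemma3p1 (n N : ℕ) (hn : 2 ≤ n) (hN : 1 ≤ N) (f : S2 → ℝ) (hf : IsDihedralMorse n f) :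
    ∃ ε₀ : ℝ, 0 < ε₀ ∧ ∀ ε : ℝ, 0 < ε → ε ≤ ε₀ →
      -- the perturbed form is a contact form
      (∀ p : S2, 0 < 1 + ε * f p) ∧
      -- nondegeneracy, and projection to orbifold critical points
      (∀ γ : Orbit n f ε, γ.action < threshold n N →
        γ.IsNondegenerate ∧
        ∃ p ∈ critPoints f, γ.ProjectsTo (Base.mk (binaryDihedral n) p)) ∧
      -- the orbits, their actions and their indices
      (∃ eMinus h ePlus : Orbit n f ε,
        eMinus.IsEmbedded ∧ eMinus.ProjectsTo (Base.mk (binaryDihedral n) (pMinus n n)) ∧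
        h.IsEmbedded ∧ h.ProjectsTo (Base.mk (binaryDihedral n) (pH n n)) ∧
        ePlus.IsEmbedded ∧ ePlus.ProjectsTo (Base.mk (binaryDihedral n) pPlus) ∧
        (∀ k : ℕ+, (eMinus.iterate k).action = k * Real.pi * (1 - ε) / 2) ∧
        (∀ k : ℕ+, (h.iterate k).action = k * Real.pi / 2) ∧
        (∀ k : ℕ+, (ePlus.iterate k).action = k * Real.pi * (1 + ε) / n) ∧
        {γ : Orbit n f ε | γ.action < threshold n N} =
          {γ | ∃ k : ℕ+, (k : ℕ) < 4 * N ∧ γ = eMinus.iterate k} ∪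
          {γ | ∃ k : ℕ+, (k : ℕ) < 4 * N ∧ γ = h.iterate k} ∪
          {γ | ∃ k : ℕ+, (k : ℕ) < 2 * n * N ∧ γ = ePlus.iterate k} ∧
        (∀ k : ℕ+, (k : ℕ) < 4 * N →
          (eMinus.iterate k).HasIndex (2 * ⌈((k : ℕ) : ℚ) / 2⌉ - 1)) ∧
        (∀ k : ℕ+, (k : ℕ) < 4 * N → (h.iterate k).HasIndex ((k : ℕ) : ℤ)) ∧
        (∀ k : ℕ+, (k : ℕ) < 2 * n * N →
          (ePlus.iterate k).HasIndex (2 * ⌊((k : ℕ) : ℚ) / n⌋ + 1))) ∧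
      -- the number of orbits in each degree
      (∀ i : ℤ, i < 0 ∨ 4 * (N : ℤ) - 2 < i → (orbitsOfDegree n N f ε i).encard = 0) ∧
      (∀ i : ℤ, i = 0 ∨ i = 4 * (N : ℤ) - 2 →
        (orbitsOfDegree n N f ε i).encard = n + 2 ∧
        ∀ γ ∈ orbitsOfDegree n N f ε i, γ.IsGood) ∧
      (∀ i : ℤ, Even i → 0 < i → i < 4 * (N : ℤ) - 2 →
        (orbitsOfDegree n N f ε i).encard = n + 3 ∧
        ∀ γ ∈ orbitsOfDegree n N f ε i, γ.IsGood) ∧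
      (∀ i : ℤ, Odd i → 0 < i → i < 4 * (N : ℤ) - 2 →
        (orbitsOfDegree n N f ε i).encard = 1 ∧
        ∀ γ ∈ orbitsOfDegree n N f ε i, γ.IsBad) ∧
      -- the filtered differential vanishes
      (∀ d : (GoodOrbit n N f ε →₀ ℚ) →ₗ[ℚ] (GoodOrbit n N f ε →₀ ℚ),
        LowersDegree d → d = 0) := by
  obtain ⟨ε₀, hε₀, H₀⟩ := exists_isLowActionSpectrum hn hN hf
  refine ⟨ε₀, hε₀, fun ε hε hle => ?_⟩
  obtain ⟨hpos, eMinus, h, ePlus, H, embM, embH, embP, projM, projH, projP, actM, actH, actP,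
    oneP, oneM, critM, critH, critP⟩ := H₀ ε hε hle
  have hmem : ∀ {i : ℤ} {γ : Orbit n f ε}, γ ∈ orbitsOfDegree n N f ε i →
    γ.action < threshold n N ∧ γ.HasDegree i := fun h => h
  refine ⟨hpos, fun γ hγ => ⟨H.isNondegenerate hγ, ?_⟩,
    ⟨eMinus, h, ePlus, embM, oneM ▸ projM 1, embH, H.iterate_one ▸ projH 1, embP, oneP ▸ projP 1,
      actM, actH, actP, ?_, fun k hk => ?_, fun k hk => ?_, fun k hk => ?_⟩,
    fun i hi => ?_, fun i hi => ⟨?_, fun γ hγ => ?_⟩, fun i he h0 h1 => ⟨?_, fun γ hγ => ?_⟩,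
    fun i ho h0 h1 => ⟨?_, fun γ hγ => ?_⟩, fun d hd => H.eq_zero_of_lowersDegree hd⟩
  · rcases (H.action_lt_iff γ).mp hγ with ⟨k, -, rfl⟩ | ⟨k, -, rfl⟩ | ⟨k, -, rfl⟩
    · exact ⟨_, critM, projM k⟩
    · exact ⟨_, critH, projH k⟩
    · exact ⟨_, critP, projP k⟩
  · ext γ
    rw [Set.union_assoc]
    exact H.action_lt_iff γ
  · have e : ⌈((k : ℕ) : ℚ) / 2⌉ = ((((k : ℕ) + 1) / 2 : ℕ) : ℤ) := by
      rw [Int.ceil_eq_iff]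
      have h1 : (k : ℕ) ≤ 2 * (((k : ℕ) + 1) / 2) := by omega
      have h2 : 2 * (((k : ℕ) + 1) / 2) ≤ (k : ℕ) + 1 := by omega
      have h1' : ((k : ℕ) : ℚ) ≤ 2 * (((k : ℕ) + 1) / 2 : ℕ) := by exact_mod_cast h1
      have h2' : 2 * ((((k : ℕ) + 1) / 2 : ℕ) : ℚ) ≤ (k : ℕ) + 1 := by exact_mod_cast h2
      rw [Int.cast_natCast]
      constructor <;> linarith
    have := (H.hasDegree_minus_iff hk (2 * (((k : ℕ) + 1) / 2 : ℕ) - 2)).mpr rfl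
    rw [e, show 2 * ((((k : ℕ) + 1) / 2 : ℕ) : ℤ) - 1 = 2 * (((k : ℕ) + 1) / 2 : ℕ) - 2 + 1 by ring]
    exact this
  · have := (H.hasDegree_hyperbolic_iff k ((k : ℕ) - 1)).mpr rfl
    rw [ReebOrbit.HasDegree, sub_add_cancel] at this
    exact this
  · have e : ⌊((k : ℕ) : ℚ) / n⌋ = (((k : ℕ) / n : ℕ) : ℤ) := by
      rw [Rat.floor_natCast_div_natCast, Int.natCast_div]
    rw [e]
    exact (H.hasDegree_plus_iff hk (2 * ((k : ℕ) / n : ℕ))).mpr rfl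
  · rw [Set.encard_eq_zero, Set.eq_empty_iff_forall_notMem]
    intro γ hγ
    obtain ⟨h1, h2⟩ := hmem hγ
    rcases (H.action_lt_iff γ).mp h1 with ⟨k, hk, rfl⟩ | ⟨k, hk, rfl⟩ | ⟨k, hk, rfl⟩
    · have := (H.hasDegree_minus_iff hk i).mp h2
      have := k.pos
      omega
    · have := (H.hasDegree_hyperbolic_iff k i).mp h2
      have := k.pos
      omega
    · have := (H.hasDegree_plus_iff hk i).mp h2
      have hlt : (k : ℕ) / n < 2 * N := by
        rw [Nat.div_lt_iff_lt_mul (by omega)]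
        calc (k : ℕ) < 2 * n * N := hk
          _ = 2 * N * n := by ring
      generalize (k : ℕ) / n = m at this hlt
      omega
  · rw [H.encard_orbitsOfDegree]
    rcases hi with rfl | rfl
    -- Degree `0`: two iterates of `e_-`, one of `h`, and `n - 1` of `e_+`, since `k = 0` is not an
    -- orbit.
    · have e1 := encard_minus (N := N) 0
      have e2 := encard_plus (n := n) (N := N) (by omega) (j := 0) (by omega)
      rw [Nat.cast_zero, mul_zero] at e1 e2
      rw [e1, encard_hyperbolic le_rfl (by omega), e2,
        show min (2 * 0 + 2) (4 * N - 1) + 1 - (2 * 0 + 1) = 2 by omega,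
        show n * 0 + n - max 1 (n * 0) = n - 1 by simp]
      norm_cast
      omega
    -- Top degree: one iterate of `e_-`, since `k = 4N` exceeds the threshold, one of `h`, and `n`
    -- of `e_+`.
    · have e1 := encard_minus (N := N) (2 * N - 1)
      have e2 := encard_plus (n := n) (N := N) (by omega) (j := 2 * N - 1) (by omega)
      have e : (2 * (2 * N - 1 : ℕ) : ℤ) = 4 * N - 2 := by omega
      rw [e] at e1 e2
      have hpos' : 1 ≤ n * (2 * N - 1) := Nat.mul_pos (by omega) (by omega)
      rw [e1, encard_hyperbolic (by omega) (by omega), e2,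
        show min (2 * (2 * N - 1) + 2) (4 * N - 1) + 1 - (2 * (2 * N - 1) + 1) = 1 by omega,
        max_eq_right hpos', Nat.add_sub_cancel_left]
      norm_cast
      omega
  · refine H.isGood_of_even (hmem hγ).1 (hmem hγ).2 ?_
    rcases hi with rfl | rfl
    · exact Even.zero
    · exact ⟨2 * N - 1, by ring⟩
  · obtain ⟨j, rfl⟩ := he.two_dvd
    lift j to ℕ using by omega
    have hpos' : 1 ≤ n * j := Nat.mul_pos (by omega) (by omega)
    rw [H.encard_orbitsOfDegree, encard_minus, encard_hyperbolic (by omega) (by omega),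
      encard_plus (by omega) (by omega),
      show min (2 * j + 2) (4 * N - 1) + 1 - (2 * j + 1) = 2 by omega, max_eq_right hpos',
      Nat.add_sub_cancel_left]
    norm_cast
    omega
  · exact H.isGood_of_even (hmem hγ).1 (hmem hγ).2 he
  · obtain ⟨j, rfl⟩ := ho
    -- Both elliptic families live in even degrees, so an odd degree contains only an iterate of
    -- `h`.
    have e1 : {k : ℕ+ | (k : ℕ) < 4 * N ∧ 2 * j + 1 = 2 * (((k : ℕ) + 1) / 2 : ℕ) - 2} = ∅ := by
      rw [Set.eq_empty_iff_forall_notMem]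
      rintro k ⟨-, hk⟩
      omega
    have e2 : {k : ℕ+ | (k : ℕ) < 2 * n * N ∧ 2 * j + 1 = 2 * ((k : ℕ) / n : ℕ)} = ∅ := by
      rw [Set.eq_empty_iff_forall_notMem]
      rintro k ⟨-, hk⟩
      generalize (k : ℕ) / n = m at hk
      omega
    rw [H.encard_orbitsOfDegree, e1, e2, encard_hyperbolic (by omega) (by omega),
      Set.encard_empty, zero_add, add_zero]
  · exact H.isBad_of_odd (hmem hγ).1 (hmem hγ).2 ho
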